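/- \textbf{Theorem.} A \emph{monomer-dimer instance} is a pair $\mathcal I=(G,\lambda)$ of a finite simple undirected graph $G=(V,E)$ with $n=|V|$ vertices and a real number $\lambda>0$. A \emph{matching} of $G$ is a set $M\subseteq E$ in which no two distinct edges share an endpoint, and $\mu_{\mathcal I}$ denotes the probability distribution on the matchings of $G$ with $\mu_{\mathcal I}(M)=\lambda^{|M|}/Z_{\mathcal I}$, where $Z_{\mathcal I}=\sum_{M}\lambda^{|M|}$. A class $\mathfrak G$ of graphs has \emph{sub-exponential neighborhood growth} if there is a function $s:\mathbb N\to\mathbb N$ with $s(\ell)=\exp(o(\ell))$ as $\ell\to\infty$ such that for every $G=(V,E)\in\mathfrak G$, every $v\in V$ and every $\ell\ge 0$, at most $s(\ell)$ vertices are at distance exactly $\ell$ from $v$ in $G$. Let $\mathfrak M$ be a class of monomer-dimer instances whose graphs form a class with sub-exponential neighborhood growth, and suppose that there is a constant $C$ with $\lambda\le C$ for all $(G,\lambda)\in\mathfrak M$. Then there exist an algorithm and a constant $K$, both depending only on $\mathfrak M$, such that on every instance $\mathcal I=(G,\lambda)\in\mathfrak M$ (with $G$ given by adjacency lists in any order)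 the algorithm halts with probability one, outputs a perfect sample from $\mu_{\mathcal I}$ (that is, for every matching $M$ of $G$ the probability that the output is $M$ is exactly $\mu_{\mathcal I}(M)$), and has expected running time at most $K(n+1)$, that is, $O(n)$. Here an algorithm is a program for a randomized random access machine that performs each of the following in unit time: addition, truncated subtraction, comparison and indirect addressing for natural numbers; arithmetic and comparison for real numbers (with $\lambda$ given as a real number); printing a natural number; and a fresh independent coin flip whose success probability is a real number that the machine has computed. -/

import Mathlib

open Filter
open scoped ENNReal Asymptotics

noncomputable section

/-! ## The monomer-dimer model -/

/-- A finite (simple, undirected) graph with vertex set `{0, …, n - 1}`. -/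
abbrev FinGraph : Type := (n : ℕ) × SimpleGraph (Fin n)

/-- The sphere of radius `ℓ` around `v`. The extended distance makes sure that vertices in other
components belong to no sphere. -/
def SimpleGraph.sphereAt {V : Type*} (G : SimpleGraph V) (v : V) (ℓ : ℕ) : Set V :=
  {u | G.edist v u = (ℓ : ℕ∞)}

/-- A class of graphs has sub-exponential neighborhood growth if there is `s : ℕ → ℕ` with
`s ℓ = exp (o(ℓ))` that bounds the size of every sphere of radius `ℓ` in every graph of the
class. -/
def SubexponentialGrowth (𝔊 : Set FinGraph) : Prop :=
  ∃ s : ℕ → ℕ,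
    (∃ f : ℕ → ℝ, f =o[atTop] (fun ℓ : ℕ => (ℓ : ℝ)) ∧ ∀ ℓ, (s ℓ : ℝ) = Real.exp (f ℓ)) ∧
    ∀ G ∈ 𝔊, ∀ (v : Fin G.1) (ℓ : ℕ), (G.2.sphereAt v ℓ).ncard ≤ s ℓ

/-- An instance of the monomer-dimer model: a finite graph and an edge weight `λ > 0`. -/
structure MonomerDimer where
  graph : FinGraph
  lam : ℝ
  lam_pos : 0 < lam

namespace MonomerDimer

variable (I : MonomerDimer)

/-- The number of vertices. -/
abbrev n : ℕ := I.graph.1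

/-- A set of edges of the graph in which no two distinct edges share an endpoint. -/
def IsMatching (M : Finset (Sym2 (Fin I.n))) : Prop :=
  (∀ e ∈ M, e ∈ I.graph.2.edgeSet) ∧
    ∀ e ∈ M, ∀ f ∈ M, ∀ v : Fin I.n, v ∈ e → v ∈ f → e = f

open Classical in
/-- The weight `λ ^ |M|` of a matching `M`; other edge sets have weight zero. -/
def weight (M : Finset (Sym2 (Fin I.n))) : ℝ :=
  if I.IsMatching M then I.lam ^ M.card else 0

/-- The partition function. -/
def partitionFunction : ℝ := ∑ M : Finset (Sym2 (Fin I.n)), I.weight M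

/-- The weighted matching distribution `μ(M) = λ ^ |M| / Z`. -/
def gibbs (M : Finset (Sym2 (Fin I.n))) : ℝ := I.weight M / I.partitionFunction

end MonomerDimer

/-! ## Randomized random access machines

The machine has integer registers, finitely many randomly accessible integer arrays (a program
names its arrays by constants), and, for exact arithmetic with the weight `λ` and with
probabilities, real registers and real arrays. Integers can be added and subtracted but not
multiplied, and reals can never be converted into integers. Every elementary operation, test and
coin flip takes one unit of time. Control flow is structured. -/

namespace RAM

/-- The contents of the memory, and the output written so far. -/
structure State where
  reg : ℕ → ℕ
  arr : ℕ → ℕ → ℕ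
  rreg : ℕ → ℝ
  rarr : ℕ → ℕ → ℝ
  out : List ℕ

/-- Elementary operations. Operands are register numbers, except for the constant `c` and the
array name `a`. -/
inductive Op where
  | const (i c : ℕ)
  | add (i j k : ℕ)
  | sub (i j k : ℕ)
  | load (i a j : ℕ)
  | store (a i j : ℕ)
  | rconst (i c : ℕ)
  | radd (i j k : ℕ)
  | rsub (i j k : ℕ)
  | rmul (i j k : ℕ)
  | rdiv (i j k : ℕ)
  | rload (i a j : ℕ)
  | rstore (a i j : ℕ)
  | print (i : ℕ)

/-- The effect of an elementary operation. Integer subtraction is truncated at zero, and division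
of a real by zero yields zero. -/
def Op.exec (S : State) : Op → State
  | const i c => { S with reg := Function.update S.reg i c }
  | add i j k => { S with reg := Function.update S.reg i (S.reg j + S.reg k) }
  | sub i j k => { S with reg := Function.update S.reg i (S.reg j - S.reg k) }
  | load i a j => { S with reg := Function.update S.reg i (S.arr a (S.reg j)) }
  | store a i j =>
      { S with arr := Function.update S.arr a (Function.update (S.arr a) (S.reg i) (S.reg j)) }
  | rconst i c => { S with rreg := Function.update S.rreg i (c : ℝ) }
  | radd i j k => { S with rreg := Function.update S.rreg i (S.rreg j + S.rreg k) }
  | rsub i j k => { S with rreg := Function.update S.rreg i (S.rreg j - S.rreg k) }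
  | rmul i j k => { S with rreg := Function.update S.rreg i (S.rreg j * S.rreg k) }
  | rdiv i j k => { S with rreg := Function.update S.rreg i (S.rreg j / S.rreg k) }
  | rload i a j => { S with rreg := Function.update S.rreg i (S.rarr a (S.reg j)) }
  | rstore a i j =>
      { S with rarr := Function.update S.rarr a (Function.update (S.rarr a) (S.reg i) (S.rreg j)) }
  | print i => { S with out := S.out ++ [S.reg i] }

/-- Tests: comparison of two integer registers, comparison of two real registers, and a fresh
independent coin flip that succeeds with the probability held by a real register. -/
inductive Test where
  | eq (i j : ℕ)
  | lt (i j : ℕ)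
  | rlt (i j : ℕ)
  | coin (i : ℕ)

/-- A coin that shows `true` with probability `x`, clamped to `[0, 1]`. -/
def coinFlip (x : ℝ) : PMF Bool :=
  PMF.ofFintype (fun b => if b then min (ENNReal.ofReal x) 1 else 1 - min (ENNReal.ofReal x) 1)
    (by simp [add_tsub_cancel_of_le])

open Classical in
/-- The law of the outcome of a test. -/
def Test.law (S : State) : Test → PMF Bool
  | eq i j => PMF.pure (decide (S.reg i = S.reg j))
  | lt i j => PMF.pure (decide (S.reg i < S.reg j))
  | rlt i j => PMF.pure (decide (S.rreg i < S.rreg j))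
  | coin i => coinFlip (S.rreg i)

/-- Programs. -/
inductive Prog where
  | nop
  | op (o : Op)
  | seq (p q : Prog)
  | ite (t : Test) (p q : Prog)
  | loop (t : Test) (p : Prog)

/-- A configuration: the stack of programs that remain to be executed, and the state. -/
abbrev Config : Type := List Prog × State

/-- One unit of time. The empty stack means that the machine has halted. -/
def step : Config → PMF Config
  | ([], S) => PMF.pure ([], S)
  | (.nop :: k, S) => PMF.pure (k, S)
  | (.op o :: k, S) => PMF.pure (k, o.exec S)
  | (.seq p q :: k, S) => PMF.pure (p :: q :: k, S)
  | (.ite t p q :: k, S) => (t.law S).map fun b => (if b then p :: k else q :: k, S)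
  | (.loop t p :: k, S) => (t.law S).map fun b => (if b then p :: .loop t p :: k else k, S)

/-- The law of the configuration after `t` units of time. -/
def law (P : Prog) (S : State) : ℕ → PMF Config
  | 0 => PMF.pure ([P], S)
  | t + 1 => (law P S t).bind step

/-- The probability that `P`, started in state `S`, eventually halts with an output in `L`:
the limit of the nondecreasing probabilities that this has happened by time `t`. -/
def outputProb (P : Prog) (S : State) (L : Set (List ℕ)) : ℝ≥0∞ :=
  ⨆ t, (law P S t).toOuterMeasure {c | c.1 = [] ∧ c.2.out ∈ L}

/-- The expected running time `𝔼 T = ∑ₜ Pr[T > t]`; it is infinite if `P` fails to halt with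
positive probability. -/
def expectedTime (P : Prog) (S : State) : ℝ≥0∞ :=
  ∑' t, (law P S t).toOuterMeasure {c | c.1 ≠ []}

end RAM

/-! ## Input and output -/

/-- An adjacency list representation of a graph: the neighbors of each vertex, listed without
repetition in some order. -/
structure AdjLists {n : ℕ} (G : SimpleGraph (Fin n)) where
  nbrs : Fin n → List (Fin n)
  nodup : ∀ v, (nbrs v).Nodup
  mem_iff : ∀ v u, u ∈ nbrs v ↔ G.Adj v u

/-- The initial state on the input `(G, λ)`. Integer register `0` holds the number `n` of vertices
and real register `0` holds `λ`. Array `1` holds the concatenation of the neighbor lists of the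
vertices `0, …, n - 1`, and array `0` holds at `v ≤ n` the position where the list of `v` starts
(at `v = n`, the total length). All other cells are zero, and nothing has been printed. -/
def AdjLists.input {n : ℕ} {G : SimpleGraph (Fin n)} (A : AdjLists G) (lam : ℝ) : RAM.State where
  reg i := if i = 0 then n else 0
  arr a i :=
    if a = 0 then
      (if i ≤ n then (((List.finRange n).take i).map fun v => (A.nbrs v).length).sum else 0)
    else if a = 1 then (((List.finRange n).flatMap A.nbrs).map Fin.val).getD i 0
    else 0
  rreg i := if i = 0 then lam else 0
  rarr _ _ := 0
  out := []

/-- The printed words that describe the edge set `M`: the two endpoints of each edge of `M`, edge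
after edge, each edge once. -/
def edgeListings {n : ℕ} (M : Finset (Sym2 (Fin n))) : Set (List ℕ) :=
  {w | ∃ l : List (Fin n × Fin n),
    (l.map fun p => s(p.1, p.2)).Nodup ∧ (∀ e, e ∈ l.map (fun p => s(p.1, p.2)) ↔ e ∈ M) ∧
      w = l.flatMap fun p => [(p.1 : ℕ), (p.2 : ℕ)]}

/-- On the instance `I`, however its adjacency lists are ordered, the program `P` prints a perfect
sample from the weighted matching distribution: for each set `M` of pairs of vertices, the
probability that it halts with output `M` is `μ(M)`. In particular it halts with probability
one, as these probabilities add up to one. -/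
def RAM.Prog.PerfectlySamples (P : RAM.Prog) (I : MonomerDimer) : Prop :=
  ∀ (A : AdjLists I.graph.2) (M : Finset (Sym2 (Fin I.n))),
    RAM.outputProb P (A.input I.lam) (edgeListings M) = ENNReal.ofReal (I.gibbs M)

end

/-! ### Unmatched probabilities of vertices and their truncated tree recursion. -/

noncomputable section

namespace MatchingSampler

section Math

/-! The vertices are decided one after another: each is left unmatched or matched to a living
neighbor, conditionally on the earlier decisions. Let `v` be the next vertex, `H` the other living
vertices, and `q u` the probability that `u` is unmatched in the graph on `H`. Then `v` stays
unmatched with weight `1` and is matched to `u` with weight `lam * q u` (`pUn_eq`), and deciding all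
vertices in this way produces the Gibbs distribution (`reveal_edges`).

The number `q u` depends on the whole graph, but the tree recursion truncated at even and odd depths
bounds it from below and above (`T_even_le_odd_ge`), with a relative gap that decays exponentially
in the depth (`T_ratio`). A round distributes the total weight `1 + A`, where `A` sums `lam` times
the upper bounds. Weight `1` decides "unmatched", and `lam` times the lower bound at `u` decides
"matched to `u`". With the leftover weight `R` the decision is suspended: `v` is removed, and the
sphere of radius `2 * m + 4` around it is decided by the same procedure. This cuts the inner ball
off from the rest, so a deep enough recursion gives the exact conditional probability that `u` is
unmatched (`reveal_local`). Its mean over the decisions on the sphere is `q u` (`reveal_pAlive`).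
The leftover weight therefore suffices to top the lower bounds up to `lam * q u` on average. The
remaining weight leads to a restart of `v`, and in all cases the decisions made during the
suspension are forgotten. One round thus accepts its outcomes in the right proportions, and so does
the repetition until acceptance.

Suspension has probability at most `ε`, the relative gap, and causes at most `s` further decisions,
where `s` bounds the sphere. Since the gap decays exponentially and spheres grow sub-exponentially,
some constant depth gives `ε * s ≤ 1 / 2` (`exists_depth`). The recursion is then subcritical, and
one vertex costs `O(1)` in expectation (`chain_dec`).

For the machine, everything is phrased through potentials (`Super`): bounded functions of the
configuration that exceed their mean after one step by at most `ρ`. The supremum of a potential over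
all memory contents that represent a given trail and task list satisfies the inequalities of the
task chain (`potential_chainBound`), so `chain_total` bounds its initial value. Two families of
potentials suffice. Truncated running times, with `ρ = 1`, bound the expected time. Probabilities of
having halted with given outputs, with `ρ = 0`, are bounded above by the Gibbs probabilities, both
for an output set and for its complement; as the program halts almost surely, these bounds are
equalities (`outputProb_of_super`). -/

lemma edist_le_succ_of_adj {V : Type*} {G : SimpleGraph V} {v u x : V} (h : G.Adj v u) {k : ℕ} (hk : G.edist u x ≤ k) :
    G.edist v x ≤ (k + 1 : ℕ) := by
  have h1 : G.edist v u = 1 := SimpleGraph.edist_eq_one_iff_adj.2 h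
  have := SimpleGraph.edist_triangle (G := G) (u := v) (v := u) (w := x)
  rw [h1] at this
  refine this.trans ?_
  push_cast
  rw [add_comm]
  gcongr

variable {V : Type*} [Fintype V] [DecidableEq V] (G : SimpleGraph V) [DecidableRel G.Adj] (lam : ℝ)

/-! ### Matchings inside a vertex set and their partition functions -/

/-- The edge set `M` is a matching of `G`. -/
def IsMatch (M : Finset (Sym2 V)) : Prop :=
  (∀ e ∈ M, e ∈ G.edgeSet) ∧ ∀ e ∈ M, ∀ f ∈ M, ∀ v : V, v ∈ e → v ∈ f → e = f

open Classical in
/-- The matchings of `G` all of whose edges lie inside `H`. -/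
def matchings (H : Finset V) : Finset (Finset (Sym2 V)) :=
  Finset.univ.filter fun M => IsMatch G M ∧ ∀ e ∈ M, ∀ x ∈ e, x ∈ H

/-- The weighted sum of `F` over the matchings inside `H`. -/
def wsum (H : Finset V) (F : Finset (Sym2 V) → ℝ) : ℝ :=
  ∑ M ∈ matchings G H, lam ^ M.card * F M

/-- The partition function of the graph induced on `H`. -/
def Z (H : Finset V) : ℝ := wsum G lam H fun _ => 1

variable {G lam}

lemma mem_matchings {H : Finset V} {M : Finset (Sym2 V)} :
    M ∈ matchings G H ↔ IsMatch G M ∧ ∀ e ∈ M, ∀ x ∈ e, x ∈ H := by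
  simp [matchings]

lemma matchings_empty : matchings G (∅ : Finset V) = {∅} := by
  ext M
  simp only [mem_matchings, Finset.mem_singleton, Finset.notMem_empty]
  constructor
  · rintro ⟨-, h⟩
    refine Finset.eq_empty_of_forall_notMem fun e he => ?_
    induction e with
    | _ a b => exact h _ he a (by simp)
  · rintro rfl
    exact ⟨⟨by simp, by simp⟩, by simp⟩

lemma wsum_empty (F : Finset (Sym2 V) → ℝ) : wsum G lam ∅ F = F ∅ := by
  simp [wsum, matchings_empty]

lemma insert_mem_matchings {H : Finset V} {v u : V} (hv : v ∈ H)
    (hu : u ∈ (H.erase v).filter (G.Adj v)) {M : Finset (Sym2 V)}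
    (hM : M ∈ matchings G ((H.erase v).erase u)) :
    s(v, u) ∉ M ∧ insert s(v, u) M ∈ matchings G H := by
  simp only [Finset.mem_filter, Finset.mem_erase] at hu
  rw [mem_matchings] at hM
  obtain ⟨⟨hE, hD⟩, hH⟩ := hM
  have hv' : ∀ e ∈ M, v ∉ e := fun e he hve => by simpa using hH e he v hve
  have hu' : ∀ e ∈ M, u ∉ e := fun e he hve => by simpa using hH e he u hve
  refine ⟨fun h => hv' _ h (by simp), mem_matchings.2 ⟨⟨?_, ?_⟩, ?_⟩⟩
  · intro e he
    rcases Finset.mem_insert.1 he with rfl | he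
    · exact hu.2
    · exact hE e he
  · intro e he f hf x hxe hxf
    rcases Finset.mem_insert.1 he with rfl | he' <;> rcases Finset.mem_insert.1 hf with rfl | hf'
    · rfl
    · rcases Sym2.mem_iff.1 hxe with rfl | rfl
      · exact absurd hxf (hv' _ hf')
      · exact absurd hxf (hu' _ hf')
    · rcases Sym2.mem_iff.1 hxf with rfl | rfl
      · exact absurd hxe (hv' _ he')
      · exact absurd hxe (hu' _ he')
    · exact hD e he' f hf' x hxe hxf
  · intro e he x hx
    rcases Finset.mem_insert.1 he with rfl | he
    · rcases Sym2.mem_iff.1 hx with rfl | rfl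
      · exact hv
      · exact hu.1.2
    · exact Finset.mem_of_mem_erase (Finset.mem_of_mem_erase (hH e he x hx))

/-- At most one edge of a matching meets `v`, and removing it leaves a matching that avoids both of
its ends. -/
lemma matchings_eq {H : Finset V} {v : V} (hv : v ∈ H) :
    matchings G H = matchings G (H.erase v) ∪
      ((H.erase v).filter (G.Adj v)).biUnion fun u =>
        (matchings G ((H.erase v).erase u)).image (insert s(v, u)) := by
  ext M
  simp only [Finset.mem_union, Finset.mem_biUnion, Finset.mem_image]
  constructor
  · intro hM
    have hM' := mem_matchings.1 hM
    by_cases h : ∃ e ∈ M, v ∈ e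
    · obtain ⟨e, he, hve⟩ := h
      obtain ⟨u, rfl⟩ := Sym2.mem_iff_exists.1 hve
      have hadj : G.Adj v u := hM'.1.1 _ he
      refine Or.inr ⟨u, ?_, M.erase s(v, u), ?_, Finset.insert_erase he⟩
      · simp only [Finset.mem_filter, Finset.mem_erase]
        exact ⟨⟨hadj.ne', hM'.2 _ he u (by simp)⟩, hadj⟩
      · refine mem_matchings.2 ⟨⟨fun e' h' => hM'.1.1 _ (Finset.mem_of_mem_erase h'),
          fun e' h' f hf => hM'.1.2 _ (Finset.mem_of_mem_erase h') _
            (Finset.mem_of_mem_erase hf)⟩, fun e' h' x hx => ?_⟩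
        simp only [Finset.mem_erase] at h' ⊢
        refine ⟨?_, ?_, hM'.2 _ h'.2 x hx⟩
        · rintro rfl
          exact h'.1 (hM'.1.2 _ h'.2 _ he x hx (by simp))
        · rintro rfl
          exact h'.1 (hM'.1.2 _ h'.2 _ he x hx (by simp))
    · refine Or.inl (mem_matchings.2 ⟨hM'.1, fun e he x hx => ?_⟩)
      refine Finset.mem_erase.2 ⟨?_, hM'.2 e he x hx⟩
      rintro rfl
      exact h ⟨e, he, hx⟩
  · rintro (h | ⟨u, hu, M', hM', rfl⟩)
    · have h := mem_matchings.1 h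
      exact mem_matchings.2 ⟨h.1, fun e he x hx => Finset.mem_of_mem_erase (h.2 e he x hx)⟩
    · exact (insert_mem_matchings hv hu hM').2

/-- Splitting the matchings according to the partner of `v`. -/
lemma wsum_eq {H : Finset V} {v : V} (hv : v ∈ H) (F : Finset (Sym2 V) → ℝ) :
    wsum G lam H F = wsum G lam (H.erase v) F +
      ∑ u ∈ (H.erase v).filter (G.Adj v),
        lam * wsum G lam ((H.erase v).erase u) fun M => F (insert s(v, u) M) := by
  have hve : ∀ M ∈ matchings G (H.erase v), ∀ e ∈ M, v ∉ e := fun M hM e he hx => by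
    simpa using (mem_matchings.1 hM).2 e he v hx
  rw [wsum, matchings_eq hv, Finset.sum_union, Finset.sum_biUnion]
  · congr 1
    refine Finset.sum_congr rfl fun u hu => ?_
    rw [Finset.sum_image, wsum, Finset.mul_sum]
    · refine Finset.sum_congr rfl fun M hM => ?_
      rw [Finset.card_insert_of_notMem (insert_mem_matchings hv hu hM).1]
      ring
    · intro M hM M' hM' h
      have h1 := (insert_mem_matchings hv hu hM).1
      have h2 := (insert_mem_matchings hv hu hM').1
      rw [← Finset.erase_insert h1, ← Finset.erase_insert h2]
      exact congrArg (fun s => Finset.erase s s(v, u)) h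
  · intro u hu u' hu' hne
    refine Finset.disjoint_left.2 fun M hM hM' => hne ?_
    obtain ⟨M1, hM1, rfl⟩ := Finset.mem_image.1 hM
    obtain ⟨M2, hM2, h⟩ := Finset.mem_image.1 hM'
    have hm := (insert_mem_matchings hv hu hM1).2
    have := (mem_matchings.1 hm).1.2 s(v, u) (by simp) s(v, u') (by rw [← h]; simp) v
      (by simp) (by simp)
    exact Sym2.congr_right.1 this
  · refine Finset.disjoint_left.2 fun M hM hM' => ?_
    obtain ⟨u, hu, hM'⟩ := Finset.mem_biUnion.1 hM'
    obtain ⟨M1, hM1, rfl⟩ := Finset.mem_image.1 hM'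
    exact hve _ hM s(v, u) (by simp) (by simp)

lemma Z_empty : Z G lam ∅ = 1 := wsum_empty _

lemma Z_eq {H : Finset V} {v : V} (hv : v ∈ H) :
    Z G lam H = Z G lam (H.erase v) +
      ∑ u ∈ (H.erase v).filter (G.Adj v), lam * Z G lam ((H.erase v).erase u) :=
  wsum_eq hv _

lemma Z_pos (hlam : 0 < lam) (H : Finset V) : 0 < Z G lam H := by
  induction H using Finset.strongInduction with
  | _ H ih =>
    rcases H.eq_empty_or_nonempty with rfl | ⟨v, hv⟩
    · simp [Z_empty]
    · rw [Z_eq hv]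
      refine add_pos_of_pos_of_nonneg (ih _ (Finset.erase_ssubset hv))
        (Finset.sum_nonneg fun u hu => ?_)
      refine (mul_pos hlam (ih _ ?_)).le
      exact (Finset.erase_subset _ _).trans_ssubset (Finset.erase_ssubset hv)

/-! ### The probability that a vertex is unmatched, and its tree recursion -/

variable (G lam)

/-- The probability that `v` is unmatched in the graph induced on `insert v H`. -/
def pUn (H : Finset V) (v : V) : ℝ := Z G lam H / Z G lam (insert v H)

/-- The truncated tree recursion for `pUn`. -/
def T : ℕ → Finset V → V → ℝ
  | 0, _, _ => 0
  | k + 1, H, v => 1 / (1 + lam * ∑ u ∈ H.filter (G.Adj v), T k (H.erase u) u)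

variable {G lam}

lemma pUn_pos (hlam : 0 < lam) (H : Finset V) (v : V) : 0 < pUn G lam H v :=
  div_pos (Z_pos hlam _) (Z_pos hlam _)

/-- Expand the partition function at `v` and divide by that of `H`: each quotient that appears is
again an unmatched probability, of a neighbor in a graph without `v`. -/
lemma pUn_eq (hlam : 0 < lam) {H : Finset V} {v : V} (hv : v ∉ H) :
    pUn G lam H v = 1 / (1 + lam * ∑ u ∈ H.filter (G.Adj v), pUn G lam (H.erase u) u) := by
  have h := Z_pos (G := G) hlam H
  have key : Z G lam (insert v H) =
      Z G lam H * (1 + lam * ∑ u ∈ H.filter (G.Adj v), pUn G lam (H.erase u) u) := by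
    rw [Z_eq (Finset.mem_insert_self v H), Finset.erase_insert hv, mul_add, mul_one, Finset.mul_sum,
      Finset.mul_sum]
    congr 1
    refine Finset.sum_congr rfl fun u hu => ?_
    rw [pUn, Finset.insert_erase (Finset.mem_filter.1 hu).1]
    field_simp
  rw [pUn, key]
  have : 0 < Z G lam (insert v H) := Z_pos hlam _
  rw [key] at this
  have h2 := (pos_iff_pos_of_mul_pos this).1 h
  field_simp

/-- The probability that `u` is unmatched is the average, over the status of `w`, of its
conditional probability. -/
lemma pUn_average (hlam : 0 < lam) {H : Finset V} {w u : V} (hw : w ∉ H) (hu : u ∈ H) :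
    pUn G lam ((insert w H).erase u) u =
      pUn G lam H w * pUn G lam (H.erase u) u +
        ∑ x ∈ H.filter (G.Adj w), lam * pUn G lam H w * pUn G lam (H.erase x) x *
          (if u ∈ H.erase x then pUn G lam ((H.erase x).erase u) u else 0) := by
  have hne : w ≠ u := by rintro rfl; exact hw hu
  have h1 : (insert w H).erase u = insert w (H.erase u) := Finset.erase_insert_of_ne hne
  have hw' : w ∉ H.erase u := fun h => hw (Finset.mem_of_mem_erase h)
  have hpos : ∀ H, 0 < Z G lam H := Z_pos hlam
  have e1 : pUn G lam ((insert w H).erase u) u =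
      Z G lam (insert w (H.erase u)) / Z G lam (insert w H) := by
    rw [pUn, h1, Finset.insert_comm, Finset.insert_erase hu]
  have e2 : pUn G lam H w * pUn G lam (H.erase u) u =
      Z G lam (H.erase u) / Z G lam (insert w H) := by
    rw [pUn, pUn, Finset.insert_erase hu]
    field_simp [(hpos H).ne', (hpos (insert w H)).ne']
  rw [e1, e2, Z_eq (Finset.mem_insert_self w _), Finset.erase_insert hw', add_div, Finset.sum_div]
  congr 1
  have : (H.erase u).filter (G.Adj w) = (H.filter (G.Adj w)).erase u := by
    ext; simp; tauto
  rw [this]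
  -- If `u` is the partner of `w`, it is not unmatched: the term `x = u` vanishes on one side and is
  -- absent on the other.
  rw [← Finset.sum_subset (Finset.erase_subset u (H.filter (G.Adj w)))]
  · refine Finset.sum_congr rfl fun x hx => ?_
    simp only [Finset.mem_erase, Finset.mem_filter] at hx
    have hux : u ∈ H.erase x := Finset.mem_erase.2 ⟨fun h => hx.1 h.symm, hu⟩
    rw [if_pos hux, pUn, pUn, pUn, Finset.insert_erase hx.2.1, Finset.insert_erase hux,
      Finset.erase_right_comm]
    field_simp [(hpos H).ne', (hpos (insert w H)).ne', (hpos (H.erase x)).ne']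
  · intro x hx hx'
    simp only [Finset.mem_erase, not_and] at hx'
    have : x = u := by by_contra h; exact hx' h hx
    subst this
    simp

/-! ### Bounds for the tree recursion -/

lemma T_nonneg (hlam : 0 < lam) (k : ℕ) (H : Finset V) (v : V) : 0 ≤ T G lam k H v := by
  induction k generalizing H v with
  | zero => simp [T]
  | succ k ih =>
    rw [T]
    have := Finset.sum_nonneg fun u (_ : u ∈ H.filter (G.Adj v)) => ih (H.erase u) u
    positivity

lemma T_denom_pos (hlam : 0 < lam) (k : ℕ) (H : Finset V) (v : V) :
    0 < 1 + lam * ∑ u ∈ H.filter (G.Adj v), T G lam k (H.erase u) u := by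
  have := Finset.sum_nonneg fun u (_ : u ∈ H.filter (G.Adj v)) => T_nonneg (G := G) hlam k (H.erase u) u
  positivity

lemma T_le_one (hlam : 0 < lam) (k : ℕ) (H : Finset V) (v : V) : T G lam k H v ≤ 1 := by
  cases k with
  | zero => simp [T]
  | succ k =>
    rw [T, div_le_one (T_denom_pos hlam k H v)]
    have := Finset.sum_nonneg fun u (_ : u ∈ H.filter (G.Adj v)) => T_nonneg (G := G) hlam k (H.erase u) u
    have := mul_nonneg hlam.le this
    linarith

/-- One level of the recursion is a decreasing function of the values at the neighbors, so it
reverses inequalities between truncations. -/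
lemma T_succ_anti (hlam : 0 < lam) {j k : ℕ}
    (h : ∀ (H : Finset V) (v : V), T G lam j H v ≤ T G lam k H v) (H : Finset V) (v : V) :
    T G lam (k + 1) H v ≤ T G lam (j + 1) H v := by
  rw [T, T]
  refine one_div_le_one_div_of_le (T_denom_pos hlam j H v) ?_
  gcongr
  exact h _ _

/-- The start value `0` is the least possible, and each level reverses the order. Hence even depths
bound all deeper truncations from below and odd depths bound them from above. -/
lemma T_even_le_odd_ge (hlam : 0 < lam) (m : ℕ) :
    (∀ N, 2 * m ≤ N → ∀ (H : Finset V) (v : V), T G lam (2 * m) H v ≤ T G lam N H v) ∧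
    (∀ N, 2 * m + 1 ≤ N → ∀ (H : Finset V) (v : V), T G lam N H v ≤ T G lam (2 * m + 1) H v) := by
  induction m with
  | zero =>
    have h0 : ∀ N, ∀ (H : Finset V) (v : V), T G lam (2 * 0) H v ≤ T G lam N H v := fun N H v => by
      simpa [T] using T_nonneg hlam N H v
    refine ⟨fun N _ => h0 N, fun N hN => ?_⟩
    obtain ⟨N, rfl⟩ : ∃ N', N = N' + 1 := ⟨N - 1, by omega⟩
    exact T_succ_anti hlam (h0 N)
  | succ m ih =>
    have h1 : ∀ N, 2 * (m + 1) ≤ N → ∀ (H : Finset V) (v : V),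
        T G lam (2 * (m + 1)) H v ≤ T G lam N H v := by
      intro N hN
      obtain ⟨N, rfl⟩ : ∃ N', N = N' + 1 := ⟨N - 1, by omega⟩
      exact T_succ_anti hlam (ih.2 N (by omega))
    refine ⟨h1, fun N hN => ?_⟩
    obtain ⟨N, rfl⟩ : ∃ N', N = N' + 1 := ⟨N - 1, by omega⟩
    exact T_succ_anti hlam (h1 N (by omega))

/-- A relative error `ε` in the sum `y` becomes a relative error of at most `y / (1 + y) * ε` in `1
/ (1 + y)`, and `y ≤ D` because truncations are at most `1`. The indices trade places since the
recursion is decreasing. -/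
lemma T_succ_ratio (hlam : 0 < lam) {j k : ℕ} {D ε : ℝ} (hε : 0 ≤ ε)
    (hD : ∀ (H : Finset V) (v : V), lam * ((H.filter (G.Adj v)).card : ℝ) ≤ D)
    (h : ∀ (H : Finset V) (v : V), T G lam j H v ≤ (1 + ε) * T G lam k H v)
    (H : Finset V) (v : V) :
    T G lam (k + 1) H v ≤ (1 + D / (1 + D) * ε) * T G lam (j + 1) H v := by
  rw [T, T, mul_one_div, div_le_div_iff₀ (T_denom_pos hlam k H v) (T_denom_pos hlam j H v), one_mul]
  set y := lam * ∑ u ∈ H.filter (G.Adj v), T G lam k (H.erase u) u with hy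
  set x := lam * ∑ u ∈ H.filter (G.Adj v), T G lam j (H.erase u) u with hx
  have hxy : x ≤ (1 + ε) * y := by
    rw [hx, hy, ← mul_assoc, mul_comm (1 + ε), mul_assoc, Finset.mul_sum _ _ (1 + ε)]
    gcongr
    exact h _ _
  have hy0 : 0 ≤ y := mul_nonneg hlam.le (Finset.sum_nonneg fun u _ => T_nonneg hlam _ _ _)
  have hyD : y ≤ D := by
    refine le_trans ?_ (hD H v)
    rw [hy]
    gcongr
    refine (Finset.sum_le_card_nsmul _ _ 1 fun u _ => T_le_one hlam _ _ _).trans ?_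
    simp
  have hD0 : 0 ≤ D := hy0.trans hyD
  have : y ≤ D / (1 + D) * (1 + y) := by
    rw [div_mul_eq_mul_div, le_div_iff₀ (by positivity)]
    nlinarith
  nlinarith

/-- Consecutive truncations approach each other exponentially fast. -/
lemma T_ratio (hlam : 0 < lam) {D : ℝ}
    (hD : ∀ (H : Finset V) (v : V), lam * ((H.filter (G.Adj v)).card : ℝ) ≤ D) (hD0 : 0 ≤ D)
    (k : ℕ) (H : Finset V) (v : V) :
    T G lam (k + 1) H v ≤ (1 + D * (D / (1 + D)) ^ k) * T G lam (k + 2) H v ∧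
      T G lam (k + 2) H v ≤ (1 + D * (D / (1 + D)) ^ k) * T G lam (k + 1) H v := by
  induction k generalizing H v with
  | zero =>
    -- The contraction starts at depth one, where the value is constantly `1`, while depth two is at
    -- least `1 / (1 + D)`; this gives the initial relative error `D`. Depth zero has no finite
    -- relative error.
    have h1 : ∀ (H : Finset V) (v : V), T G lam 1 H v = 1 := fun H v => by simp [T]
    have h2 := T_le_one (G := G) hlam 2 H v
    simp only [zero_add, h1, pow_zero, mul_one]
    refine ⟨?_, by linarith⟩
    have : T G lam 2 H v = 1 / (1 + lam * ((H.filter (G.Adj v)).card : ℝ)) := by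
      rw [T]
      simp [h1]
    rw [this, mul_one_div, le_div_iff₀ (by positivity)]
    linarith [hD H v]
  | succ k ih =>
    have he : 0 ≤ D * (D / (1 + D)) ^ k := by positivity
    have e : D * (D / (1 + D)) ^ (k + 1) = D / (1 + D) * (D * (D / (1 + D)) ^ k) := by ring
    rw [e]
    exact ⟨T_succ_ratio hlam he hD (fun H v => (ih H v).2) H v,
      T_succ_ratio hlam he hD (fun H v => (ih H v).1) H v⟩

/-- The truncated recursion is exact if it exhausts a set that contains the component of `v`. -/
lemma T_eq_pUn (hlam : 0 < lam) (B : Finset V) (N : ℕ) (H : Finset V) (v : V) (hvB : v ∈ B)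
    (hvH : v ∉ H) (hB : ∀ x ∈ B, ∀ y ∈ H, G.Adj x y → y ∈ B) (hN : (H ∩ B).card < N) :
    T G lam N H v = pUn G lam H v := by
  induction N generalizing H v with
  | zero => simp at hN
  | succ N ih =>
    rw [T, pUn_eq hlam hvH]
    congr 3
    refine Finset.sum_congr rfl fun u hu => ?_
    rw [Finset.mem_filter] at hu
    have huB := hB v hvB u hu.1 hu.2
    refine ih (H.erase u) u huB (Finset.notMem_erase _ _)
      (fun x hx y hy => hB x hx y (Finset.mem_of_mem_erase hy)) ?_
    -- Each level deletes a vertex of `H ∩ B`, so the recursion runs out of neighbors before it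
    -- reaches depth zero.
    rw [Finset.erase_inter, Finset.card_erase_of_mem (Finset.mem_inter.2 ⟨hu.1, huB⟩)]
    have := Finset.card_pos.2 ⟨u, Finset.mem_inter.2 ⟨hu.1, huB⟩⟩
    omega

/-- The truncated recursion depends only on a ball. -/
lemma T_congr (k : ℕ) (H H' : Finset V) (v : V)
    (h : ∀ x, G.edist v x ≤ k → (x ∈ H ↔ x ∈ H')) : T G lam k H v = T G lam k H' v := by
  induction k generalizing H H' v with
  | zero => rfl
  | succ k ih =>
    rw [T, T]
    have e : H.filter (G.Adj v) = H'.filter (G.Adj v) := by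
      ext u
      simp only [Finset.mem_filter]
      refine and_congr_left fun hu => h u ?_
      rw [SimpleGraph.edist_eq_one_iff_adj.2 hu]
      push_cast
      exact le_add_self
    rw [e]
    congr 3
    refine Finset.sum_congr rfl fun u hu => ih _ _ _ fun x hx => ?_
    rw [Finset.mem_filter] at hu
    simp only [Finset.mem_erase]
    rw [h x (edist_le_succ_of_adj hu.2 hx)]

end Math
end MatchingSampler
end

/-! ### The task chain as a system of inequalities, independent of the machine. -/

noncomputable section
namespace MatchingSampler

section Chain

variable {V : Type*} [Fintype V] [DecidableEq V] {G : SimpleGraph V} [DecidableRel G.Adj] {lam : ℝ}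

/-! ### Trails of decided vertices -/

/-- The decided vertices with their partners, the latest decision first. -/
abbrev Trail (V : Type*) := List (V × Option V)

/-- The undecided vertices. -/
def alive : Trail V → Finset V
  | [] => Finset.univ
  | (v, none) :: t => (alive t).erase v
  | (v, some u) :: t => ((alive t).erase v).erase u

/-- The edges of the matching that a trail describes. -/
def edges : Trail V → Finset (Sym2 V)
  | [] => ∅
  | (_, none) :: t => edges t
  | (v, some u) :: t => insert s(v, u) (edges t)

variable (G) in
/-- Every entry decides an undecided vertex and matches it, if at all, to an undecided neighbor. -/
def Valid : Trail V → Prop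
  | [] => True
  | e :: t => Valid t ∧ e.1 ∈ alive t ∧ ∀ u, e.2 = some u → u ∈ ((alive t).erase e.1).filter (G.Adj e.1)

lemma Valid.none {t : Trail V} (ht : Valid G t) {v : V} (hv : v ∈ alive t) :
    Valid G ((v, none) :: t) := ⟨ht, hv, by simp⟩

lemma Valid.some {t : Trail V} (ht : Valid G t) {v u : V} (hv : v ∈ alive t)
    (hu : u ∈ ((alive t).erase v).filter (G.Adj v)) : Valid G ((v, some u) :: t) :=
  ⟨ht, hv, by rintro u' h; cases h; exact hu⟩

lemma alive_cons_subset (e : V × Option V) (t : Trail V) : alive (e :: t) ⊆ (alive t).erase e.1 := by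
  obtain ⟨v, _ | u⟩ := e
  · exact subset_rfl
  · exact Finset.erase_subset _ _

lemma alive_append_subset (τ t : Trail V) : alive (τ ++ t) ⊆ alive t := by
  induction τ with
  | nil => exact subset_rfl
  | cons e τ ih =>
    exact (alive_cons_subset e (τ ++ t)).trans ((Finset.erase_subset _ _).trans ih)

lemma mem_alive_append {τ t : Trail V} {x : V} (h1 : x ∈ alive t)
    (h2 : ∀ e ∈ τ, e.1 ≠ x ∧ ∀ u, e.2 = some u → u ≠ x) : x ∈ alive (τ ++ t) := by
  induction τ with
  | nil => exact h1
  | cons e τ ih =>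
    have h3 := ih fun e he => h2 e (List.mem_cons_of_mem _ he)
    obtain ⟨h4, h5⟩ := h2 e List.mem_cons_self
    obtain ⟨v, _ | u⟩ := e
    · exact Finset.mem_erase.2 ⟨h4.symm, h3⟩
    · exact Finset.mem_erase.2 ⟨(h5 u rfl).symm, Finset.mem_erase.2 ⟨h4.symm, h3⟩⟩

/-! ### Revealing vertices one after another -/

variable (G lam) in
/-- The expectation of `f` when the vertices of `L` are decided one after another, each according to
its conditional distribution. -/
def reveal : List V → (Trail V → ℝ) → Trail V → ℝ
  | [], f, t => f t
  | v :: L, f, t =>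
    if v ∈ alive t then
      pUn G lam ((alive t).erase v) v * reveal L f ((v, none) :: t) +
        ∑ u ∈ ((alive t).erase v).filter (G.Adj v),
          lam * pUn G lam ((alive t).erase v) v * pUn G lam (((alive t).erase v).erase u) u *
            reveal L f ((v, some u) :: t)
    else reveal L f t

lemma reveal_cons (v : V) (L : List V) (f : Trail V → ℝ) :
    reveal G lam (v :: L) f = reveal G lam [v] (reveal G lam L f) := by
  funext t
  simp [reveal]

/-- This is `pUn_eq` with the denominator cleared. It makes the coefficients in `reveal` a
probability distribution. -/
lemma pUn_total (hlam : 0 < lam) {H : Finset V} {v : V} (hv : v ∉ H) :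
    pUn G lam H v + ∑ u ∈ H.filter (G.Adj v),
      lam * pUn G lam H v * pUn G lam (H.erase u) u = 1 := by
  have h := pUn_eq (G := G) hlam hv
  have hp := pUn_pos (G := G) hlam H v
  rw [eq_div_iff] at h
  · rw [← Finset.mul_sum]
    linarith
  · intro h0
    rw [h0] at h
    simp [h] at hp

lemma reveal_add (L : List V) (f g : Trail V → ℝ) (t : Trail V) :
    reveal G lam L (fun t => f t + g t) t = reveal G lam L f t + reveal G lam L g t := by
  induction L generalizing t with
  | nil => rfl
  | cons v L ih =>
    simp only [reveal, ih]
    split_ifs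
    · simp only [mul_add, Finset.sum_add_distrib]
      ring
    · rfl

lemma reveal_mul (L : List V) (c : ℝ) (f : Trail V → ℝ) (t : Trail V) :
    reveal G lam L (fun t => c * f t) t = c * reveal G lam L f t := by
  induction L generalizing t with
  | nil => rfl
  | cons v L ih =>
    simp only [reveal, ih]
    split_ifs
    · rw [mul_add, Finset.mul_sum]
      congr 1
      · ring
      · exact Finset.sum_congr rfl fun u _ => by ring
    · rfl

lemma reveal_const (hlam : 0 < lam) (L : List V) (c : ℝ) (t : Trail V) :
    reveal G lam L (fun _ => c) t = c := by
  induction L generalizing t with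
  | nil => rfl
  | cons v L ih =>
    simp only [reveal, ih]
    split_ifs
    · rw [← Finset.sum_mul, ← add_mul, pUn_total hlam (Finset.notMem_erase _ _), one_mul]
    · rfl

lemma reveal_affine (hlam : 0 < lam) {ι : Type*} (L : List V) (a : ℝ) (s : Finset ι) (c : ι → ℝ)
    (g : ι → Trail V → ℝ) (t : Trail V) :
    reveal G lam L (fun t => a + ∑ i ∈ s, c i * g i t) t =
      a + ∑ i ∈ s, c i * reveal G lam L (g i) t := by
  rw [reveal_add, reveal_const hlam]
  congr 1
  induction s using Finset.cons_induction with
  | empty => simpa using reveal_const hlam L 0 t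
  | cons i s hi ih =>
    simp only [Finset.sum_cons]
    rw [reveal_add, reveal_mul, ih]

/-- Monotonicity, restricted to the trails that can arise. -/
lemma reveal_mono (hlam : 0 < lam) (L : List V) (f g : Trail V → ℝ) (t : Trail V) (ht : Valid G t)
    (h : ∀ τ : Trail V, Valid G (τ ++ t) → τ.length ≤ L.length →
      (∀ e ∈ τ, e.1 ∈ L ∧ ∀ u, e.2 = some u → G.Adj e.1 u) → (∀ v ∈ L, v ∉ alive (τ ++ t)) →
      f (τ ++ t) ≤ g (τ ++ t)) :
    reveal G lam L f t ≤ reveal G lam L g t := by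
  induction L generalizing t with
  | nil => exact h [] ht (by simp) (by simp) (by simp)
  | cons v L ih =>
    have key : ∀ e : V × Option V, e.1 = v → (∀ u, e.2 = some u → G.Adj e.1 u) →
        Valid G (e :: t) → reveal G lam L f (e :: t) ≤ reveal G lam L g (e :: t) := by
      intro e he hadj hv
      refine ih _ hv fun τ h1 h2 h3 h4 => ?_
      have e1 : τ ++ e :: t = (τ ++ [e]) ++ t := by simp
      rw [e1] at h1 h4 ⊢
      refine h _ h1 (by simpa using h2) ?_ ?_
      · intro e' h'
        rcases List.mem_append.1 h' with h' | h'
        · exact ⟨List.mem_cons_of_mem _ (h3 e' h').1, (h3 e' h').2⟩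
        · rw [List.mem_singleton.1 h']
          exact ⟨by simp [he], hadj⟩
      · intro x hx
        rcases List.mem_cons.1 hx with rfl | hx
        · intro hx
          rw [← e1] at hx
          have := alive_cons_subset e t (alive_append_subset _ _ hx)
          simp [he] at this
        · exact h4 x hx
    simp only [reveal]
    split_ifs with hv
    · have hp := pUn_pos (G := G) hlam ((alive t).erase v) v
      gcongr with u hu
      · exact key _ rfl (by simp) (ht.none hv)
      · exact mul_nonneg (mul_nonneg hlam.le hp.le) (pUn_pos hlam _ _).le
      · exact key _ rfl (by rintro u' h; cases h; exact (Finset.mem_filter.1 hu).2) (ht.some hv hu)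
    · refine ih _ ht fun τ h1 h2 h3 h4 => h τ h1 (h2.trans (by simp))
        (fun e he => ⟨List.mem_cons_of_mem _ (h3 e he).1, (h3 e he).2⟩) fun x hx => ?_
      rcases List.mem_cons.1 hx with rfl | hx
      · exact fun hx => hv (alive_append_subset _ _ hx)
      · exact h4 x hx

variable (G lam) in
/-- The conditional probability that `u` ends up unmatched, given a trail that does not decide it
first. -/
def pAlive (u : V) (t : Trail V) : ℝ := if u ∈ alive t then pUn G lam ((alive t).erase u) u else 0

lemma pAlive_none (u v : V) (t : Trail V) : pAlive G lam u ((v, none) :: t) =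
    if u ∈ (alive t).erase v then pUn G lam (((alive t).erase v).erase u) u else 0 := rfl

lemma pAlive_some (u v x : V) (t : Trail V) : pAlive G lam u ((v, some x) :: t) =
    if u ∈ ((alive t).erase v).erase x then
      pUn G lam ((((alive t).erase v).erase x).erase u) u else 0 := rfl

/-- By `pUn_average`, one decision does not change the mean, so the conditional probability is a
martingale. The vertex `u` itself must not be revealed, since `pAlive` vanishes as soon as `u` is
decided. -/
lemma reveal_pAlive (hlam : 0 < lam) (u : V) (L : List V) (hu : u ∉ L) (t : Trail V) :
    reveal G lam L (pAlive G lam u) t = pAlive G lam u t := by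
  induction L generalizing t with
  | nil => rfl
  | cons w L ih =>
    have hne : u ≠ w := fun h => hu (h ▸ List.mem_cons_self)
    simp only [reveal, ih fun h => hu (List.mem_cons_of_mem _ h)]
    split_ifs with hw
    · simp only [pAlive_none, pAlive_some]
      rw [pAlive]
      by_cases hua : u ∈ alive t
      · have huH : u ∈ (alive t).erase w := Finset.mem_erase.2 ⟨hne, hua⟩
        rw [if_pos huH, if_pos hua]
        have := pUn_average (G := G) hlam (Finset.notMem_erase w (alive t)) huH
        rw [Finset.insert_erase hw] at this
        rw [this]
      · have h1 : u ∉ (alive t).erase w := fun h => hua (Finset.mem_of_mem_erase h)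
        have h2 : ∀ x, u ∉ ((alive t).erase w).erase x := fun x h => h1 (Finset.mem_of_mem_erase h)
        simp [hua]
    · rfl

/-- Revealing all vertices yields the Gibbs distribution. -/
lemma reveal_edges (hlam : 0 < lam) (g : Finset (Sym2 V) → ℝ) (L : List V) (t : Trail V)
    (hL : ∀ v ∈ alive t, v ∈ L) :
    reveal G lam L (fun t => g (edges t)) t =
      wsum G lam (alive t) (fun M => g (M ∪ edges t)) / Z G lam (alive t) := by
  induction L generalizing t with
  | nil =>
    have : alive t = ∅ := Finset.eq_empty_of_forall_notMem fun v hv => by simpa using hL v hv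
    simp [reveal, this, wsum_empty, Z_empty]
  | cons v L ih =>
    have hpos : ∀ H, 0 < Z G lam H := Z_pos hlam
    simp only [reveal]
    split_ifs with hv
    · have h1 : ∀ e : V × Option V, e.1 = v → ∀ x ∈ alive (e :: t), x ∈ L := by
        intro e he x hx
        have hx' := Finset.mem_erase.1 (alive_cons_subset e t hx)
        rcases List.mem_cons.1 (hL x hx'.2) with rfl | h
        · exact absurd he.symm hx'.1
        · exact h
      -- The coefficients of `reveal` are quotients of partition functions; they convert the
      -- normalization of the smaller living set into that of the larger one.
      rw [ih _ (h1 _ rfl), wsum_eq hv, add_div, Finset.sum_div]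
      congr 1
      · rw [pUn, Finset.insert_erase hv]
        simp only [alive, edges]
        field_simp [(hpos (alive t)).ne', (hpos ((alive t).erase v)).ne']
      · refine Finset.sum_congr rfl fun u hu => ?_
        rw [ih _ (h1 _ rfl), pUn, pUn, Finset.insert_erase hv,
          Finset.insert_erase (Finset.mem_filter.1 hu).1]
        simp only [alive, edges, Finset.insert_union, Finset.union_insert]
        field_simp [(hpos (alive t)).ne', (hpos ((alive t).erase v)).ne',
          (hpos (((alive t).erase v).erase u)).ne']
    · refine ih _ fun x hx => ?_
      rcases List.mem_cons.1 (hL x hx) with rfl | h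
      · exact absurd hx hv
      · exact h

/-! ### The chain of tasks -/

/-- A task: decide a vertex, or finish the decision of a vertex (begun when the trail had height `h`)
after its surroundings have been revealed. -/
inductive Task (V : Type*) where
  | dec (v : V)
  | fin (v : V) (h : ℕ)

variable (G lam) in
/-- The sum, over the undecided neighbors `u` of `v`, of `T a u - T b u` times `F u`. -/
def wt (a b : ℕ) (H : Finset V) (v : V) (F : V → ℝ) : ℝ :=
  ∑ u ∈ H.filter (G.Adj v), lam * (T G lam a (H.erase u) u - T G lam b (H.erase u) u) * F u

variable (G lam) in
/-- A potential `Ψ` of the task chain: it exceeds its expectation after one round by at most the cost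
`ρ * c` of that round. -/
structure ChainBound (Ψ : Trail V → List (Task V) → ℝ) (ρ c : ℝ) (sph : V → List V) (m N : ℕ) :
    Prop where
  dead : ∀ t v r, Valid G t → v ∉ alive t → Ψ t (.dec v :: r) ≤ ρ * c + Ψ t r
  dec : ∀ t v r, Valid G t → v ∈ alive t →
    (1 + wt G lam (2 * m + 1) 0 ((alive t).erase v) v fun _ => 1) * Ψ t (.dec v :: r) ≤
      (1 + wt G lam (2 * m + 1) 0 ((alive t).erase v) v fun _ => 1) * (ρ * c) +
      Ψ ((v, none) :: t) r +
      (wt G lam (2 * m) 0 ((alive t).erase v) v fun u => Ψ ((v, some u) :: t) r) +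
      (wt G lam (2 * m + 1) (2 * m) ((alive t).erase v) v fun _ => 1) *
        Ψ ((v, none) :: t) ((sph v).map .dec ++ .fin v t.length :: r)
  fin : ∀ τ t v r, Valid G (τ ++ (v, none) :: t) → τ.length ≤ (sph v).length →
    (wt G lam (2 * m + 1) (2 * m) (alive (τ ++ (v, none) :: t)) v fun _ => 1) *
        Ψ (τ ++ (v, none) :: t) (.fin v t.length :: r) ≤
      (wt G lam (2 * m + 1) (2 * m) (alive (τ ++ (v, none) :: t)) v fun _ => 1) * (ρ * c) +
      (wt G lam N (2 * m) (alive (τ ++ (v, none) :: t)) v fun u => Ψ ((v, some u) :: t) r) +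
      ((wt G lam (2 * m + 1) (2 * m) (alive (τ ++ (v, none) :: t)) v fun _ => 1) -
        wt G lam N (2 * m) (alive (τ ++ (v, none) :: t)) v fun _ => 1) * Ψ t (.dec v :: r)

/-- If every undecided vertex can be decided at expected cost `K`, so can lists of vertices. -/
lemma chain_reveal (hlam : 0 < lam) {Ψ : Trail V → List (Task V) → ℝ} {ρ c K : ℝ}
    {sph : V → List V} {m N : ℕ} (hΨ : ChainBound G lam Ψ ρ c sph m N) (hρ : 0 ≤ ρ) (hK : 0 ≤ K)
    (hc : 0 ≤ c) (h : ℕ)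
    (hdec : ∀ t v r, Valid G t → v ∈ alive t → (alive t).card ≤ h →
      Ψ t (.dec v :: r) ≤ ρ * K + reveal G lam [v] (fun t' => Ψ t' r) t)
    (L : List V) (r : List (Task V)) (t : Trail V) (ht : Valid G t) (hcard : (alive t).card ≤ h) :
    Ψ t (L.map .dec ++ r) ≤ ρ * (c * L.length + K * (L.toFinset ∩ alive t).card) +
      reveal G lam L (fun t' => Ψ t' r) t := by
  induction L generalizing t with
  | nil => simp [reveal]
  | cons v L ih =>
    rw [List.map_cons, List.cons_append]
    by_cases hv : v ∈ alive t
    · refine (hdec t v _ ht hv hcard).trans ?_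
      rw [reveal_cons v L]
      set k := ((v :: L).toFinset ∩ alive t).card
      -- Deciding `v` kills it, so one of the `k` expensive vertices is paid for.
      have hk : ∀ τ, v ∉ alive (τ ++ t) → ((L.toFinset ∩ alive (τ ++ t)).card : ℝ) + 1 ≤ k := by
        intro τ hτ
        have : L.toFinset ∩ alive (τ ++ t) ⊆ ((v :: L).toFinset ∩ alive t).erase v := by
          intro x hx
          rw [Finset.mem_inter] at hx
          refine Finset.mem_erase.2 ⟨?_, Finset.mem_inter.2 ⟨?_, alive_append_subset _ _ hx.2⟩⟩
          · rintro rfl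
            exact hτ hx.2
          · simpa using Or.inr (List.mem_toFinset.1 hx.1)
        have h1 := Finset.card_le_card this
        have hvm : v ∈ (v :: L).toFinset ∩ alive t := Finset.mem_inter.2 ⟨by simp, hv⟩
        rw [Finset.card_erase_of_mem hvm] at h1
        have := Finset.card_pos.2 ⟨v, hvm⟩
        have h2 : (L.toFinset ∩ alive (τ ++ t)).card + 1 ≤ k := by omega
        exact_mod_cast h2
      have := reveal_mono hlam [v] (fun t' => Ψ t' (L.map .dec ++ r))
        (fun t' => ρ * (c * L.length + K * (k - 1)) + reveal G lam L (fun t' => Ψ t' r) t') t ht ?_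
      · rw [reveal_add, reveal_const hlam] at this
        simp only [List.length_cons, Nat.cast_add, Nat.cast_one]
        have h3 : 0 ≤ ρ * c := mul_nonneg hρ hc
        nlinarith
      · intro τ h1 _ _ h4
        refine (ih _ h1 ((Finset.card_le_card (alive_append_subset _ _)).trans hcard)).trans ?_
        have := hk τ (h4 v (by simp))
        gcongr
        linarith
    -- A task for a dead vertex costs a single round. Hence repetitions in `L` are charged only to
    -- its length, and `K` only to its distinct living vertices.
    · refine (hΨ.dead t v _ ht hv).trans ?_
      have h1 := ih t ht hcard
      have h2 : (v :: L).toFinset ∩ alive t = L.toFinset ∩ alive t := by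
        ext x
        simp only [List.toFinset_cons, Finset.mem_inter, Finset.mem_insert]
        constructor
        · rintro ⟨rfl | h, h'⟩
          · exact absurd h' hv
          · exact ⟨h, h'⟩
        · exact fun h => ⟨Or.inr h.1, h.2⟩
      rw [h2]
      simp only [reveal, if_neg hv, List.length_cons, Nat.cast_add, Nat.cast_one]
      linarith

/-- Depth zero is identically zero, so it stands for "no lower bound subtracted". -/
lemma wt_zero_right (a : ℕ) (H : Finset V) (v : V) (F : V → ℝ) :
    wt G lam a 0 H v F = ∑ u ∈ H.filter (G.Adj v), lam * T G lam a (H.erase u) u * F u := by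
  simp [wt, T]

/-- After the sphere around `v` has been revealed, the recursion near `v` is unchanged. -/
lemma reveal_local (hlam : 0 < lam) {sph : V → List V} {m N : ℕ} {v : V}
    (hsph : ∀ w, w ∈ sph v ↔ G.edist v w = (2 * m + 4 : ℕ))
    (hN : (Finset.univ.filter fun x => G.edist v x < (2 * m + 4 : ℕ)).card < N)
    (τ t : Trail V)
    (h3 : ∀ e ∈ τ, e.1 ∈ sph v ∧ ∀ u, e.2 = some u → G.Adj e.1 u)
    (h4 : ∀ w ∈ sph v, w ∉ alive (τ ++ t)) :
    (alive (τ ++ t)).filter (G.Adj v) = (alive t).filter (G.Adj v) ∧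
    (∀ k ≤ 2 * m + 1, ∀ u, G.Adj v u → T G lam k ((alive (τ ++ t)).erase u) u =
      T G lam k ((alive t).erase u) u) ∧
    ∀ u, G.Adj v u → T G lam N ((alive (τ ++ t)).erase u) u =
      pUn G lam ((alive (τ ++ t)).erase u) u := by
  -- Partners of sphere vertices lie at distance at least `2 * m + 3` from `v`, so nothing within `2
  -- * m + 2` dies. The recursion of depth `2 * m + 1` at a neighbor of `v` sees no further than
  -- that; this explains the radius `2 * m + 4`.
  have hnear : ∀ x, G.edist v x ≤ (2 * m + 2 : ℕ) → (x ∈ alive (τ ++ t) ↔ x ∈ alive t) := by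
    intro x hx
    refine ⟨fun h => alive_append_subset _ _ h, fun h => mem_alive_append h fun e he => ?_⟩
    obtain ⟨h5, h6⟩ := h3 e he
    have h7 := (hsph _).1 h5
    constructor
    · rintro rfl
      rw [h7] at hx
      exact absurd (Nat.cast_le.1 hx) (by omega)
    · rintro u hu rfl
      have h8 := SimpleGraph.edist_triangle (G := G) (u := v) (v := u) (w := e.1)
      rw [h7, SimpleGraph.edist_eq_one_iff_adj.2 (h6 u hu).symm] at h8
      have h9 : ((2 * m + 4 : ℕ) : ℕ∞) ≤ ((2 * m + 3 : ℕ) : ℕ∞) := by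
        refine h8.trans ?_
        have : ((2 * m + 3 : ℕ) : ℕ∞) = (2 * m + 2 : ℕ) + 1 := by push_cast; ring
        rw [this]
        gcongr
      exact absurd (Nat.cast_le.1 h9) (by omega)
  refine ⟨?_, ?_, ?_⟩
  · ext u
    simp only [Finset.mem_filter]
    refine and_congr_left fun hu => hnear u ?_
    rw [SimpleGraph.edist_eq_one_iff_adj.2 hu]
    exact_mod_cast (by omega : 1 ≤ 2 * m + 2)
  · intro k hk u hu
    refine T_congr k _ _ u fun x hx => ?_
    simp only [Finset.mem_erase]
    rw [hnear x ((edist_le_succ_of_adj hu hx).trans (by exact_mod_cast (by omega)))]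
  · intro u hu
    -- Every edge that leaves the open ball ends on the sphere, which is dead, so the ball is closed
    -- under adjacency to living vertices.
    refine T_eq_pUn hlam (Finset.univ.filter fun x => G.edist v x < (2 * m + 4 : ℕ)) N _ u ?_
      (Finset.notMem_erase _ _) ?_ ((Finset.card_le_card Finset.inter_subset_right).trans_lt hN)
    · simp only [Finset.mem_filter, Finset.mem_univ, true_and]
      rw [SimpleGraph.edist_eq_one_iff_adj.2 hu]
      exact_mod_cast (by omega : 1 < 2 * m + 4)
    · intro x hx y hy hxy
      simp only [Finset.mem_filter, Finset.mem_univ, true_and] at hx ⊢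
      have h5 : G.edist v y ≤ (2 * m + 4 : ℕ) := by
        have h8 := SimpleGraph.edist_triangle (G := G) (u := v) (v := x) (w := y)
        rw [SimpleGraph.edist_eq_one_iff_adj.2 hxy] at h8
        exact h8.trans (Order.add_one_le_of_lt hx)
      refine lt_of_le_of_ne h5 fun h6 => ?_
      exact h4 y ((hsph y).2 h6) (Finset.mem_of_mem_erase hy)

/-- The arithmetic behind `chain_dec`. -/
lemma chain_dec_arith {ρ c D ε B s A M Q R κ l K Ψ0 Ψn MΨ QΨ Ψr Y : ℝ} (hρ : 0 ≤ ρ) (hc : 0 ≤ c)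
    (hK : K = 2 * (c * (1 + D) + c * (B + 1))) (hD0 : 0 ≤ D) (hε0 : 0 ≤ ε) (hε1 : ε ≤ 1)
    (hεs : ε * s ≤ 1 / 2) (hB0 : 0 ≤ B) (hl0 : 0 ≤ l) (hl : l ≤ B) (hκ0 : 0 ≤ κ) (hκ : κ ≤ s)
    (hR : R = A - M) (hR0 : 0 ≤ R) (hRε : R ≤ ε * M) (hM0 : 0 ≤ M) (hMQ : M ≤ Q) (hAD : A ≤ D)
    (hdec : (1 + A) * Ψ0 ≤ (1 + A) * (ρ * c) + Ψn + MΨ + R * Ψr)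
    (hrev : Ψr ≤ ρ * (c * l + K * κ) + Y)
    (havg : R * Y ≤ R * (ρ * c) + -MΨ + (R + M) * Ψ0 + (QΨ - Q * Ψ0)) :
    Ψ0 ≤ ρ * K + (Ψn + QΨ) / (1 + Q) := by
  have hs : 0 ≤ s := hκ0.trans hκ
  have hK0 : 0 ≤ K := by rw [hK]; positivity
  have hrevR := mul_le_mul_of_nonneg_left hrev hR0
  have hQ1 : 0 < 1 + Q := by linarith
  -- A failed round returns to `Ψ0`, which thus occurs on both sides. As `A = R + M`, collecting its
  -- terms leaves the weight `1 + Q` of the accepted outcomes.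
  have hfinal : (1 + Q) * Ψ0 ≤ (1 + A) * (ρ * c) + R * (ρ * (c * l + K * κ)) +
      R * (ρ * c) + Ψn + QΨ := by
    have h1 : (R + M) * Ψ0 = A * Ψ0 := by rw [hR]; ring
    rw [mul_add] at hrevR
    rw [h1] at havg
    linarith
  have hcost : (1 + A) * (ρ * c) + R * (ρ * (c * l + K * κ)) + R * (ρ * c) ≤
      (1 + Q) * (ρ * K) := by
    have h1 : (1 + A) * c ≤ (1 + Q) * (c * (1 + D)) := by
      have h1 : (1 + A) * c ≤ (1 + D) * c := by gcongr
      have h2 : 0 ≤ Q * (c * (1 + D)) := mul_nonneg (by linarith) (by positivity)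
      linarith
    have hRQ : R ≤ ε * (1 + Q) := hRε.trans (mul_le_mul_of_nonneg_left (by linarith) hε0)
    have h2 : R * (c * l + c) ≤ (1 + Q) * (c * (B + 1)) := by
      have h3 : R ≤ 1 + Q := hRQ.trans (mul_le_of_le_one_left hQ1.le hε1)
      have h4 : c * l + c ≤ c * (B + 1) := by
        have := mul_le_mul_of_nonneg_left hl hc
        linarith
      exact mul_le_mul h3 h4 (by positivity) hQ1.le
    -- The recursive decisions use at most half of the budget `K`, by `ε * s ≤ 1 / 2`. The factor
    -- `2` in `K` leaves the other half for the direct costs.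
    have h3 : R * (K * κ) ≤ (1 + Q) * (K / 2) := by
      calc R * (K * κ) ≤ R * (K * s) := by gcongr
        _ ≤ ε * (1 + Q) * (K * s) := by
          gcongr
        _ = (1 + Q) * (K * (ε * s)) := by ring
        _ ≤ (1 + Q) * (K * (1 / 2)) := by gcongr
        _ = _ := by ring
    have h4 : (1 + A) * c + R * (c * l + K * κ) + R * c ≤ (1 + Q) * K := by
      have : (1 + Q) * K = (1 + Q) * (c * (1 + D)) + (1 + Q) * (c * (B + 1)) +
          (1 + Q) * (K / 2) := by rw [hK]; ring
      rw [this]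
      linarith
    have := mul_le_mul_of_nonneg_left h4 hρ
    linarith
  rw [← sub_le_iff_le_add', le_div_iff₀ hQ1]
  linarith

/-- The expected cost of deciding one vertex is bounded by a constant, and the status of the vertex
has its conditional distribution. -/
lemma chain_dec (hlam : 0 < lam) {Ψ : Trail V → List (Task V) → ℝ} {ρ c D ε B s : ℝ}
    {sph : V → List V} {m N : ℕ} (hΨ : ChainBound G lam Ψ ρ c sph m N) (hρ : 0 ≤ ρ) (hc : 0 ≤ c)
    (hsph : ∀ v w, w ∈ sph v ↔ G.edist v w = (2 * m + 4 : ℕ))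
    (hN : ∀ v, (Finset.univ.filter fun x => G.edist v x < (2 * m + 4 : ℕ)).card < N)
    (hD : ∀ (H : Finset V) (v : V), lam * ((H.filter (G.Adj v)).card : ℝ) ≤ D) (hD0 : 0 ≤ D)
    (hε : ∀ (H : Finset V) (v : V), T G lam (2 * m + 1) H v ≤ (1 + ε) * T G lam (2 * m) H v)
    (hε0 : 0 ≤ ε) (hε1 : ε ≤ 1) (hεs : ε * s ≤ 1 / 2)
    (hB : ∀ v, ((sph v).length : ℝ) ≤ B) (hs : ∀ v, ((sph v).toFinset.card : ℝ) ≤ s)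
    (hB0 : 0 ≤ B) (h : ℕ) (t : Trail V) (v : V) (r : List (Task V)) (ht : Valid G t)
    (hv : v ∈ alive t) (hcard : (alive t).card ≤ h) :
    Ψ t (.dec v :: r) ≤ ρ * (2 * (c * (1 + D) + c * (B + 1))) +
      reveal G lam [v] (fun t' => Ψ t' r) t := by
  -- Recursive decisions take place after `v` has been removed, so fewer vertices are alive. The
  -- restart of `v` has no such decrease; it is kept as the unknown `Ψ0` and eliminated
  -- algebraically.
  induction h generalizing t v r with
  | zero =>
    have := Finset.card_pos.2 ⟨v, hv⟩
    omega
  | succ h ih =>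
    set K := 2 * (c * (1 + D) + c * (B + 1)) with hKdef
    have hK : 0 ≤ K := by positivity
    have hcard1 : (alive ((v, none) :: t)).card ≤ h := by
      have := Finset.card_erase_lt_of_mem hv
      show ((alive t).erase v).card ≤ h
      omega
    have hrev := chain_reveal hlam hΨ hρ hK hc h (fun t v r h1 h2 h3 => ih t v r h1 h2 h3)
      (sph v) (.fin v t.length :: r) ((v, none) :: t) (ht.none hv) hcard1
    set Ψ0 := Ψ t (.dec v :: r) with hΨ0
    have hdec := hΨ.dec t v r ht hv
    set H := (alive t).erase v with hH
    have haH : alive ((v, none) :: t) = H := rfl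
    set Nv := H.filter (G.Adj v) with hNv
    set lo : V → ℝ := fun u => T G lam (2 * m) (H.erase u) u with hlo
    set hi : V → ℝ := fun u => T G lam (2 * m + 1) (H.erase u) u with hhi
    set q : V → ℝ := fun u => pUn G lam (H.erase u) u with hq
    set Ψs : V → ℝ := fun u => Ψ ((v, some u) :: t) r with hΨs
    set R := wt G lam (2 * m + 1) (2 * m) H v fun _ => 1 with hR
    have hReq : R = ∑ u ∈ Nv, lam * hi u - ∑ u ∈ Nv, lam * lo u := by
      rw [hR, wt, ← Finset.sum_sub_distrib]
      exact Finset.sum_congr rfl fun u _ => by ring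
    have hX : (wt G lam (2 * m + 1) 0 H v fun _ => 1) = ∑ u ∈ Nv, lam * hi u := by
      rw [wt_zero_right]
      exact Finset.sum_congr rfl fun u _ => by ring
    have hM : wt G lam (2 * m) 0 H v Ψs = ∑ u ∈ Nv, lam * lo u * Ψs u := wt_zero_right _ _ _ _
    -- The exact probability equals a sufficiently deep truncation, so the alternating bounds apply
    -- to it.
    have hpT : ∀ u, ∃ k, 2 * m + 1 ≤ k ∧ q u = T G lam k (H.erase u) u := fun u =>
      ⟨2 * m + 1 + ((H.erase u) ∩ Finset.univ).card + 1, by omega,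
        (T_eq_pUn hlam Finset.univ _ _ u (Finset.mem_univ _) (Finset.notMem_erase _ _)
          (fun _ _ _ _ _ => Finset.mem_univ _) (by omega)).symm⟩
    have hloq : ∀ u, lo u ≤ q u := fun u => by
      obtain ⟨k, hk, h⟩ := hpT u
      rw [h]
      exact (T_even_le_odd_ge hlam m).1 k (by omega) _ _
    have hlohi : ∀ u, lo u ≤ hi u := fun u => (T_even_le_odd_ge hlam m).1 _ (by omega) _ _
    have hlo0 : ∀ u, 0 ≤ lo u := fun u => T_nonneg hlam _ _ _
    have hR0 : 0 ≤ R := by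
      rw [hReq, sub_nonneg]
      exact Finset.sum_le_sum fun u _ => mul_le_mul_of_nonneg_left (hlohi u) hlam.le
    -- Average the finishing inequality over the decisions on the sphere. The weight `R` and the
    -- lower bounds do not depend on them, and the exact conditional probabilities enter linearly,
    -- so `reveal_pAlive` replaces the latter by `q`.
    have havg : R * reveal G lam (sph v) (fun t' => Ψ t' (.fin v t.length :: r)) ((v, none) :: t) ≤
        (R * (ρ * c) + ∑ u ∈ Nv, -(lam * lo u) * Ψs u + (R + ∑ u ∈ Nv, lam * lo u) * Ψ0) +
          ∑ u ∈ Nv, (lam * (Ψs u - Ψ0)) * q u := by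
      have hrp : ∀ u ∈ Nv, q u = reveal G lam (sph v) (pAlive G lam u) ((v, none) :: t) := by
        intro u hu
        have hu' := Finset.mem_filter.1 hu
        rw [reveal_pAlive hlam, pAlive, if_pos (by rw [haH]; exact hu'.1), haH]
        rw [hsph, SimpleGraph.edist_eq_one_iff_adj.2 hu'.2]
        intro h
        have : 1 = 2 * m + 4 := by exact_mod_cast h
        omega
      have hsum : ∑ u ∈ Nv, (lam * (Ψs u - Ψ0)) * q u = ∑ u ∈ Nv, (lam * (Ψs u - Ψ0)) *
          reveal G lam (sph v) (pAlive G lam u) ((v, none) :: t) :=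
        Finset.sum_congr rfl fun u hu => by rw [hrp u hu]
      rw [hsum, ← reveal_affine hlam, ← reveal_mul]
      refine reveal_mono hlam _ _ _ _ (ht.none hv) fun τ h1 h2 h3 h4 => ?_
      obtain ⟨l1, l2, l3⟩ := reveal_local hlam (hsph v) (hN v) τ ((v, none) :: t) h3 h4
      have hfin := hΨ.fin τ t v r h1 h2
      have hRτ : (wt G lam (2 * m + 1) (2 * m) (alive (τ ++ (v, none) :: t)) v fun _ => 1) = R := by
        rw [wt, l1]
        refine Finset.sum_congr rfl fun u hu => ?_
        have hu' := Finset.mem_filter.1 hu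
        rw [l2 _ le_rfl u hu'.2, l2 _ (by omega) u hu'.2]
        rfl
      have hWτ : ∀ F : V → ℝ, wt G lam N (2 * m) (alive (τ ++ (v, none) :: t)) v F =
          ∑ u ∈ Nv, lam * (pAlive G lam u (τ ++ (v, none) :: t) - lo u) * F u := by
        intro F
        rw [wt, l1]
        refine Finset.sum_congr rfl fun u hu => ?_
        have hu' : u ∈ Finset.filter (G.Adj v) (alive (τ ++ (v, none) :: t)) := by
          rw [l1]
          exact hu
        have hu'' := Finset.mem_filter.1 hu'
        rw [l3 u hu''.2, l2 _ (by omega) u hu''.2, pAlive, if_pos hu''.1]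
        rfl
      rw [hRτ, hWτ, hWτ] at hfin
      refine hfin.trans (le_of_eq ?_)
      have e1 : ∑ u ∈ Nv, lam * (pAlive G lam u (τ ++ (v, none) :: t) - lo u) *
            Ψ ((v, some u) :: t) r =
          ∑ u ∈ Nv, lam * Ψs u * pAlive G lam u (τ ++ (v, none) :: t) +
            ∑ u ∈ Nv, -(lam * lo u) * Ψs u := by
        rw [← Finset.sum_add_distrib]
        exact Finset.sum_congr rfl fun u _ => by ring
      have e2 : ∑ u ∈ Nv, lam * (pAlive G lam u (τ ++ (v, none) :: t) - lo u) * 1 =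
          ∑ u ∈ Nv, lam * pAlive G lam u (τ ++ (v, none) :: t) - ∑ u ∈ Nv, lam * lo u := by
        rw [← Finset.sum_sub_distrib]
        exact Finset.sum_congr rfl fun u _ => by ring
      have e3 : ∑ u ∈ Nv, lam * (Ψs u - Ψ0) * pAlive G lam u (τ ++ (v, none) :: t) =
          ∑ u ∈ Nv, lam * Ψs u * pAlive G lam u (τ ++ (v, none) :: t) -
            (∑ u ∈ Nv, lam * pAlive G lam u (τ ++ (v, none) :: t)) * Ψ0 := by
        rw [Finset.sum_mul, ← Finset.sum_sub_distrib]
        exact Finset.sum_congr rfl fun u _ => by ring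
      rw [e1, e2, e3]
      ring
    have e1 : ∑ u ∈ Nv, lam * (Ψs u - Ψ0) * q u =
        ∑ u ∈ Nv, lam * q u * Ψs u - (∑ u ∈ Nv, lam * q u) * Ψ0 := by
      rw [Finset.sum_mul, ← Finset.sum_sub_distrib]
      exact Finset.sum_congr rfl fun u _ => by ring
    have e2 : ∑ u ∈ Nv, -(lam * lo u) * Ψs u = - ∑ u ∈ Nv, lam * lo u * Ψs u := by
      rw [← Finset.sum_neg_distrib]
      exact Finset.sum_congr rfl fun u _ => by ring
    rw [e1, e2] at havg
    rw [hX, hM] at hdec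
    set A := ∑ u ∈ Nv, lam * hi u
    set M := ∑ u ∈ Nv, lam * lo u
    set Q := ∑ u ∈ Nv, lam * q u
    set MΨ := ∑ u ∈ Nv, lam * lo u * Ψs u
    set QΨ := ∑ u ∈ Nv, lam * q u * Ψs u
    set Ψn := Ψ ((v, none) :: t) r
    set kk : ℝ := (((sph v).toFinset ∩ alive ((v, none) :: t)).card : ℝ)
    have hMQ : M ≤ Q := Finset.sum_le_sum fun u _ => mul_le_mul_of_nonneg_left (hloq u) hlam.le
    have hM0 : 0 ≤ M := Finset.sum_nonneg fun u _ => mul_nonneg hlam.le (hlo0 u)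
    have hAD : A ≤ D := by
      refine le_trans ?_ (hD H v)
      have : A = lam * ∑ u ∈ Nv, hi u := (Finset.mul_sum _ _ _).symm
      rw [this]
      gcongr
      refine (Finset.sum_le_card_nsmul _ _ 1 fun u _ => T_le_one hlam _ _ _).trans ?_
      simp [Nv]
    have hRε : R ≤ ε * M := by
      have : A ≤ (1 + ε) * M := by
        rw [Finset.mul_sum]
        refine Finset.sum_le_sum fun u _ => ?_
        have := mul_le_mul_of_nonneg_left (hε (H.erase u) u) hlam.le
        calc lam * hi u ≤ lam * ((1 + ε) * lo u) := this
          _ = _ := by ring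
      rw [hReq]
      linarith
    have hkk : kk ≤ s := by
      refine le_trans ?_ (hs v)
      exact Nat.cast_le.2 (Finset.card_le_card Finset.inter_subset_left)
    have hkk0 : 0 ≤ kk := Nat.cast_nonneg _
    have hp : pUn G lam H v = 1 / (1 + Q) := by
      rw [pUn_eq hlam (Finset.notMem_erase _ _), Finset.mul_sum]
    have hgoal : reveal G lam [v] (fun t' => Ψ t' r) t = (Ψn + QΨ) / (1 + Q) := by
      simp only [reveal, if_pos hv]
      rw [← hH, hp, add_div, Finset.sum_div]
      congr 1
      · simp only [Ψn]; ring
      · refine Finset.sum_congr rfl fun u _ => ?_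
        simp only [hq, hΨs]; ring
    rw [hgoal]
    exact chain_dec_arith hρ hc hKdef hD0 hε0 hε1 hεs hB0 (Nat.cast_nonneg _) (hB v) hkk0 hkk hReq
      hR0 hRε hM0 hMQ hAD hdec hrev havg

/-- The expected cost of the whole chain is linear, and the output has the Gibbs distribution. -/
lemma chain_total (hlam : 0 < lam) {Ψ : Trail V → List (Task V) → ℝ} {ρ c D ε B s : ℝ}
    {sph : V → List V} {m N : ℕ} (hΨ : ChainBound G lam Ψ ρ c sph m N) (hρ : 0 ≤ ρ) (hc : 0 ≤ c)
    (hsph : ∀ v w, w ∈ sph v ↔ G.edist v w = (2 * m + 4 : ℕ))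
    (hN : ∀ v, (Finset.univ.filter fun x => G.edist v x < (2 * m + 4 : ℕ)).card < N)
    (hD : ∀ (H : Finset V) (v : V), lam * ((H.filter (G.Adj v)).card : ℝ) ≤ D) (hD0 : 0 ≤ D)
    (hε : ∀ (H : Finset V) (v : V), T G lam (2 * m + 1) H v ≤ (1 + ε) * T G lam (2 * m) H v)
    (hε0 : 0 ≤ ε) (hε1 : ε ≤ 1) (hεs : ε * s ≤ 1 / 2)
    (hB : ∀ v, ((sph v).length : ℝ) ≤ B) (hs : ∀ v, ((sph v).toFinset.card : ℝ) ≤ s)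
    (hB0 : 0 ≤ B) (g : Finset (Sym2 V) → ℝ) (a : ℝ)
    (hfin : ∀ t, Valid G t → Ψ t [] ≤ a + g (edges t))
    (L : List V) (hL : ∀ v, v ∈ L) :
    Ψ [] (L.map .dec) ≤ ρ * (c * L.length + 2 * (c * (1 + D) + c * (B + 1)) * Fintype.card V) + a +
      wsum G lam Finset.univ g / Z G lam Finset.univ := by
  have hK : 0 ≤ 2 * (c * (1 + D) + c * (B + 1)) := by positivity
  have h1 := chain_reveal hlam hΨ hρ hK hc (Fintype.card V)
    (fun t v r h1 h2 h3 => chain_dec hlam hΨ hρ hc hsph hN hD hD0 hε hε0 hε1 hεs hB hs hB0 _ t v r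
      h1 h2 h3) L [] [] trivial (Finset.card_le_univ _)
  have h2 := reveal_mono hlam L (fun t' => Ψ t' []) (fun t' => a + g (edges t')) [] trivial
    (fun τ h _ _ _ => hfin _ h)
  rw [reveal_add, reveal_const hlam, reveal_edges hlam g L [] (fun v _ => hL v)] at h2
  rw [List.append_nil] at h1
  have h3 : (L.toFinset ∩ alive ([] : Trail V)).card = Fintype.card V := by
    have : L.toFinset ∩ alive ([] : Trail V) = Finset.univ := by
      ext x
      simp [alive, hL]
    rw [this, Finset.card_univ]
  rw [h3] at h1
  simp only [alive, edges, Finset.union_empty] at h2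
  linarith

end Chain
end MatchingSampler
end

/-! ### Potentials, loops over neighbors, and the tree recursion on the machine. -/

noncomputable section
namespace MatchingSampler

open RAM

/-! ### Potentials and deterministic runs -/

/-- A bounded potential that exceeds its expectation after one step of the machine by at most `ρ`. -/
structure Super (Φ : Config → ℝ) (ρ : ℝ) : Prop where
  cost : 0 ≤ ρ
  nonneg : ∀ c, 0 ≤ Φ c
  bdd : ∃ B, ∀ c, Φ c ≤ B
  nop : ∀ k S, Φ (.nop :: k, S) ≤ ρ + Φ (k, S)
  op : ∀ o k S, Φ (.op o :: k, S) ≤ ρ + Φ (k, o.exec S)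
  seq : ∀ p q k S, Φ (.seq p q :: k, S) ≤ ρ + Φ (p :: q :: k, S)
  ite_eq : ∀ i j p q k S, Φ (.ite (.eq i j) p q :: k, S) ≤
    ρ + Φ ((if S.reg i = S.reg j then p else q) :: k, S)
  loop_lt : ∀ i j p k S, Φ (.loop (.lt i j) p :: k, S) ≤
    ρ + Φ (if S.reg i < S.reg j then p :: .loop (.lt i j) p :: k else k, S)
  coin : ∀ i p q k S, 0 ≤ S.rreg i → S.rreg i ≤ 1 → Φ (.ite (.coin i) p q :: k, S) ≤
    ρ + (S.rreg i * Φ (p :: k, S) + (1 - S.rreg i) * Φ (q :: k, S))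

/-- The program `P` deterministically leads from `S` to `S'` within time `T`. -/
def Runs (P : Prog) (S : State) (T : ℕ) (S' : State) : Prop :=
  ∀ Φ ρ, Super Φ ρ → ∀ k, Φ (P :: k, S) ≤ ρ * T + Φ (k, S')

/-- Potentials are only bounded from above, so a run may be charged more time than it takes. -/
lemma Runs.mono {P : Prog} {S S' : State} {T T' : ℕ} (h : Runs P S T S') (hT : T ≤ T') :
    Runs P S T' S' := fun Φ ρ hΦ k => by
  have h1 := h Φ ρ hΦ k
  have h2 : (T : ℝ) ≤ T' := Nat.cast_le.2 hT
  have := mul_le_mul_of_nonneg_left h2 hΦ.cost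
  linarith

lemma Runs.nop (S : State) : Runs .nop S 1 S := fun Φ ρ hΦ k => by
  simpa using hΦ.nop k S

lemma Runs.seq {p q : Prog} {S S' S'' : State} {T T' : ℕ} (h : Runs p S T S')
    (h' : Runs q S' T' S'') : Runs (.seq p q) S (T + T' + 1) S'' := fun Φ ρ hΦ k => by
  have h1 := hΦ.seq p q k S
  have h2 := h Φ ρ hΦ (q :: k)
  have h3 := h' Φ ρ hΦ k
  push_cast
  linarith

lemma Runs.ite_pos {p q : Prog} {S S' : State} {T i j : ℕ} (h : Runs p S T S')
    (hij : S.reg i = S.reg j) : Runs (.ite (.eq i j) p q) S (T + 1) S' := fun Φ ρ hΦ k => by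
  have h1 := hΦ.ite_eq i j p q k S
  rw [if_pos hij] at h1
  have h2 := h Φ ρ hΦ k
  push_cast
  linarith

lemma Runs.ite_neg {p q : Prog} {S S' : State} {T i j : ℕ} (h : Runs q S T S')
    (hij : S.reg i ≠ S.reg j) : Runs (.ite (.eq i j) p q) S (T + 1) S' := fun Φ ρ hΦ k => by
  have h1 := hΦ.ite_eq i j p q k S
  rw [if_neg hij] at h1
  have h2 := h Φ ρ hΦ k
  push_cast
  linarith

lemma Runs.loop_done {p : Prog} {S : State} {i j : ℕ} (hij : ¬ S.reg i < S.reg j) :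
    Runs (.loop (.lt i j) p) S 1 S := fun Φ ρ hΦ k => by
  have h1 := hΦ.loop_lt i j p k S
  rw [if_neg hij] at h1
  simpa using h1

lemma Runs.loop_step {p : Prog} {S S' S'' : State} {T T' i j : ℕ} (hij : S.reg i < S.reg j)
    (h : Runs p S T S') (h' : Runs (.loop (.lt i j) p) S' T' S'') :
    Runs (.loop (.lt i j) p) S (T + T' + 1) S'' := fun Φ ρ hΦ k => by
  have h1 := hΦ.loop_lt i j p k S
  rw [if_pos hij] at h1
  have h2 := h Φ ρ hΦ (.loop (.lt i j) p :: k)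
  have h3 := h' Φ ρ hΦ k
  push_cast
  linarith

/-- A sequence of elementary operations. -/
def block : List Op → Prog
  | [] => .nop
  | o :: os => .seq (.op o) (block os)

lemma Runs.block (os : List Op) (S : State) :
    Runs (block os) S (2 * os.length + 1) (os.foldl Op.exec S) := by
  induction os generalizing S with
  | nil => simpa [MatchingSampler.block] using Runs.nop S
  | cons o os ih =>
    have h1 : Runs (.op o) S 1 (o.exec S) := fun Φ ρ hΦ k => by simpa using hΦ.op o k S
    refine (h1.seq (ih _)).mono ?_
    simp only [List.length_cons]
    omega

/-! ### The adjacency lists in memory -/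

lemma getD_flatMap {α : Type*} (L : List α) (f : α → List ℕ) (i j : ℕ) (hi : i < L.length)
    (hj : j < (f L[i]).length) :
    (L.flatMap f).getD (((L.take i).map fun a => (f a).length).sum + j) 0 = (f L[i])[j] := by
  induction L generalizing i with
  | nil => simp at hi
  | cons a L ih =>
    cases i with
    | zero =>
      simp only [List.getElem_cons_zero] at hj
      simp [List.getElem?_append_left hj, List.getElem?_eq_getElem hj]
    | succ i =>
      have := ih i (by simpa using hi) (by simpa using hj)
      simp only [List.take_succ_cons, List.map_cons, List.sum_cons, List.flatMap_cons,
        List.getElem_cons_succ]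
      rw [List.getD_append_right _ _ _ _ (by omega), ← this]
      congr 1
      omega

variable {n : ℕ} {G : SimpleGraph (Fin n)} (A : AdjLists G)

/-- The position at which the neighbors of `v` start. -/
def offset (v : ℕ) : ℕ := (A.input 0).arr 0 v

/-- The arrays `0` and `1` hold the adjacency lists. -/
def HasGraph (f : ℕ → ℕ → ℕ) : Prop := f 0 = (A.input 0).arr 0 ∧ f 1 = (A.input 0).arr 1

lemma offset_succ (v : Fin n) : offset A (v + 1) = offset A v + (A.nbrs v).length := by
  have h1 : (v : ℕ) + 1 ≤ n := v.2
  have h2 : (v : ℕ) < (List.finRange n).length := by simp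
  simp only [offset, AdjLists.input, if_true, if_pos h1, if_pos v.2.le]
  rw [List.take_succ_eq_append_getElem h2]
  simp

lemma input_nbr (v : Fin n) (j : ℕ) (hj : j < (A.nbrs v).length) :
    (A.input 0).arr 1 (offset A v + j) = ((A.nbrs v)[j] : Fin n) := by
  have h2 : (v : ℕ) < (List.finRange n).length := by simp
  have := getD_flatMap (List.finRange n) (fun v => (A.nbrs v).map Fin.val) v j h2
    (by simpa using hj)
  simp only [offset, AdjLists.input, if_true, if_pos v.2.le, one_ne_zero, if_false]
  simp only [List.length_map] at this
  rw [List.map_flatMap, this]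
  simp

/-! ### Iterating over the neighbors of a vertex -/

/-- Runs `body` with register `b + 2` ranging over the neighbors of the vertex in register `vr`.
Register `2` has to hold `1`. -/
def forNbrs (vr b : ℕ) (body : Prog) : Prog :=
  .seq (block [.add (b + 1) vr 2, .load (b + 1) 0 (b + 1), .load b 0 vr])
    (.loop (.lt b (b + 1)) (.seq (block [.load (b + 2) 1 b, .add b b 2]) body))

/-- The state `S` with register `i` set to `x`. -/
abbrev setReg (S : State) (i x : ℕ) : State := { S with reg := Function.update S.reg i x }

section forNbrs

variable {A}

/-- The invariant is indexed by the neighbors still to be visited, so it can state what the rest of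
the loop will contribute. The body must preserve the position and the end of the list, which is why
nested loops use higher registers. -/
lemma forNbrs_loop_runs {v : Fin n} {Inv : List (Fin n) → State → Prop} {c b : ℕ} {body : Prog}
    (hb : 2 < b) (hbase : ∀ l S, Inv l S → HasGraph A S.arr ∧ S.reg 2 = 1)
    (hreg : ∀ l S i x, Inv l S → b ≤ i → i ≤ b + 2 → Inv l (setReg S i x))
    (hbody : ∀ u l S, u ∈ A.nbrs v → Inv (u :: l) S → S.reg (b + 2) = (u : ℕ) →
      ∃ S', Runs body S c S' ∧ Inv l S' ∧ S'.reg b = S.reg b ∧ S'.reg (b + 1) = S.reg (b + 1))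
    (l : List (Fin n)) (S : State) (j : ℕ) (hS : Inv l S) (hj : (A.nbrs v).drop j = l)
    (hjl : j + l.length = (A.nbrs v).length)
    (h1 : S.reg b = offset A v + j) (h2 : S.reg (b + 1) = offset A v + (A.nbrs v).length) :
    ∃ S', Runs (.loop (.lt b (b + 1)) (.seq (block [.load (b + 2) 1 b, .add b b 2]) body)) S
      ((c + 7) * l.length + 1) S' ∧ Inv [] S' := by
  induction l generalizing S j with
  | nil =>
    refine ⟨S, ?_, hS⟩
    refine (Runs.loop_done ?_).mono (by simp)
    simp at hjl
    omega
  | cons u l ih =>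
    have hlt : S.reg b < S.reg (b + 1) := by
      simp only [List.length_cons] at hjl
      omega
    have hjlt : j < (A.nbrs v).length := by
      simp only [List.length_cons] at hjl
      omega
    have hu : (A.nbrs v)[j] = u ∧ (A.nbrs v).drop (j + 1) = l := by
      rw [List.drop_eq_getElem_cons hjlt] at hj
      exact List.cons.inj hj
    obtain ⟨⟨hg0, hg1⟩, hone⟩ := hbase _ _ hS
    have hval : S.arr 1 (S.reg b) = (u : ℕ) := by
      rw [hg1, h1, input_nbr A v j hjlt, hu.1]
    set S1 := ([.load (b + 2) 1 b, .add b b 2] : List Op).foldl Op.exec S with hS1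
    have hS1eq : S1 = setReg (setReg S (b + 2) u) b (S.reg b + 1) := by
      simp only [hS1, List.foldl, Op.exec, hval, setReg]
      congr 2
      rw [Function.update_of_ne (by omega), Function.update_of_ne (by omega), hone]
    have hI1 : Inv (u :: l) S1 := by
      rw [hS1eq]
      exact hreg _ _ _ _ (hreg _ _ _ _ hS (by omega) (by omega)) (by omega) (by omega)
    obtain ⟨S2, hr, hI2, e1, e2⟩ := hbody u l S1 (hu.1 ▸ List.getElem_mem hjlt) hI1
      (by rw [hS1eq]; simp)
    obtain ⟨S3, hr3, hI3⟩ := ih S2 (j + 1) hI2 hu.2 (by simp only [List.length_cons] at hjl; omega)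
      (by rw [e1, hS1eq]; simp [h1]; ring) (by rw [e2, hS1eq]; simp [h2])
    refine ⟨S3, (Runs.loop_step hlt ((Runs.block _ S).seq hr) hr3).mono ?_, hI3⟩
    simp only [List.length_cons, List.length_nil]
    ring_nf
    omega

/-- The list of `v` ends where the list of `v + 1` starts; this entry exists even for the last
vertex because array `0` also stores the total length. -/
lemma forNbrs_start {v : Fin n} {b vr : ℕ} (hvr : vr < b) {S : State}
    (hg : HasGraph A S.arr) (hone : S.reg 2 = 1) (hv : S.reg vr = (v : ℕ)) :
    ([.add (b + 1) vr 2, .load (b + 1) 0 (b + 1), .load b 0 vr] : List Op).foldl Op.exec S =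
      setReg (setReg S (b + 1) (offset A v + (A.nbrs v).length)) b (offset A v) := by
  have e : ∀ x, S.arr 0 x = offset A x := fun x => by rw [hg.1]; rfl
  simp only [List.foldl, Op.exec, setReg]
  congr 1
  funext i
  simp only [Function.update_apply, hone, hv, e, ← offset_succ]
  split_ifs <;> first | rfl | (exfalso; omega)

lemma forNbrs_runs {v : Fin n} {Inv : List (Fin n) → State → Prop} {c b vr : ℕ} {body : Prog}
    (hb : 2 < b) (hvr : vr < b) (hbase : ∀ l S, Inv l S → HasGraph A S.arr ∧ S.reg 2 = 1)
    (hreg : ∀ l S i x, Inv l S → b ≤ i → i ≤ b + 2 → Inv l (setReg S i x))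
    (hbody : ∀ u l S, u ∈ A.nbrs v → Inv (u :: l) S → S.reg (b + 2) = (u : ℕ) →
      ∃ S', Runs body S c S' ∧ Inv l S' ∧ S'.reg b = S.reg b ∧ S'.reg (b + 1) = S.reg (b + 1))
    {S : State} (hS : Inv (A.nbrs v) S) (hv : S.reg vr = (v : ℕ)) {Δ : ℕ}
    (hΔ : (A.nbrs v).length ≤ Δ) :
    ∃ S', Runs (forNbrs vr b body) S ((c + 7) * Δ + 9) S' ∧ Inv [] S' := by
  obtain ⟨hg, hone⟩ := hbase _ _ hS
  have hst := forNbrs_start hvr hg hone hv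
  obtain ⟨S', hr, hI⟩ := forNbrs_loop_runs hb hbase hreg hbody (A.nbrs v)
    (setReg (setReg S (b + 1) (offset A v + (A.nbrs v).length)) b (offset A v)) 0
    (hreg _ _ _ _ (hreg _ _ _ _ hS (by omega) (by omega)) (by omega) (by omega)) (by simp)
    (by simp) (by simp) (by simp)
  rw [← hst] at hr
  refine ⟨S', ((Runs.block _ S).seq hr).mono ?_, hI⟩
  simp only [List.length_cons, List.length_nil]
  have := Nat.mul_le_mul_left (c + 7) hΔ
  omega

end forNbrs

/-! ### Computing the tree recursion -/

variable (lam : ℝ)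

/-- The conventions on the memory that all subprograms rely on. -/
structure Base (S : State) : Prop where
  graph : HasGraph A S.arr
  zero : S.reg 1 = 0
  one : S.reg 2 = 1
  lam : S.rreg 0 = lam

/-- Array `2` marks the vertices outside `H`. -/
def Dead (S : State) (H : Finset (Fin n)) : Prop :=
  ∀ x : Fin n, S.arr 2 x = if x ∈ H then 0 else 1

/-- Only registers from `b` on have changed. -/
structure Frame (b : ℕ) (S S' : State) : Prop where
  reg : ∀ i < b, S'.reg i = S.reg i
  rreg : ∀ i < b, S'.rreg i = S.rreg i
  arr : S'.arr = S.arr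
  out : S'.out = S.out

variable {A lam}

lemma Frame.trans {b b' : ℕ} {S S' S'' : State} (h : Frame b S S') (h' : Frame b' S' S'')
    (hb : b ≤ b') : Frame b S S'' :=
  ⟨fun i hi => (h'.reg i (by omega)).trans (h.reg i hi),
    fun i hi => (h'.rreg i (by omega)).trans (h.rreg i hi), h'.arr.trans h.arr, h'.out.trans h.out⟩

lemma Frame.base {b : ℕ} {S S' : State} (h : Frame b S S') (hb : 2 < b) (hS : Base A lam S) :
    Base A lam S' :=
  ⟨by rw [h.arr]; exact hS.graph, by rw [h.reg _ (by omega), hS.zero],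
    by rw [h.reg _ hb, hS.one], by rw [h.rreg _ (by omega), hS.lam]⟩

lemma Frame.dead {b : ℕ} {S S' : State} (h : Frame b S S') {H : Finset (Fin n)} (hS : Dead S H) :
    Dead S' H := by
  intro x
  rw [h.arr, hS x]

variable (A lam) in
/-- `P vr b` computes `f H v` in real register `b`, where `v` is in register `vr` and `H` is the set
of living vertices; it uses only the registers from `b` on. -/
def Computes (P : ℕ → ℕ → Prog) (f : Finset (Fin n) → Fin n → ℝ) (c : ℕ) : Prop :=
  ∀ vr b S H (v : Fin n), vr < b → 2 < b → Base A lam S → Dead S H → S.reg vr = (v : ℕ) →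
    ∃ S', Runs (P vr b) S c S' ∧ Frame b S S' ∧ S'.rreg b = f H v

/-- Runs `p` if the vertex in register `b + 2` is alive. -/
def guarded (b : ℕ) (p : Prog) : Prog :=
  .seq (block [.load (b + 3) 2 (b + 2)]) (.ite (.eq (b + 3) 1) p .nop)

/-- Computes the weight of the neighbor in register `b + 2`. -/
def weightProg (P Q : ℕ → ℕ → Prog) (b : ℕ) : Prog :=
  .seq (block [.store 2 (b + 2) 2]) (.seq (P (b + 2) (b + 4)) (.seq (Q (b + 2) (b + 5))
    (block [.store 2 (b + 2) 1, .rsub (b + 4) (b + 4) (b + 5), .rmul (b + 4) 0 (b + 4)])))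

/-- Marking `u` as dead makes the two subprograms see `H.erase u`. Since `u` was alive, clearing its
mark afterwards restores the arrays exactly, as `Frame` demands. -/
lemma weightProg_runs {P Q : ℕ → ℕ → Prog} {f g : Finset (Fin n) → Fin n → ℝ} {c c' : ℕ}
    (hP : Computes A lam P f c) (hQ : Computes A lam Q g c') {b : ℕ} (hb : 2 < b) {S : State}
    {H : Finset (Fin n)} {u : Fin n} (hS : Base A lam S) (hH : Dead S H) (hu : u ∈ H)
    (hreg : S.reg (b + 2) = (u : ℕ)) :
    ∃ S', Runs (weightProg P Q b) S (c + c' + 13) S' ∧ Frame (b + 4) S S' ∧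
      S'.rreg (b + 4) = lam * (f (H.erase u) u - g (H.erase u) u) := by
  set S1 := ([.store 2 (b + 2) 2] : List Op).foldl Op.exec S with hS1
  have hb1 : Base A lam S1 := by
    refine ⟨⟨?_, ?_⟩, ?_, ?_, ?_⟩ <;> simp [hS1, Op.exec, hS.graph.1, hS.graph.2, hS.zero, hS.one,
      hS.lam]
  have hd1 : Dead S1 (H.erase u) := by
    intro x
    simp only [hS1, List.foldl, Op.exec, Function.update_self, hreg, hS.one, Function.update_apply,
      Fin.val_inj, Finset.mem_erase, hH x]
    by_cases hx : x = u <;> simp [hx]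
  obtain ⟨S2, r2, f2, v2⟩ := hP (b + 2) (b + 4) S1 (H.erase u) u (by omega) (by omega) hb1 hd1 hreg
  obtain ⟨S3, r3, f3, v3⟩ := hQ (b + 2) (b + 5) S2 (H.erase u) u (by omega) (by omega)
    (f2.base (by omega) hb1) (f2.dead hd1) ((f2.reg _ (by omega)).trans hreg)
  have f13 := f2.trans f3 (by omega)
  refine ⟨_, ((Runs.block _ S).seq (r2.seq (r3.seq (Runs.block _ S3)))).mono ?_, ?_, ?_⟩
  · simp only [List.length_cons, List.length_nil]
    omega
  · refine ⟨fun i hi => ?_, fun i hi => ?_, ?_, ?_⟩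
    · simp only [List.foldl, Op.exec]
      rw [f13.reg i hi]
      rfl
    · simp only [List.foldl, Op.exec]
      rw [Function.update_of_ne (by omega), Function.update_of_ne (by omega), f13.rreg i hi]
      rfl
    · simp only [List.foldl, Op.exec]
      rw [f13.arr, f13.reg _ (by omega), f13.reg 1 (by omega), hb1.zero]
      have hz : S.arr 2 u = 0 := by rw [hH u, if_pos hu]
      funext a i
      simp only [hS1, List.foldl, Op.exec, Function.update_apply, hreg]
      split_ifs with h1
      · subst h1
        simp only [Function.update_apply]
        split_ifs with h2
        · rw [h2, hz]
        · rfl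
      · rfl
    · simp only [List.foldl, Op.exec]
      rw [f13.out]
      rfl
  · have e1 : S3.rreg 0 = lam := by rw [f13.rreg _ (by omega), hb1.lam]
    have e2 : S3.rreg (b + 4) = f (H.erase u) u := by rw [f3.rreg _ (by omega), v2]
    simp [Op.exec, e1, e2, v3]

/-- Sums the weights of the living neighbors of the vertex in register `vr`. -/
def sumProg (P Q : ℕ → ℕ → Prog) (vr b : ℕ) : Prog :=
  .seq (block [.rconst b 0]) (forNbrs vr b (guarded b
    (.seq (weightProg P Q b) (block [.radd b b (b + 4)]))))

lemma sum_nbrs [DecidableRel G.Adj] (H : Finset (Fin n)) (v : Fin n) (w : Fin n → ℝ) :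
    ((A.nbrs v).map fun u => if u ∈ H then w u else 0).sum = ∑ u ∈ H.filter (G.Adj v), w u := by
  rw [← List.sum_toFinset _ (A.nodup v), ← Finset.sum_filter]
  refine Finset.sum_congr ?_ fun _ _ => rfl
  ext u
  simp [A.mem_iff, and_comm]

/-- Loop invariant: the accumulated value plus the weights of the unvisited neighbors is constant.
-/
lemma sumProg_computes [DecidableRel G.Adj] {P Q : ℕ → ℕ → Prog}
    {f g : Finset (Fin n) → Fin n → ℝ} {c c' Δ : ℕ}
    (hΔ : ∀ v, (A.nbrs v).length ≤ Δ) (hP : Computes A lam P f c) (hQ : Computes A lam Q g c') :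
    Computes A lam (sumProg P Q)
      (fun H v => ∑ u ∈ H.filter (G.Adj v), lam * (f (H.erase u) u - g (H.erase u) u))
      ((c + c' + 30) * Δ + 20) := by
  intro vr b S H v hvr hb hS hH hv
  set w : Fin n → ℝ := fun u => lam * (f (H.erase u) u - g (H.erase u) u) with hw
  set tot := ((A.nbrs v).map fun u => if u ∈ H then w u else 0).sum with htot
  set Inv : List (Fin n) → State → Prop := fun l S' => Frame b S S' ∧
    S'.rreg b + (l.map fun u => if u ∈ H then w u else 0).sum = tot with hInv
  set S1 := ([.rconst b 0] : List Op).foldl Op.exec S with hS1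
  have hf1 : Frame b S S1 := by
    refine ⟨fun i hi => rfl, fun i hi => ?_, rfl, rfl⟩
    simp only [hS1, List.foldl, Op.exec]
    rw [Function.update_of_ne (by omega)]
  have hreg : ∀ l S i x, Inv l S → b ≤ i → i ≤ b + 2 → Inv l (setReg S i x) := by
    rintro l S' i x ⟨h1, h2⟩ hi hi'
    refine ⟨⟨fun j hj => ?_, h1.rreg, h1.arr, h1.out⟩, h2⟩
    exact (Function.update_of_ne (by omega) _ _).trans (h1.reg j hj)
  have hbody : ∀ u l S, u ∈ A.nbrs v → Inv (u :: l) S → S.reg (b + 2) = (u : ℕ) →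
      ∃ S', Runs (guarded b (.seq (weightProg P Q b) (block [.radd b b (b + 4)]))) S (c + c' + 22) S' ∧
        Inv l S' ∧ S'.reg b = S.reg b ∧ S'.reg (b + 1) = S.reg (b + 1) := by
    rintro u l S' - ⟨h1, h2⟩ hu
    set S'' := ([.load (b + 3) 2 (b + 2)] : List Op).foldl Op.exec S' with hS''
    have hf'' : Frame (b + 3) S' S'' := by
      refine ⟨fun i hi => ?_, fun i hi => rfl, rfl, rfl⟩
      simp only [hS'', List.foldl, Op.exec]
      rw [Function.update_of_ne (by omega)]
    have hval : S''.reg (b + 3) = if u ∈ H then 0 else 1 := by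
      simp [hS'', Op.exec, hu, h1.dead hH u]
    have hb'' := hf''.base (by omega) (h1.base hb hS)
    by_cases huH : u ∈ H
    · rw [if_pos huH] at hval
      obtain ⟨S3, r3, f3, e3⟩ := weightProg_runs hP hQ hb hb'' (hf''.dead (h1.dead hH)) huH
        ((hf''.reg _ (by omega)).trans hu)
      have hfr := hf''.trans f3 (by omega)
      refine ⟨_, ((Runs.block _ S').seq (Runs.ite_pos (r3.seq (Runs.block _ S3))
        (hval.trans hb''.zero.symm))).mono ?_, ⟨⟨fun i hi => ?_, fun i hi => ?_, ?_, ?_⟩, ?_⟩, ?_, ?_⟩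
      · simp only [List.length_cons, List.length_nil]
        omega
      · exact (hfr.reg i (by omega)).trans (h1.reg i hi)
      · simp only [List.foldl, Op.exec]
        rw [Function.update_of_ne (by omega)]
        exact (hfr.rreg i (by omega)).trans (h1.rreg i hi)
      · exact hfr.arr.trans h1.arr
      · exact hfr.out.trans h1.out
      · simp only [List.foldl, Op.exec, Function.update_self, e3]
        rw [hfr.rreg b (by omega), ← h2, List.map_cons, List.sum_cons, if_pos huH, hw]
        ring
      · exact hfr.reg b (by omega)
      · exact hfr.reg _ (by omega)
    · rw [if_neg huH] at hval
      refine ⟨S'', ((Runs.block _ S').seq (Runs.ite_neg (Runs.nop _)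
        (by rw [hval, hb''.zero]; omega))).mono ?_, ⟨h1.trans hf'' (by omega), ?_⟩,
        hf''.reg _ (by omega), hf''.reg _ (by omega)⟩
      · simp only [List.length_cons, List.length_nil]
        omega
      · rw [hf''.rreg _ (by omega), ← h2, List.map_cons, List.sum_cons, if_neg huH]
        ring
  obtain ⟨S2, r2, f2, e2⟩ := forNbrs_runs (A := A) (v := v) (Inv := Inv) (c := c + c' + 22) (b := b)
    (vr := vr) (body := guarded b (.seq (weightProg P Q b) (block [.radd b b (b + 4)]))) hb hvr
    (fun l S' h => ⟨(h.1.base hb hS).graph, (h.1.base hb hS).one⟩) hreg hbody (S := S1)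
    ⟨hf1, by simp [hS1, Op.exec, htot]⟩ ((hf1.reg vr hvr).trans hv) (hΔ v)
  refine ⟨S2, ((Runs.block _ S).seq r2).mono ?_, f2, ?_⟩
  · simp only [List.length_cons, List.length_nil]
    have : (c + c' + 22 + 7) * Δ ≤ (c + c' + 30) * Δ := Nat.mul_le_mul_right _ (by omega)
    omega
  · simp only [List.map_nil, List.sum_nil, add_zero] at e2
    rw [e2, htot, sum_nbrs]

/-- Computes the truncated tree recursion. -/
def treeProg : ℕ → ℕ → ℕ → Prog
  | 0, _, b => block [.rconst b 0]
  | k + 1, vr, b => .seq (sumProg (treeProg k) (fun _ b => block [.rconst b 0]) vr b)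
      (block [.rconst (b + 1) 1, .radd b b (b + 1), .rdiv b (b + 1) b])

/-- The running time of `treeProg`. -/
def treeTime (Δ : ℕ) : ℕ → ℕ
  | 0 => 3
  | k + 1 => ((treeTime Δ k + 3 + 30) * Δ + 20) + 8

lemma treeProg_zero_computes [DecidableRel G.Adj] :
    Computes A lam (fun _ b => block [.rconst b 0]) (T G lam 0) 3 := by
  intro vr b S H v hvr hb hS hH hv
  refine ⟨_, Runs.block _ S, ⟨fun i hi => rfl, fun i hi => ?_, rfl, rfl⟩, ?_⟩
  · simp only [List.foldl, Op.exec]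
    rw [Function.update_of_ne (by omega)]
  · simp [Op.exec, T]

/-- The machine has no procedure calls, so the recursion is unrolled in the program text and each
level works in registers above those of its caller. For fixed depth and degree bound the time is
constant. -/
lemma treeProg_computes [DecidableRel G.Adj] {Δ : ℕ} (hΔ : ∀ v, (A.nbrs v).length ≤ Δ) (k : ℕ) :
    Computes A lam (treeProg k) (T G lam k) (treeTime Δ k) := by
  induction k with
  | zero => exact treeProg_zero_computes
  | succ k ih =>
    intro vr b S H v hvr hb hS hH hv
    obtain ⟨S1, r1, f1, e1⟩ := sumProg_computes hΔ ih treeProg_zero_computes vr b S H v hvr hb hS hH hv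
    refine ⟨_, r1.seq (Runs.block _ S1), ⟨fun i hi => f1.reg i hi, fun i hi => ?_, f1.arr, f1.out⟩,
      ?_⟩
    · simp only [List.foldl, Op.exec]
      rw [Function.update_of_ne (by omega), Function.update_of_ne (by omega),
        Function.update_of_ne (by omega), f1.rreg i hi]
    · simp only [List.foldl, Op.exec, Function.update_self]
      rw [Function.update_of_ne (show b + 1 ≠ b by omega), Function.update_self,
        Function.update_of_ne (show b ≠ b + 1 by omega), e1, T]
      simp only [T, sub_zero, Nat.cast_one, ← Finset.mul_sum]
      rw [add_comm]

end MatchingSampler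
end

/-! ### Random choice of a neighbor, and enumeration of a ball. -/

noncomputable section
namespace MatchingSampler

open RAM

variable {n : ℕ} {G : SimpleGraph (Fin n)} {A : AdjLists G} {lam : ℝ}

/-! ### Choosing a neighbor at random -/

/-- Selects the living neighbor in register `b + 2` with probability `weight / rem`, and otherwise
subtracts its weight from `rem`. -/
def pickInner (P Q : ℕ → ℕ → Prog) (b : ℕ) : Prog :=
  .seq (weightProg P Q b) (.seq (block [.rdiv (b + 5) (b + 4) 3])
    (.ite (.coin (b + 5)) (block [.add 8 (b + 2) 2]) (block [.rsub 3 3 (b + 4)])))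

/-- Tries to select the neighbor in register `b + 2` if none has been selected and it is alive. -/
def pickBody (P Q : ℕ → ℕ → Prog) (b : ℕ) : Prog :=
  .ite (.eq 8 1) (guarded b (pickInner P Q b)) .nop

/-- With `rem` in real register `3`, puts `u + 1` into register `8` with probability
`weight u / rem`, for the living neighbors `u` of the vertex in register `vr`. -/
def pickProg (P Q : ℕ → ℕ → Prog) (vr b : ℕ) : Prog :=
  forNbrs vr b (pickBody P Q b)

/-- What `pickProg` preserves. -/
structure PickFrame (b : ℕ) (S S' : State) : Prop where
  reg : ∀ i < b, i ≠ 8 → S'.reg i = S.reg i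
  rreg : S'.rreg 0 = S.rreg 0
  arr : S'.arr = S.arr
  out : S'.out = S.out

lemma PickFrame.base {b : ℕ} {S S' : State} (h : PickFrame b S S') (hb : 2 < b)
    (hS : Base A lam S) : Base A lam S' :=
  ⟨by rw [h.arr]; exact hS.graph, by rw [h.reg _ (by omega) (by omega), hS.zero],
    by rw [h.reg _ hb (by omega), hS.one], by rw [h.rreg, hS.lam]⟩

lemma PickFrame.trans_frame {b b' : ℕ} {S S' S'' : State} (h : PickFrame b S S')
    (h' : Frame b' S' S'') (hb : b ≤ b') (hb0 : 0 < b) : PickFrame b S S'' :=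
  ⟨fun i hi hi' => (h'.reg i (by omega)).trans (h.reg i hi hi'),
    (h'.rreg 0 (by omega)).trans h.rreg, h'.arr.trans h.arr, h'.out.trans h.out⟩

/-- Once register `8` is nonzero, the guard skips all remaining neighbors. -/
lemma pickProg_selected {v : Fin n} {P Q : ℕ → ℕ → Prog} {b : ℕ} (hb : 8 < b) {S0 : State}
    (hS0 : Base A lam S0) (u : Fin n) (l : List (Fin n)) (S : State) (j : ℕ)
    (hS : PickFrame b S0 S) (h8 : S.reg 8 = u + 1) (hj : (A.nbrs v).drop j = l)
    (hjl : j + l.length = (A.nbrs v).length)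
    (h1 : S.reg b = offset A v + j) (h2 : S.reg (b + 1) = offset A v + (A.nbrs v).length) :
    ∃ S', Runs (.loop (.lt b (b + 1)) (.seq (block [.load (b + 2) 1 b, .add b b 2]) (pickBody P Q b))) S (9 * l.length + 1) S' ∧
      PickFrame b S0 S' ∧ S'.reg 8 = u + 1 := by
  refine forNbrs_loop_runs (A := A) (v := v) (c := 2)
    (Inv := fun _ S => PickFrame b S0 S ∧ S.reg 8 = u + 1) (by omega)
    (fun l S h => ⟨(h.1.base (by omega) hS0).graph, (h.1.base (by omega) hS0).one⟩) ?_ ?_ l S j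
    ⟨hS, h8⟩ hj hjl h1 h2
  · rintro l S i x ⟨h, h'⟩ hi -
    refine ⟨⟨fun j hj hj' => ?_, h.rreg, h.arr, h.out⟩, ?_⟩
    · exact (Function.update_of_ne (by omega) _ _).trans (h.reg j hj hj')
    · exact (Function.update_of_ne (by omega) _ _).trans h'
  · rintro w l S - ⟨h, h'⟩ -
    refine ⟨S, Runs.ite_neg (Runs.nop S) ?_, ⟨h, h'⟩, rfl, rfl⟩
    rw [h', (h.base (by omega) hS0).zero]
    omega

lemma forNbrs_fold {b : ℕ} (hb : 2 < b) {v : Fin n} {S : State} {j : ℕ} (hg : HasGraph A S.arr)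
    (hone : S.reg 2 = 1) (hj : j < (A.nbrs v).length) (h1 : S.reg b = offset A v + j) :
    ([.load (b + 2) 1 b, .add b b 2] : List Op).foldl Op.exec S =
      setReg (setReg S (b + 2) ((A.nbrs v)[j] : Fin n)) b (S.reg b + 1) := by
  have hval : S.arr 1 (S.reg b) = ((A.nbrs v)[j] : Fin n) := by
    rw [hg.2, h1, input_nbr A v j hj]
  simp only [List.foldl, Op.exec, hval, setReg]
  congr 2
  rw [Function.update_of_ne (by omega), Function.update_of_ne (by omega), hone]

/-- Accepting `u` with probability `w u / rem`, and subtracting `w u` from `rem` upon rejection,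
gives every neighbor its weight relative to the initial `rem`. The inequality is multiplied by
`rem`; this makes it additive along the list and meaningful for `rem = 0`. -/
lemma pickProg_loop {v : Fin n} {P Q : ℕ → ℕ → Prog} {f g : Finset (Fin n) → Fin n → ℝ} {c c' : ℕ}
    (hP : Computes A lam P f c) (hQ : Computes A lam Q g c') {Φ : Config → ℝ} {ρ : ℝ}
    (hΦ : Super Φ ρ) {b : ℕ} (hb : 8 < b) {S0 : State} (hS0 : Base A lam S0) {H : Finset (Fin n)}
    (hH : Dead S0 H) (k : List Prog) (F : Fin n → ℝ) (F0 : ℝ) (hFp : ∀ u, 0 ≤ F u) (hF0p : 0 ≤ F0)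
    (hF : ∀ u ∈ A.nbrs v, u ∈ H → ∀ S', PickFrame b S0 S' → S'.reg 8 = u + 1 → Φ (k, S') ≤ F u)
    (hF0 : ∀ S', PickFrame b S0 S' → S'.reg 8 = 0 → Φ (k, S') ≤ F0)
    (w : Fin n → ℝ) (hw : ∀ u ∈ H, w u = lam * (f (H.erase u) u - g (H.erase u) u))
    (hw0 : ∀ u, 0 ≤ w u) (hwH : ∀ u ∉ H, w u = 0)
    (l : List (Fin n)) (S : State) (j : ℕ)
    (hS : PickFrame b S0 S) (h8 : S.reg 8 = 0) (hj : (A.nbrs v).drop j = l)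
    (hjl : j + l.length = (A.nbrs v).length)
    (h1 : S.reg b = offset A v + j) (h2 : S.reg (b + 1) = offset A v + (A.nbrs v).length)
    (hrem : (l.map w).sum ≤ S.rreg 3) :
    S.rreg 3 * Φ (.loop (.lt b (b + 1)) (.seq (block [.load (b + 2) 1 b, .add b b 2]) (pickBody P Q b)) :: k, S) ≤
      S.rreg 3 * (ρ * ((c + c' + 40) * l.length + 1)) + (l.map fun u => w u * F u).sum +
        (S.rreg 3 - (l.map w).sum) * F0 := by
  induction l generalizing S j with
  | nil =>
    have h3 := Runs.loop_done (i := b) (j := b + 1)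
      (p := (.seq (block [.load (b + 2) 1 b, .add b b 2]) (pickBody P Q b))) (S := S) (by simp at hjl; omega) Φ ρ hΦ k
    have h4 := hF0 S hS h8
    simp only [List.map_nil, List.sum_nil, List.length_nil] at hrem ⊢
    have := mul_le_mul_of_nonneg_left (h3.trans (add_le_add_right h4 _)) hrem
    simp at this ⊢
    linarith
  | cons u l ih =>
    set body : Prog := .seq (block [.load (b + 2) 1 b, .add b b 2]) (pickBody P Q b) with hbody
    set k' := Prog.loop (.lt b (b + 1)) body :: k with hk'
    have hlt : S.reg b < S.reg (b + 1) := by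
      simp only [List.length_cons] at hjl
      omega
    have hjlt : j < (A.nbrs v).length := by
      simp only [List.length_cons] at hjl
      omega
    have hu : (A.nbrs v)[j] = u ∧ (A.nbrs v).drop (j + 1) = l := by
      rw [List.drop_eq_getElem_cons hjlt] at hj
      exact List.cons.inj hj
    have hjl' : j + 1 + l.length = (A.nbrs v).length := by
      simp only [List.length_cons] at hjl
      omega
    have humem : u ∈ A.nbrs v := hu.1 ▸ List.getElem_mem hjlt
    simp only [List.map_cons, List.sum_cons, List.length_cons] at hrem ⊢
    have hl0 : 0 ≤ (l.map w).sum := List.sum_nonneg (by simpa using fun a _ => hw0 a)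
    have hlF0 : 0 ≤ (l.map fun u => w u * F u).sum :=
      List.sum_nonneg (by simpa using fun a _ => mul_nonneg (hw0 a) (hFp a))
    have hrem0 : 0 ≤ S.rreg 3 := le_trans (add_nonneg (hw0 u) hl0) hrem
    -- For `rem = 0` the left side vanishes, and only nonnegativity of the right side is needed;
    -- otherwise the quotients are genuine probabilities.
    rcases hrem0.eq_or_lt with hz | hpos
    · rw [← hz, zero_mul, zero_mul, zero_add]
      refine add_nonneg (add_nonneg (mul_nonneg (hw0 u) (hFp u)) hlF0) (mul_nonneg ?_ hF0p)
      linarith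
    have hSb := hS.base (by omega) hS0
    set S1 := setReg (setReg S (b + 2) (u : ℕ)) b (S.reg b + 1) with hS1
    set S2 := setReg S1 (b + 3) (if u ∈ H then 0 else 1) with hS2
    have hS12 : ([.load (b + 3) 2 (b + 2)] : List Op).foldl Op.exec S1 = S2 := by
      have : S1.arr 2 (S1.reg (b + 2)) = if u ∈ H then 0 else 1 := by
        simp only [hS1, setReg]
        rw [Function.update_of_ne (by omega), Function.update_self, hS.arr]
        exact hH u
      simp only [List.foldl, Op.exec, hS2, setReg, this]
    have hf2 : Frame b S S2 := by
      refine ⟨fun i hi => ?_, fun _ _ => rfl, rfl, rfl⟩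
      simp only [hS2, hS1, setReg]
      rw [Function.update_of_ne (by omega), Function.update_of_ne (by omega),
        Function.update_of_ne (by omega)]
    have hp2 := hS.trans_frame hf2 le_rfl (by omega)
    have hb2 := hf2.base (by omega) hSb
    have hstart : Φ (.loop (.lt b (b + 1)) body :: k, S) ≤
        ρ * 13 + Φ (.ite (.eq (b + 3) 1) (pickInner P Q b) .nop :: k', S2) := by
      have e1 := hΦ.loop_lt b (b + 1) body k S
      rw [if_pos hlt] at e1
      have e2 : Φ (body :: k', S) ≤ _ :=
        hΦ.seq (block [.load (b + 2) 1 b, .add b b 2]) (pickBody P Q b) k' S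
      have e3 := Runs.block [.load (b + 2) 1 b, .add b b 2] S Φ ρ hΦ (pickBody P Q b :: k')
      rw [forNbrs_fold (by omega) hSb.graph hSb.one hjlt h1, hu.1, ← hS1] at e3
      have e4 : Φ (pickBody P Q b :: k', S1) ≤ _ :=
        hΦ.ite_eq 8 1 (guarded b (pickInner P Q b)) .nop k' S1
      have h81 : S1.reg 8 = S1.reg 1 := by
        simp only [hS1, setReg]
        rw [Function.update_of_ne (by omega), Function.update_of_ne (by omega),
          Function.update_of_ne (by omega), Function.update_of_ne (by omega), h8, hSb.zero]
      rw [if_pos h81] at e4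
      have e5 : Φ (guarded b (pickInner P Q b) :: k', S1) ≤ _ :=
        hΦ.seq (block [.load (b + 3) 2 (b + 2)])
          (.ite (.eq (b + 3) 1) (pickInner P Q b) .nop) k' S1
      have e6 := Runs.block [.load (b + 3) 2 (b + 2)] S1 Φ ρ hΦ
        (.ite (.eq (b + 3) 1) (pickInner P Q b) .nop :: k')
      rw [hS12] at e6
      simp only [List.length_cons, List.length_nil] at e3 e6
      push_cast at e3 e6
      have := hΦ.cost
      linarith
    have hite := hΦ.ite_eq (b + 3) 1 (pickInner P Q b) .nop k' S2
    have hr3 : S2.reg (b + 3) = if u ∈ H then 0 else 1 := Function.update_self _ _ _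
    have hrb : S2.reg b = offset A v + (j + 1) := by
      simp only [hS2, hS1, setReg]
      rw [Function.update_of_ne (by omega), Function.update_self, h1]
      ring
    have hrb1 : S2.reg (b + 1) = offset A v + (A.nbrs v).length := by
      simp only [hS2, hS1, setReg]
      rw [Function.update_of_ne (by omega), Function.update_of_ne (by omega),
        Function.update_of_ne (by omega), h2]
    have hrb2 : S2.reg (b + 2) = (u : ℕ) := by
      simp only [hS2, hS1, setReg]
      rw [Function.update_of_ne (by omega), Function.update_of_ne (by omega),
        Function.update_self]
    have h82 : S2.reg 8 = 0 := (hf2.reg 8 hb).trans h8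
    have hrr2 : S2.rreg = S.rreg := rfl
    have hrho := hΦ.cost
    by_cases huH : u ∈ H
    · rw [hr3, if_pos huH, hb2.zero, if_pos rfl] at hite
      have hd2 : Dead S2 H := by
        intro x
        rw [hp2.arr]
        exact hH x
      obtain ⟨S3, r3, f3, e3⟩ := weightProg_runs hP hQ (b := b) (by omega) hb2 hd2 huH hrb2
      rw [← hw u huH] at e3
      have hq3 : Φ (pickInner P Q b :: k', S2) ≤ _ := hΦ.seq (weightProg P Q b)
          (.seq (block [.rdiv (b + 5) (b + 4) 3]) (.ite (.coin (b + 5)) (block [.add 8 (b + 2) 2])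
          (block [.rsub 3 3 (b + 4)]))) k' S2
      have hq4 := r3 Φ ρ hΦ (.seq (block [.rdiv (b + 5) (b + 4) 3])
        (.ite (.coin (b + 5)) (block [.add 8 (b + 2) 2]) (block [.rsub 3 3 (b + 4)])) :: k')
      have hq5 := hΦ.seq (block [.rdiv (b + 5) (b + 4) 3])
        (.ite (.coin (b + 5)) (block [.add 8 (b + 2) 2]) (block [.rsub 3 3 (b + 4)])) k' S3
      have hq6 := Runs.block [.rdiv (b + 5) (b + 4) 3] S3 Φ ρ hΦ
        (.ite (.coin (b + 5)) (block [.add 8 (b + 2) 2]) (block [.rsub 3 3 (b + 4)]) :: k')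
      set S4 := ([.rdiv (b + 5) (b + 4) 3] : List Op).foldl Op.exec S3 with hS4
      have f4 : Frame (b + 4) S3 S4 := by
        refine ⟨fun i hi => rfl, fun i hi => ?_, rfl, rfl⟩
        simp only [hS4, List.foldl, Op.exec]
        rw [Function.update_of_ne (by omega)]
      have f24 := f3.trans f4 le_rfl
      have hp4 := hp2.trans_frame f24 (by omega) (by omega)
      have hr4 : S4.rreg 3 = S.rreg 3 := f24.rreg 3 (by omega)
      have hc4 : S4.rreg (b + 5) = w u / S.rreg 3 := by
        simp only [hS4, List.foldl, Op.exec, Function.update_self, e3]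
        rw [f3.rreg 3 (by omega), hrr2]
      have hw4 : S4.rreg (b + 4) = w u := by
        simp only [hS4, List.foldl, Op.exec]
        rw [Function.update_of_ne (by omega), e3]
      have hq7 := hΦ.coin (b + 5) (block [.add 8 (b + 2) 2]) (block [.rsub 3 3 (b + 4)]) k' S4
        (by rw [hc4]; exact div_nonneg (hw0 u) hrem0)
        (by rw [hc4, div_le_one hpos]; linarith)
      have hsel := Runs.block [.add 8 (b + 2) 2] S4 Φ ρ hΦ k'
      set S5 := ([.add 8 (b + 2) 2] : List Op).foldl Op.exec S4 with hS5
      have hb4 := hp4.base (by omega) hS0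
      have hp5 : PickFrame b S0 S5 := by
        refine ⟨fun i hi hi' => ?_, hp4.rreg, hp4.arr, hp4.out⟩
        simp only [hS5, List.foldl, Op.exec]
        rw [Function.update_of_ne hi', hp4.reg i hi hi']
      have hreg5 : ∀ i, i ≠ 8 → S5.reg i = S4.reg i := fun i hi => by
        simp only [hS5, List.foldl, Op.exec]
        rw [Function.update_of_ne hi]
      obtain ⟨S6, r6, f6, e6⟩ := pickProg_selected (A := A) (v := v) (P := P) (Q := Q) hb hS0 u l S5
        (j + 1) hp5 (by
          simp only [hS5, List.foldl, Op.exec, Function.update_self]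
          rw [f24.reg _ (by omega), hrb2, hb4.one]) hu.2 hjl'
        (by rw [hreg5 _ (by omega), f24.reg _ (by omega), hrb])
        (by rw [hreg5 _ (by omega), f24.reg _ (by omega), hrb1])
      have hsel6 := r6 Φ ρ hΦ k
      have hsel7 := hF u humem huH S6 f6 e6
      have hun := Runs.block [.rsub 3 3 (b + 4)] S4 Φ ρ hΦ k'
      set S7 := ([.rsub 3 3 (b + 4)] : List Op).foldl Op.exec S4 with hS7
      have hr7 : S7.rreg 3 = S.rreg 3 - w u := by
        simp only [hS7, List.foldl, Op.exec, Function.update_self]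
        rw [hr4, hw4]
      have hp7 : PickFrame b S0 S7 := by
        refine ⟨hp4.reg, ?_, hp4.arr, hp4.out⟩
        simp only [hS7, List.foldl, Op.exec]
        rw [Function.update_of_ne (by omega), hp4.rreg]
      have hih := ih S7 (j + 1) hp7 ((f24.reg 8 (by omega)).trans h82) hu.2 hjl'
        ((f24.reg _ (by omega)).trans hrb) ((f24.reg _ (by omega)).trans hrb1) (by rw [hr7]; linarith)
      rw [hr7] at hih
      rw [hc4] at hq7
      simp only [List.length_cons, List.length_nil] at hsel hun hq6
      push_cast at hsel hun hq6 hq4 hsel6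
      have hA : Φ (block [.add 8 (b + 2) 2] :: k', S4) ≤
          ρ * ((c + c' + 40) * l.length + 4) + F u := by
        have h9 : ρ * (9 * l.length) ≤ ρ * ((c + c' + 40) * l.length) := by
          gcongr
          have : (0 : ℝ) ≤ c := Nat.cast_nonneg c
          have : (0 : ℝ) ≤ c' := Nat.cast_nonneg c'
          linarith
        linarith
      have hB : (S.rreg 3 - w u) * Φ (block [.rsub 3 3 (b + 4)] :: k', S4) ≤
          (S.rreg 3 - w u) * (ρ * ((c + c' + 40) * l.length + 4)) + (l.map fun u => w u * F u).sum +
            (S.rreg 3 - w u - (l.map w).sum) * F0 := by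
        have := mul_le_mul_of_nonneg_left hun (by linarith : 0 ≤ S.rreg 3 - w u)
        linarith
      have hC : S.rreg 3 * Φ (.loop (.lt b (b + 1)) body :: k, S) ≤
          S.rreg 3 * (ρ * (c + c' + 35)) + (w u * Φ (block [.add 8 (b + 2) 2] :: k', S4) +
            (S.rreg 3 - w u) * Φ (block [.rsub 3 3 (b + 4)] :: k', S4)) := by
        have h10 : Φ (.loop (.lt b (b + 1)) body :: k, S) ≤ ρ * (c + c' + 35) +
            (w u / S.rreg 3 * Φ (block [.add 8 (b + 2) 2] :: k', S4) +
            (1 - w u / S.rreg 3) * Φ (block [.rsub 3 3 (b + 4)] :: k', S4)) := by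
          linarith
        have h11 := mul_le_mul_of_nonneg_left h10 hrem0
        refine h11.trans (le_of_eq ?_)
        field_simp
      have hD := mul_le_mul_of_nonneg_left hA (hw0 u)
      push_cast
      have hE : S.rreg 3 * (ρ * (c + c' + 35)) + S.rreg 3 * (ρ * ((c + c' + 40) * l.length + 4)) ≤
          S.rreg 3 * (ρ * ((c + c' + 40) * (l.length + 1) + 1)) := by
        rw [← mul_add, ← mul_add]
        refine mul_le_mul_of_nonneg_left (mul_le_mul_of_nonneg_left ?_ hrho) hrem0
        linarith
      linarith
    · rw [hr3, if_neg huH, hb2.zero, if_neg (by omega)] at hite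
      have hnop := hΦ.nop k' S2
      have hih := ih S2 (j + 1) hp2 h82 hu.2 hjl' hrb hrb1
        (by rw [hrr2]; linarith [hw0 u])
      rw [hrr2] at hih
      rw [hwH u huH]
      have h10 : Φ (.loop (.lt b (b + 1)) body :: k, S) ≤ ρ * 16 + Φ (k', S2) := by linarith
      have h11 := mul_le_mul_of_nonneg_left h10 hrem0
      push_cast
      have hE : S.rreg 3 * (ρ * 16) + S.rreg 3 * (ρ * ((c + c' + 40) * l.length + 1)) ≤
          S.rreg 3 * (ρ * ((c + c' + 40) * (l.length + 1) + 1)) := by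
        rw [← mul_add, ← mul_add]
        have : (0 : ℝ) ≤ (c + c' + 40) * l.length := by positivity
        have : (0 : ℝ) ≤ c := Nat.cast_nonneg c
        have : (0 : ℝ) ≤ c' := Nat.cast_nonneg c'
        refine mul_le_mul_of_nonneg_left (mul_le_mul_of_nonneg_left ?_ hrho) hrem0
        linarith
      linarith

lemma pickProg_bound [DecidableRel G.Adj] {v : Fin n} {P Q : ℕ → ℕ → Prog}
    {f g : Finset (Fin n) → Fin n → ℝ} {c c' Δ : ℕ} (hΔ : ∀ v, (A.nbrs v).length ≤ Δ)
    (hP : Computes A lam P f c) (hQ : Computes A lam Q g c') {Φ : Config → ℝ} {ρ : ℝ}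
    (hΦ : Super Φ ρ) {vr b : ℕ} (hvr : vr < b) (hb : 8 < b) {S : State} (hS : Base A lam S)
    {H : Finset (Fin n)} (hH : Dead S H) (hv : S.reg vr = (v : ℕ)) (h8 : S.reg 8 = 0)
    (k : List Prog) (F : Fin n → ℝ) (F0 : ℝ) (hFp : ∀ u, 0 ≤ F u) (hF0p : 0 ≤ F0)
    (hF : ∀ u ∈ H.filter (G.Adj v), ∀ S', PickFrame b S S' → S'.reg 8 = u + 1 → Φ (k, S') ≤ F u)
    (hF0 : ∀ S', PickFrame b S S' → S'.reg 8 = 0 → Φ (k, S') ≤ F0)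
    (hw0 : ∀ u, 0 ≤ lam * (f (H.erase u) u - g (H.erase u) u))
    (hrem : ∑ u ∈ H.filter (G.Adj v), lam * (f (H.erase u) u - g (H.erase u) u) ≤ S.rreg 3) :
    S.rreg 3 * Φ (pickProg P Q vr b :: k, S) ≤
      S.rreg 3 * (ρ * (((c + c' + 40) * Δ + 10 : ℕ) : ℝ)) +
      ∑ u ∈ H.filter (G.Adj v), lam * (f (H.erase u) u - g (H.erase u) u) * F u +
        (S.rreg 3 - ∑ u ∈ H.filter (G.Adj v), lam * (f (H.erase u) u - g (H.erase u) u)) * F0 := by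
  set w : Fin n → ℝ := fun u => if u ∈ H then lam * (f (H.erase u) u - g (H.erase u) u) else 0
    with hw
  have hsum : ((A.nbrs v).map w).sum =
      ∑ u ∈ H.filter (G.Adj v), lam * (f (H.erase u) u - g (H.erase u) u) := sum_nbrs H v _
  have hsumF : ((A.nbrs v).map fun u => w u * F u).sum =
      ∑ u ∈ H.filter (G.Adj v), lam * (f (H.erase u) u - g (H.erase u) u) * F u := by
    rw [← sum_nbrs (A := A)]
    congr 1
    refine List.map_congr_left fun u _ => ?_
    simp only [hw]
    split_ifs <;> simp
  have hst := forNbrs_start (A := A) hvr hS.graph hS.one hv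
  set S1 := setReg (setReg S (b + 1) (offset A v + (A.nbrs v).length)) b (offset A v) with hS1
  have hp : PickFrame b S S1 := by
    refine ⟨fun i hi _ => ?_, rfl, rfl, rfl⟩
    simp only [hS1, setReg]
    rw [Function.update_of_ne (by omega), Function.update_of_ne (by omega)]
  have h3 := pickProg_loop hP hQ hΦ hb hS hH k F F0 hFp hF0p
    (fun u hu huH => hF u (Finset.mem_filter.2 ⟨huH, (A.mem_iff v u).1 hu⟩)) hF0 w
    (fun u hu => by simp [hw, hu]) (fun u => by simp only [hw]; split_ifs; exacts [hw0 u, le_rfl])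
    (fun u hu => by simp [hw, hu]) (A.nbrs v) S1 0 hp
    (by
      simp only [hS1, setReg]
      rw [Function.update_of_ne (by omega), Function.update_of_ne (by omega), h8])
    (by simp) (by simp) (by simp [hS1]) (by simp [hS1]) (by rw [hsum]; exact hrem)
  rw [hsum, hsumF] at h3
  have hr : S1.rreg 3 = S.rreg 3 := rfl
  rw [hr] at h3
  have hrem0 : 0 ≤ S.rreg 3 := le_trans (Finset.sum_nonneg fun u _ => hw0 u) hrem
  have h1 := hΦ.seq (block [.add (b + 1) vr 2, .load (b + 1) 0 (b + 1), .load b 0 vr])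
    (.loop (.lt b (b + 1)) (.seq (block [.load (b + 2) 1 b, .add b b 2]) (pickBody P Q b))) k S
  have h2 := Runs.block [.add (b + 1) vr 2, .load (b + 1) 0 (b + 1), .load b 0 vr] S Φ ρ hΦ
    (.loop (.lt b (b + 1)) (.seq (block [.load (b + 2) 1 b, .add b b 2]) (pickBody P Q b)) :: k)
  rw [hst] at h2
  simp only [List.length_cons, List.length_nil] at h2
  push_cast at h2 ⊢
  have h4 : ((A.nbrs v).length : ℝ) ≤ Δ := Nat.cast_le.2 (hΔ v)
  have h5 := mul_le_mul_of_nonneg_left (h1.trans (add_le_add_right h2 _)) hrem0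
  have hrho := hΦ.cost
  have h6 : S.rreg 3 * (ρ * ((c + c' + 40) * (A.nbrs v).length + 1)) ≤
      S.rreg 3 * (ρ * ((c + c' + 40) * Δ + 1)) := by gcongr
  have : (0 : ℝ) ≤ S.rreg 3 * ρ := by positivity
  simp only [pickProg, forNbrs]
  linarith

/-! ### Visiting a ball -/

/-- Runs `leaf` with register `7` ranging over the walks of length at most `k` from the vertex in
register `vr`. -/
def visit (leaf : Prog) : ℕ → ℕ → ℕ → Prog
  | 0, vr, _ => .seq (block [.add 7 vr 1]) leaf
  | k + 1, vr, b => .seq (.seq (block [.add 7 vr 1]) leaf)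
      (forNbrs vr b (visit leaf k (b + 2) (b + 3)))

/-- The end vertices of the walks of length at most `k` from `v`. -/
def ballList (A : AdjLists G) : ℕ → Fin n → List (Fin n)
  | 0, v => [v]
  | k + 1, v => v :: (A.nbrs v).flatMap (ballList A k)

/-- Walks may revisit vertices, but their ends fill exactly the ball. The multiplicities do no harm
because `ballBound` limits the length of the list. -/
lemma mem_ballList {k : ℕ} {v x : Fin n} : x ∈ ballList A k v ↔ G.edist v x ≤ k := by
  induction k generalizing v with
  | zero =>
    simp only [ballList, List.mem_singleton, Nat.cast_zero, nonpos_iff_eq_zero,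
      SimpleGraph.edist_eq_zero_iff]
    exact eq_comm
  | succ k ih =>
    simp only [ballList, List.mem_cons, List.mem_flatMap, ih, A.mem_iff]
    constructor
    · rintro (rfl | ⟨u, h1, h2⟩)
      · simp
      · exact edist_le_succ_of_adj h1 h2
    · intro h
      obtain ⟨p, hp⟩ := SimpleGraph.exists_walk_of_edist_ne_top
        (ne_top_of_le_ne_top (ENat.natCast_ne_top _) h)
      cases p with
      | nil => exact Or.inl rfl
      | @cons _ u _ h1 q =>
        refine Or.inr ⟨u, h1, (SimpleGraph.Walk.edist_le q).trans ?_⟩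
        rw [← hp] at h
        have : q.length + 1 ≤ k + 1 := by simpa using Nat.cast_le.1 h
        exact Nat.cast_le.2 (by omega)

/-- A bound on the number of walks of length at most `k`. -/
def ballBound (Δ : ℕ) : ℕ → ℕ
  | 0 => 1
  | k + 1 => 1 + Δ * ballBound Δ k

lemma length_ballList {Δ : ℕ} (hΔ : ∀ v, (A.nbrs v).length ≤ Δ) (k : ℕ) (v : Fin n) :
    (ballList A k v).length ≤ ballBound Δ k := by
  induction k generalizing v with
  | zero => simp [ballList, ballBound]
  | succ k ih =>
    simp only [ballList, ballBound, List.length_cons, List.length_flatMap]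
    have : ((A.nbrs v).map fun a => (ballList A k a).length).sum ≤
        ((A.nbrs v).map fun a => (ballList A k a).length).length • ballBound Δ k :=
      List.sum_le_card_nsmul _ _ (by simpa using fun a _ => ih a)
    simp only [List.length_map, smul_eq_mul] at this
    have := Nat.mul_le_mul_right (ballBound Δ k) (hΔ v)
    omega

/-- The running time of `visit`. -/
def visitTime (Δ c : ℕ) : ℕ → ℕ
  | 0 => c + 4
  | k + 1 => c + 4 + ((visitTime Δ c k + 7) * Δ + 9) + 1

/-- The invariant consumes `ballList A k v` in the order of the visits, in front of a suffix `l`.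
The suffix is what a nested call leaves to its caller, and the preserved registers below `b` hold
the state of the enclosing loops. -/
lemma visit_runs {Δ : ℕ} (hΔ : ∀ v, (A.nbrs v).length ≤ Δ) {Inv : List (Fin n) → State → Prop}
    {leaf : Prog} {c : ℕ}
    (hbase : ∀ l S, Inv l S → HasGraph A S.arr ∧ S.reg 1 = 0 ∧ S.reg 2 = 1)
    (hreg : ∀ l S i x, Inv l S → (i = 7 ∨ 12 ≤ i) → Inv l (setReg S i x))
    (hleaf : ∀ w l S, Inv (w :: l) S → S.reg 7 = (w : ℕ) →
      ∃ S', Runs leaf S c S' ∧ Inv l S' ∧ ∀ i ≥ 12, S'.reg i = S.reg i)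
    (k vr b : ℕ) (v : Fin n) (l : List (Fin n)) (S : State) (h12 : 12 ≤ vr) (hvr : vr < b)
    (hS : Inv (ballList A k v ++ l) S) (hv : S.reg vr = (v : ℕ)) :
    ∃ S', Runs (visit leaf k vr b) S (visitTime Δ c k) S' ∧ Inv l S' ∧
      ∀ i, 12 ≤ i → i < b → S'.reg i = S.reg i := by
  have hfirst : ∀ (l : List (Fin n)) (S : State), Inv (v :: l) S → S.reg vr = (v : ℕ) →
      ∃ S', Runs (.seq (block [.add 7 vr 1]) leaf) S (c + 4) S' ∧ Inv l S' ∧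
        ∀ i ≥ 12, S'.reg i = S.reg i := by
    intro l S hS hv
    have e : ([.add 7 vr 1] : List Op).foldl Op.exec S = setReg S 7 v := by
      simp [Op.exec, setReg, hv, (hbase _ _ hS).2.1]
    have r := Runs.block [.add 7 vr 1] S
    rw [e] at r
    obtain ⟨S', r', h1, h2⟩ := hleaf v l (setReg S 7 v) (hreg _ _ _ _ hS (Or.inl rfl)) (by simp)
    refine ⟨S', (r.seq r').mono (by simp; omega), h1, fun i hi => (h2 i hi).trans ?_⟩
    exact Function.update_of_ne (by omega) _ _
  induction k generalizing vr b v l S with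
  | zero =>
    obtain ⟨S', r, h1, h2⟩ := hfirst l S hS hv
    exact ⟨S', r, h1, fun i hi _ => h2 i hi⟩
  | succ k ih =>
    obtain ⟨S1, r1, hI1, e1⟩ := hfirst ((A.nbrs v).flatMap (ballList A k) ++ l) S hS hv
    obtain ⟨S2, r2, hI2, e2⟩ := forNbrs_runs (A := A) (v := v) (c := visitTime Δ c k)
      (Inv := fun l' S' => Inv (l'.flatMap (ballList A k) ++ l) S' ∧
        ∀ i, 12 ≤ i → i < b → S'.reg i = S1.reg i) (body := visit leaf k (b + 2) (b + 3))
      (by omega) hvr (fun l' S' h => ⟨(hbase _ _ h.1).1, (hbase _ _ h.1).2.2⟩)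
      (by
        rintro l' S' i x ⟨h1, h2⟩ hi hi'
        refine ⟨hreg _ _ _ _ h1 (Or.inr (by omega)), fun j hj hj' => ?_⟩
        exact (Function.update_of_ne (by omega) _ _).trans (h2 j hj hj'))
      (by
        rintro u l' S' - ⟨h1, h2⟩ hu
        rw [List.flatMap_cons, List.append_assoc] at h1
        obtain ⟨S3, r3, hI3, e3⟩ := ih (b + 2) (b + 3) u _ S' (by omega) (by omega) h1 hu
          (fun l S hS hv => by
            have e : ([.add 7 (b + 2) 1] : List Op).foldl Op.exec S = setReg S 7 u := by
              simp [Op.exec, setReg, hv, (hbase _ _ hS).2.1]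
            have r := Runs.block [.add 7 (b + 2) 1] S
            rw [e] at r
            obtain ⟨S', r', h1, h2⟩ := hleaf u l (setReg S 7 u) (hreg _ _ _ _ hS (Or.inl rfl))
              (by simp)
            refine ⟨S', (r.seq r').mono (by simp; omega), h1, fun i hi => (h2 i hi).trans ?_⟩
            exact Function.update_of_ne (by omega) _ _)
        exact ⟨S3, r3, ⟨hI3, fun i hi hi' => (e3 i hi (by omega)).trans (h2 i hi hi')⟩,
          e3 b (by omega) (by omega), e3 _ (by omega) (by omega)⟩)
      ⟨hI1, fun _ _ _ => rfl⟩ ((e1 vr h12).trans hv) (hΔ v)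
    exact ⟨S2, r1.seq r2, hI2, fun i hi hi' => (e2 i hi hi').trans (e1 i hi)⟩

end MatchingSampler
end

/-! ### Memory layout of trails and tasks, and the programs that update them. -/

noncomputable section
namespace MatchingSampler

open RAM

variable {n : ℕ} {G : SimpleGraph (Fin n)} {A : AdjLists G} {lam : ℝ}

/-! ### The representation of trails and tasks in memory -/

/-- A stack of pairs in a pair of arrays, with its top at the highest index. -/
def Stk (f g : ℕ → ℕ) : List (ℕ × ℕ) → Prop
  | [] => True
  | e :: l => f l.length = e.1 ∧ g l.length = e.2 ∧ Stk f g l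

lemma Stk.congr {f g f' g' : ℕ → ℕ} {l : List (ℕ × ℕ)} (h : Stk f g l)
    (hf : ∀ i < l.length, f' i = f i) (hg : ∀ i < l.length, g' i = g i) : Stk f' g' l := by
  induction l with
  | nil => trivial
  | cons e l ih =>
    refine ⟨(hf _ (by simp)).trans h.1, (hg _ (by simp)).trans h.2.1, ih h.2.2 ?_ ?_⟩
    · exact fun i hi => hf i (hi.trans (by simp))
    · exact fun i hi => hg i (hi.trans (by simp))

lemma Stk.push {f g : ℕ → ℕ} {l : List (ℕ × ℕ)} (h : Stk f g l) {k : ℕ} (hk : k = l.length)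
    (a b : ℕ) : Stk (Function.update f k a) (Function.update g k b) ((a, b) :: l) := by
  subst hk
  refine ⟨by simp, by simp, h.congr ?_ ?_⟩ <;>
  · intro i hi
    exact Function.update_of_ne hi.ne _ _

/-- The code of a partner. -/
def encMate : Option (Fin n) → ℕ
  | none => 0
  | some u => u + 1

/-- The code of a trail entry. -/
def encEntry (e : Fin n × Option (Fin n)) : ℕ × ℕ := (e.1, encMate e.2)

/-- The code of a task. -/
def encTask : Task (Fin n) → ℕ × ℕ
  | .dec v => (v, 0)
  | .fin v h => (v, h + 1)

variable (A lam) in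
/-- The memory holds the trail `t` and the tasks `r`, with living vertices `H` and marked vertices
`W`. -/
structure Mem (t : Trail (Fin n)) (r : List (Task (Fin n))) (H W : Finset (Fin n)) (S : State) :
    Prop where
  base : Base A lam S
  sp : S.reg 3 = r.length
  th : S.reg 4 = t.length
  tasks : Stk (S.arr 6) (S.arr 7) (r.map encTask)
  trail : Stk (S.arr 4) (S.arr 5) (t.map encEntry)
  dead : Dead S H
  mark : ∀ x : Fin n, S.arr 3 x = if x ∈ W then 1 else 0
  out : S.out = []

lemma Base.of_eq {S S' : State} (h : Base A lam S) (h0 : S'.arr 0 = S.arr 0)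
    (h1 : S'.arr 1 = S.arr 1) (r1 : S'.reg 1 = S.reg 1) (r2 : S'.reg 2 = S.reg 2)
    (hl : S'.rreg 0 = S.rreg 0) : Base A lam S' :=
  ⟨⟨h0.trans h.graph.1, h1.trans h.graph.2⟩, r1.trans h.zero, r2.trans h.one, hl.trans h.lam⟩

variable {t : Trail (Fin n)} {r : List (Task (Fin n))} {H W : Finset (Fin n)} {S S' : State}

lemma Mem.of_eq (h : Mem A lam t r H W S) (hreg : ∀ i, 1 ≤ i → i ≤ 4 → S'.reg i = S.reg i)
    (hl : S'.rreg 0 = S.rreg 0) (harr : S'.arr = S.arr) (hout : S'.out = S.out) :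
    Mem A lam t r H W S' :=
  ⟨h.base.of_eq (by rw [harr]) (by rw [harr]) (hreg 1 le_rfl (by omega)) (hreg 2 (by omega) (by omega)) hl,
    (hreg 3 (by omega) (by omega)).trans h.sp, (hreg 4 (by omega) le_rfl).trans h.th,
    by rw [harr]; exact h.tasks, by rw [harr]; exact h.trail, fun x => by rw [harr]; exact h.dead x,
    fun x => by rw [harr]; exact h.mark x, hout.trans h.out⟩

lemma Mem.of_frame (h : Mem A lam t r H W S) {b : ℕ} (hb : 4 < b) (hf : Frame b S S') :
    Mem A lam t r H W S' :=
  h.of_eq (fun i _ hi => hf.reg i (by omega)) (hf.rreg 0 (by omega)) hf.arr hf.out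

lemma Mem.of_pickFrame (h : Mem A lam t r H W S) {b : ℕ} (hb : 4 < b) (hf : PickFrame b S S') :
    Mem A lam t r H W S' :=
  h.of_eq (fun i _ hi => hf.reg i (by omega) (by omega)) hf.rreg hf.arr hf.out

lemma Mem.of_setReg (h : Mem A lam t r H W S) {i : ℕ} (hi : 4 < i) (x : ℕ) :
    Mem A lam t r H W (setReg S i x) :=
  h.of_eq (fun j _ hj => Function.update_of_ne (by omega) _ _) rfl rfl rfl

/-- The living vertices after an entry has been added to the trail. -/
def kill (H : Finset (Fin n)) : Fin n × Option (Fin n) → Finset (Fin n)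
  | (v, none) => H.erase v
  | (v, some u) => (H.erase v).erase u

lemma alive_cons (e : Fin n × Option (Fin n)) (t : Trail (Fin n)) :
    alive (e :: t) = kill (alive t) e := by
  obtain ⟨v, _ | u⟩ := e <;> rfl

/-- A vertex is killed once before the weights of its neighbors are computed, and possibly again
when it enters the trail. -/
lemma kill_erase (H : Finset (Fin n)) (v : Fin n) (o : Option (Fin n)) :
    kill (H.erase v) (v, o) = kill H (v, o) := by
  cases o <;> simp [kill]

lemma Dead.kill {H : Finset (Fin n)} {f : ℕ → ℕ} (h : ∀ x : Fin n, f x = if x ∈ H then 0 else 1)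
    (v x : Fin n) : Function.update f v 1 x = if x ∈ H.erase v then 0 else 1 := by
  simp only [Function.update_apply, Fin.val_inj, Finset.mem_erase, h x]
  by_cases hx : x = v <;> simp [hx]

lemma Dead.revive {H : Finset (Fin n)} {f : ℕ → ℕ} (h : ∀ x : Fin n, f x = if x ∈ H then 0 else 1)
    (v x : Fin n) : Function.update f v 0 x = if x ∈ insert v H then 0 else 1 := by
  simp only [Function.update_apply, Fin.val_inj, Finset.mem_insert, h x]
  by_cases hx : x = v <;> simp [hx]

/-! ### Updating trail and tasks -/

/-- Adds the vertex in register `5` with the partner coded in register `8` to the trail. -/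
def decideProg : Prog :=
  .seq (block [.store 4 4 5, .store 5 4 8, .add 4 4 2, .store 2 5 2])
    (.ite (.eq 8 1) .nop (block [.sub 8 8 2, .store 2 8 2]))

lemma decideProg_runs (h : Mem A lam t r H W S) {v : Fin n} {o : Option (Fin n)}
    (hv : S.reg 5 = (v : ℕ)) (ho : S.reg 8 = encMate o) :
    ∃ S', Runs decideProg S 20 S' ∧ Mem A lam ((v, o) :: t) r (kill H (v, o)) W S' ∧
      S'.reg 5 = (v : ℕ) := by
  have r1 := Runs.block [.store 4 4 5, .store 5 4 8, .add 4 4 2, .store 2 5 2] S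
  set S1 := ([.store 4 4 5, .store 5 4 8, .add 4 4 2, .store 2 5 2] : List Op).foldl Op.exec S
    with hS1
  have hone := h.base.one
  have m1 : Mem A lam ((v, o) :: t) r (H.erase v) W S1 := by
    refine ⟨h.base.of_eq ?_ ?_ ?_ ?_ ?_, ?_, ?_, ?_, ?_, ?_, ?_, ?_⟩
    · simp [hS1, Op.exec]
    · simp [hS1, Op.exec]
    · simp [hS1, Op.exec]
    · simp [hS1, Op.exec]
    · simp [hS1, Op.exec]
    · simpa [hS1, Op.exec] using h.sp
    · simp [hS1, Op.exec, h.th, hone]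
    · simpa [hS1, Op.exec] using h.tasks
    · have := h.trail.push (k := S.reg 4) (by simpa using h.th) v (encMate o)
      simpa [hS1, Op.exec, encEntry, hv, ho] using this
    · intro x
      have := Dead.kill h.dead v x
      simpa [hS1, Op.exec, hv, hone] using this
    · intro x
      simpa [hS1, Op.exec] using h.mark x
    · simpa [hS1, Op.exec] using h.out
  have hv1 : S1.reg 5 = (v : ℕ) := by simp [hS1, Op.exec, hv]
  have ho1 : S1.reg 8 = encMate o := by simp [hS1, Op.exec, ho]
  cases o with
  | none =>
    refine ⟨S1, (r1.seq (Runs.ite_pos (Runs.nop _) ?_)).mono (by simp), m1, hv1⟩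
    rw [ho1, m1.base.zero]
    rfl
  | some u =>
    have r2 := Runs.block [.sub 8 8 2, .store 2 8 2] S1
    set S2 := ([.sub 8 8 2, .store 2 8 2] : List Op).foldl Op.exec S1 with hS2
    refine ⟨S2, (r1.seq (Runs.ite_neg r2 ?_)).mono (by simp), ?_, ?_⟩
    · rw [ho1, m1.base.zero]
      simp [encMate]
    · have hone1 := m1.base.one
      refine ⟨m1.base.of_eq ?_ ?_ ?_ ?_ ?_, ?_, ?_, ?_, ?_, ?_, ?_, ?_⟩
      · simp [hS2, Op.exec]
      · simp [hS2, Op.exec]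
      · simp [hS2, Op.exec]
      · simp [hS2, Op.exec]
      · simp [hS2, Op.exec]
      · simpa [hS2, Op.exec] using m1.sp
      · simpa [hS2, Op.exec] using m1.th
      · simpa [hS2, Op.exec] using m1.tasks
      · simpa [hS2, Op.exec] using m1.trail
      · intro x
        have := Dead.kill m1.dead u x
        simpa [hS2, Op.exec, ho1, hone1, encMate, kill] using this
      · intro x
        simpa [hS2, Op.exec] using m1.mark x
      · simpa [hS2, Op.exec] using m1.out
    · simp [hS2, Op.exec, hv1]

/-- Adds a task to decide the vertex in register `i`. -/
def pushDec (i : ℕ) : Prog := block [.store 6 3 i, .store 7 3 1, .add 3 3 2]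

lemma pushDec_runs (h : Mem A lam t r H W S) {v : Fin n} {i : ℕ} (hv : S.reg i = (v : ℕ)) :
    ∃ S', Runs (pushDec i) S 7 S' ∧ Mem A lam t (.dec v :: r) H W S' ∧
      ∀ j, j ≠ 3 → S'.reg j = S.reg j := by
  refine ⟨_, Runs.block _ S, ?_, ?_⟩
  · have hone := h.base.one
    have hzero := h.base.zero
    refine ⟨h.base.of_eq ?_ ?_ ?_ ?_ ?_, ?_, ?_, ?_, ?_, ?_, ?_, ?_⟩
    · simp [Op.exec]
    · simp [Op.exec]
    · simp [Op.exec]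
    · simp [Op.exec]
    · simp [Op.exec]
    · simp [Op.exec, h.sp, hone]
    · simpa [Op.exec] using h.th
    · have := h.tasks.push (k := S.reg 3) (by simpa using h.sp) v 0
      simpa [Op.exec, encTask, hv, hzero] using this
    · simpa [Op.exec] using h.trail
    · intro x
      simpa [Op.exec] using h.dead x
    · intro x
      simpa [Op.exec] using h.mark x
    · simpa [Op.exec] using h.out
  · intro j hj
    simp [Op.exec, hj]

/-- Adds a task to finish the vertex in register `5` at the current height of the trail. -/
def pushFin : Prog := block [.add 6 4 2, .store 6 3 5, .store 7 3 6, .add 3 3 2]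

lemma pushFin_runs (h : Mem A lam t r H W S) {v : Fin n} (hv : S.reg 5 = (v : ℕ)) :
    ∃ S', Runs pushFin S 9 S' ∧ Mem A lam t (.fin v t.length :: r) H W S' ∧
      ∀ j, j ≠ 3 → j ≠ 6 → S'.reg j = S.reg j := by
  refine ⟨_, Runs.block _ S, ?_, ?_⟩
  · have hone := h.base.one
    refine ⟨h.base.of_eq ?_ ?_ ?_ ?_ ?_, ?_, ?_, ?_, ?_, ?_, ?_, ?_⟩
    · simp [Op.exec]
    · simp [Op.exec]
    · simp [Op.exec]
    · simp [Op.exec]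
    · simp [Op.exec]
    · simp [Op.exec, h.sp, hone]
    · simpa [Op.exec] using h.th
    · have := h.tasks.push (k := S.reg 3) (by simpa using h.sp) v (t.length + 1)
      simpa [Op.exec, encTask, hv, hone, h.th] using this
    · simpa [Op.exec] using h.trail
    · intro x
      simpa [Op.exec] using h.dead x
    · intro x
      simpa [Op.exec] using h.mark x
    · simpa [Op.exec] using h.out
  · intro j hj hj'
    simp [Op.exec, hj, hj']

/-- Removes the top entry of the trail. -/
def popTrail : Prog :=
  .seq (block [.sub 4 4 2, .load 6 4 4, .load 7 5 4, .store 2 6 1])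
    (.ite (.eq 7 1) .nop (block [.sub 7 7 2, .store 2 7 1]))

/-- By validity, the entry had killed vertices that were alive, so reviving them gives back the
former living set and nothing more. -/
lemma popTrail_runs [DecidableRel G.Adj] {e : Fin n × Option (Fin n)} (h : Mem A lam (e :: t) r (alive (e :: t)) W S)
    (ht : Valid G (e :: t)) :
    ∃ S', Runs popTrail S 20 S' ∧ Mem A lam t r (alive t) W S' ∧
      S'.reg 5 = S.reg 5 ∧ S'.reg 8 = S.reg 8 ∧ S'.reg 9 = S.reg 9 := by
  obtain ⟨v, o⟩ := e
  have r1 := Runs.block [.sub 4 4 2, .load 6 4 4, .load 7 5 4, .store 2 6 1] S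
  set S1 := ([.sub 4 4 2, .load 6 4 4, .load 7 5 4, .store 2 6 1] : List Op).foldl Op.exec S
    with hS1
  have hone := h.base.one
  have hzero := h.base.zero
  have hth : S.reg 4 = t.length + 1 := by simpa using h.th
  have htop : S.arr 4 t.length = v ∧ S.arr 5 t.length = encMate o := by
    have := h.trail
    simp only [List.map_cons, Stk, List.length_map, encEntry] at this
    exact ⟨this.1, this.2.1⟩
  have m1 : Mem A lam t r (insert v (alive ((v, o) :: t))) W S1 := by
    refine ⟨h.base.of_eq ?_ ?_ ?_ ?_ ?_, ?_, ?_, ?_, ?_, ?_, ?_, ?_⟩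
    · simp [hS1, Op.exec]
    · simp [hS1, Op.exec]
    · simp [hS1, Op.exec]
    · simp [hS1, Op.exec]
    · simp [hS1, Op.exec]
    · simpa [hS1, Op.exec] using h.sp
    · simp [hS1, Op.exec, hth, hone]
    · simpa [hS1, Op.exec] using h.tasks
    · have := h.trail
      simp only [List.map_cons, Stk] at this
      simpa [hS1, Op.exec] using this.2.2
    · intro x
      have := Dead.revive h.dead v x
      simpa [hS1, Op.exec, hth, hone, hzero, htop.1] using this
    · intro x
      simpa [hS1, Op.exec] using h.mark x
    · simpa [hS1, Op.exec] using h.out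
  have h5 : S1.reg 5 = S.reg 5 ∧ S1.reg 8 = S.reg 8 ∧ S1.reg 9 = S.reg 9 := by
    simp [hS1, Op.exec]
  have ho1 : S1.reg 7 = encMate o := by simp [hS1, Op.exec, hth, hone, htop.2]
  cases o with
  | none =>
    refine ⟨S1, (r1.seq (Runs.ite_pos (Runs.nop _) ?_)).mono (by simp), ?_, h5⟩
    · rw [ho1, m1.base.zero]
      rfl
    · have : insert v (alive ((v, none) :: t)) = alive t := Finset.insert_erase ht.2.1
      rwa [this] at m1
  | some u =>
    have r2 := Runs.block [.sub 7 7 2, .store 2 7 1] S1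
    set S2 := ([.sub 7 7 2, .store 2 7 1] : List Op).foldl Op.exec S1 with hS2
    refine ⟨S2, (r1.seq (Runs.ite_neg r2 ?_)).mono (by simp), ?_, ?_⟩
    · rw [ho1, m1.base.zero]
      simp [encMate]
    · have hone1 := m1.base.one
      have hzero1 := m1.base.zero
      have hset : insert u (insert v (alive ((v, some u) :: t))) = alive t := by
        rw [Finset.insert_comm]
        have hu := (Finset.mem_filter.1 (ht.2.2 u rfl)).1
        simp only [alive]
        rw [Finset.insert_erase hu, Finset.insert_erase ht.2.1]
      refine ⟨m1.base.of_eq ?_ ?_ ?_ ?_ ?_, ?_, ?_, ?_, ?_, ?_, ?_, ?_⟩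
      · simp [hS2, Op.exec]
      · simp [hS2, Op.exec]
      · simp [hS2, Op.exec]
      · simp [hS2, Op.exec]
      · simp [hS2, Op.exec]
      · simpa [hS2, Op.exec] using m1.sp
      · simpa [hS2, Op.exec] using m1.th
      · simpa [hS2, Op.exec] using m1.tasks
      · simpa [hS2, Op.exec] using m1.trail
      · intro x
        have := Dead.revive m1.dead u x
        rw [hset] at this
        simpa [hS2, Op.exec, ho1, hone1, hzero1, encMate] using this
      · intro x
        simpa [hS2, Op.exec] using m1.mark x
      · simpa [hS2, Op.exec] using m1.out
    · simpa [hS2, Op.exec] using h5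

/-- Restores the trail to the height in register `9`. -/
def restoreProg : Prog := .loop (.lt 9 4) popTrail

lemma restoreProg_runs [DecidableRel G.Adj] (τ : Trail (Fin n)) (h : Mem A lam (τ ++ t) r (alive (τ ++ t)) W S)
    (ht : Valid G (τ ++ t)) (h9 : S.reg 9 = t.length) :
    ∃ S', Runs restoreProg S (21 * τ.length + 1) S' ∧ Mem A lam t r (alive t) W S' ∧
      S'.reg 5 = S.reg 5 ∧ S'.reg 8 = S.reg 8 := by
  induction τ generalizing S with
  | nil =>
    refine ⟨S, Runs.loop_done ?_, h, rfl, rfl⟩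
    rw [h9, h.th]
    simp
  | cons e τ ih =>
    obtain ⟨S1, r1, m1, e5, e8, e9⟩ := popTrail_runs h ht
    obtain ⟨S2, r2, m2, f5, f8⟩ := ih m1 ht.1 (e9.trans h9)
    refine ⟨S2, (Runs.loop_step ?_ r1 r2).mono ?_, m2, f5.trans e5, f8.trans e8⟩
    · rw [h9, h.th]
      simp
    · simp only [List.length_cons]
      omega

/-! ### Scheduling the sphere -/

/-- The vertices at distance `k + 1` from `v`, possibly repeated. -/
def sphereList (A : AdjLists G) (k : ℕ) (v : Fin n) : List (Fin n) :=
  ((ballList A (k + 1) v).filter (· ∉ ballList A k v)).reverse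

lemma mem_sphereList {k : ℕ} {v w : Fin n} :
    w ∈ sphereList A k v ↔ G.edist v w = (k + 1 : ℕ) := by
  simp only [sphereList, List.mem_reverse, List.mem_filter, decide_eq_true_eq, mem_ballList, not_le]
  constructor
  · rintro ⟨h1, h2⟩
    refine le_antisymm h1 ?_
    push_cast
    exact Order.add_one_le_of_lt h2
  · intro h
    rw [h]
    exact ⟨le_rfl, Nat.cast_lt.2 (by omega)⟩

lemma length_sphereList {Δ : ℕ} (hΔ : ∀ v, (A.nbrs v).length ≤ Δ) (k : ℕ) (v : Fin n) :
    (sphereList A k v).length ≤ ballBound Δ (k + 1) := by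
  rw [sphereList, List.length_reverse]
  exact (List.length_filter_le _ _).trans (length_ballList hΔ _ _)

/-- Adds a task for the vertex in register `7` unless it is marked. -/
def scheduleLeaf : Prog := .seq (block [.load 8 3 7]) (.ite (.eq 8 1) (pushDec 7) .nop)

/-- Adds tasks for the vertices at distance `k + 1` from the vertex in register `12`. -/
def scheduleProg (k : ℕ) : Prog :=
  .seq (visit (block [.store 3 7 2]) k 12 13) (.seq (visit scheduleLeaf (k + 1) 12 13)
    (visit (block [.store 3 7 1]) k 12 13))

/-- The running time of `scheduleProg`. -/
def scheduleTime (Δ k : ℕ) : ℕ := visitTime Δ 3 k + (visitTime Δ 12 (k + 1) + visitTime Δ 3 k + 1) + 1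

/-- Three passes: mark the ball of radius `k`, push the unmarked ends of walks of length at most `k
+ 1`, and clear the marks. Clearing by a second visit, rather than over the whole array, keeps the
time independent of `n`. -/
lemma scheduleProg_runs {Δ : ℕ} (hΔ : ∀ v, (A.nbrs v).length ≤ Δ) (k : ℕ)
    (h : Mem A lam t r H ∅ S) {v : Fin n} (hv : S.reg 12 = (v : ℕ)) :
    ∃ S', Runs (scheduleProg k) S (scheduleTime Δ k) S' ∧
      Mem A lam t ((sphereList A k v).map .dec ++ r) H ∅ S' := by
  have hstore : ∀ {r' W S} (i : ℕ) (w : Fin n), Mem A lam t r' H W S → S.reg 7 = (w : ℕ) →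
      (i = 2 ∨ i = 1) → ∃ S', Runs (block [.store 3 7 i]) S 3 S' ∧
        Mem A lam t r' H (if i = 2 then insert w W else W.erase w) S' ∧ S'.reg = S.reg := by
    intro r' W S i w h h7 hi
    refine ⟨_, Runs.block _ S, ?_, rfl⟩
    have hone := h.base.one
    have hzero := h.base.zero
    refine ⟨h.base.of_eq ?_ ?_ ?_ ?_ ?_, ?_, ?_, ?_, ?_, ?_, ?_, ?_⟩
    · simp [Op.exec]
    · simp [Op.exec]
    · simp [Op.exec]
    · simp [Op.exec]
    · simp [Op.exec]
    · simpa [Op.exec] using h.sp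
    · simpa [Op.exec] using h.th
    · simpa [Op.exec] using h.tasks
    · simpa [Op.exec] using h.trail
    · intro x
      simpa [Op.exec] using h.dead x
    · intro x
      simp only [List.foldl, Op.exec, Function.update_self, h7, Function.update_apply, Fin.val_inj,
        h.mark x]
      rcases hi with rfl | rfl
      · by_cases hx : x = w <;> simp [hx, hone]
      · by_cases hx : x = w <;> simp [hx, hzero]
    · simpa [Op.exec] using h.out
  have hbase : ∀ {r' W S}, Mem A lam t r' H W S → HasGraph A S.arr ∧ S.reg 1 = 0 ∧ S.reg 2 = 1 :=
    fun h => ⟨h.base.graph, h.base.zero, h.base.one⟩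
  set B := ballList A k v with hB
  obtain ⟨S1, r1, ⟨W1, m1, hW1⟩, e1⟩ := visit_runs (A := A) hΔ
    (Inv := fun l S => ∃ W, Mem A lam t r H W S ∧ W ∪ l.toFinset = B.toFinset)
    (leaf := block [.store 3 7 2]) (c := 3) (fun l S ⟨W, h, _⟩ => hbase h)
    (fun l S i x ⟨W, h, h'⟩ hi => ⟨W, h.of_setReg (by omega) x, h'⟩)
    (by
      rintro w l S ⟨W, h, h'⟩ h7
      obtain ⟨S', r', m', e'⟩ := hstore 2 w h h7 (Or.inl rfl)
      rw [if_pos rfl] at m'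
      refine ⟨S', r', ⟨_, m', ?_⟩, fun i _ => by rw [e']⟩
      rw [← h', List.toFinset_cons, Finset.insert_union, Finset.union_insert])
    k 12 13 v [] S le_rfl (by omega) ⟨∅, h, by simp [hB]⟩ hv
  rw [List.toFinset_nil, Finset.union_empty] at hW1
  subst hW1
  -- Pushing onto the stack reverses the order of the visits, hence the reversal in `sphereList`.
  obtain ⟨S2, r2, ⟨p, m2, hp⟩, e2⟩ := visit_runs (A := A) hΔ
    (Inv := fun l S => ∃ p : List (Fin n), Mem A lam t (p.map .dec ++ r) H B.toFinset S ∧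
      (l.filter (· ∉ B)).reverse ++ p = sphereList A k v)
    (leaf := scheduleLeaf) (c := 12) (fun l S ⟨W, h, _⟩ => hbase h)
    (fun l S i x ⟨W, h, h'⟩ hi => ⟨W, h.of_setReg (by omega) x, h'⟩)
    (by
      rintro w l S ⟨p, h, h'⟩ h7
      have r1 := Runs.block [.load 8 3 7] S
      have e : ([.load 8 3 7] : List Op).foldl Op.exec S = setReg S 8 (if w ∈ B then 1 else 0) := by
        have := h.mark w
        simp only [List.mem_toFinset] at this
        simp [Op.exec, setReg, h7, this]
      rw [e] at r1
      have m1 := h.of_setReg (i := 8) (by omega) (if w ∈ B then 1 else 0)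
      set S1 := setReg S 8 (if w ∈ B then 1 else 0) with hS1
      by_cases hw : w ∈ B
      · refine ⟨S1, (r1.seq (Runs.ite_neg (Runs.nop _) ?_)).mono (by simp), ⟨p, m1, ?_⟩, ?_⟩
        · rw [m1.base.zero]
          simp [hS1, setReg, hw]
        · rw [← h', List.filter_cons_of_neg (by simpa using hw)]
        · intro i hi
          exact Function.update_of_ne (by omega) _ _
      · obtain ⟨S2, r2, m2, e2⟩ := pushDec_runs m1 (v := w) (i := 7) (by simp [hS1, setReg, h7])
        refine ⟨S2, (r1.seq (Runs.ite_pos r2 ?_)).mono (by simp), ⟨w :: p, m2, ?_⟩, ?_⟩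
        · rw [m1.base.zero]
          simp [hS1, setReg, hw]
        · rw [← h', List.filter_cons_of_pos (by simpa using hw)]
          simp
        · intro i hi
          rw [e2 i (by omega)]
          exact Function.update_of_ne (by omega) _ _)
    (k + 1) 12 13 v [] S1 le_rfl (by omega) ⟨[], m1, by simp [sphereList, hB]⟩
    ((e1 12 le_rfl (by omega)).trans hv)
  rw [List.filter_nil, List.reverse_nil, List.nil_append] at hp
  subst hp
  obtain ⟨S3, r3, ⟨W3, m3, hW3⟩, e3⟩ := visit_runs (A := A) hΔ
    (Inv := fun l S => ∃ W, Mem A lam t ((sphereList A k v).map .dec ++ r) H W S ∧ W \ l.toFinset = ∅)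
    (leaf := block [.store 3 7 1]) (c := 3) (fun l S ⟨W, h, _⟩ => hbase h)
    (fun l S i x ⟨W, h, h'⟩ hi => ⟨W, h.of_setReg (by omega) x, h'⟩)
    (by
      rintro w l S ⟨W, h, h'⟩ h7
      obtain ⟨S', r', m', e'⟩ := hstore 1 w h h7 (Or.inr rfl)
      rw [if_neg (by omega)] at m'
      refine ⟨S', r', ⟨_, m', ?_⟩, fun i _ => by rw [e']⟩
      rw [← h']
      ext x
      simp only [Finset.mem_sdiff, Finset.mem_erase, List.mem_toFinset, List.mem_cons, not_or]
      tauto)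
    k 12 13 v [] S2 le_rfl (by omega) ⟨B.toFinset, m2, by simp [hB]⟩
    ((e2 12 le_rfl (by omega)).trans ((e1 12 le_rfl (by omega)).trans hv))
  rw [List.toFinset_nil, Finset.sdiff_empty] at hW3
  subst hW3
  exact ⟨S3, r1.seq (r2.seq r3), m3⟩

/-- Suspends the decision of the vertex in register `5` until the sphere of radius `k + 1` around it
has been revealed. -/
def suspendProg (k : ℕ) : Prog :=
  .seq pushFin (.seq decideProg (.seq (block [.add 12 5 1]) (scheduleProg k)))

/-- The finishing task is pushed first, below the tasks of the sphere, and records the height before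
`v` enters the trail provisionally as unmatched. Restoring that height therefore removes this entry
too. -/
lemma suspendProg_runs {Δ : ℕ} (hΔ : ∀ v, (A.nbrs v).length ≤ Δ) (k : ℕ)
    (h : Mem A lam t r H ∅ S) {v : Fin n} (hv : S.reg 5 = (v : ℕ)) (h8 : S.reg 8 = 0) :
    ∃ S', Runs (suspendProg k) S (scheduleTime Δ k + 35) S' ∧
      Mem A lam ((v, none) :: t) ((sphereList A k v).map .dec ++ .fin v t.length :: r)
        (H.erase v) ∅ S' := by
  obtain ⟨S1, r1, m1, e1⟩ := pushFin_runs h hv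
  obtain ⟨S2, r2, m2, e2⟩ := decideProg_runs (o := none) m1 ((e1 5 (by omega) (by omega)).trans hv)
    ((e1 8 (by omega) (by omega)).trans h8)
  have r3 := Runs.block [.add 12 5 1] S2
  have e3 : ([.add 12 5 1] : List Op).foldl Op.exec S2 = setReg S2 12 v := by
    simp [Op.exec, setReg, e2, m2.base.zero]
  rw [e3] at r3
  obtain ⟨S4, r4, m4⟩ := scheduleProg_runs hΔ k (m2.of_setReg (i := 12) (by omega) v) (v := v)
    (by simp)
  refine ⟨S4, (r1.seq (r2.seq (r3.seq r4))).mono ?_, m4⟩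
  simp
  omega

end MatchingSampler
end

/-! ### The main loop realizes the task chain. -/

noncomputable section
namespace MatchingSampler

open RAM

variable {n : ℕ} {G : SimpleGraph (Fin n)} {A : AdjLists G} {lam : ℝ}
  {t : Trail (Fin n)} {r : List (Task (Fin n))} {H W : Finset (Fin n)} {S S' : State}

/-! ### One round of the main loop -/

/-- Decides the vertex in register `5`, which has to be alive. -/
def decAliveProg (m : ℕ) : Prog :=
  .seq (block [.store 2 5 2]) (.seq (sumProg (treeProg (2 * m + 1)) (treeProg 0) 5 12)
    (.seq (block [.rconst 3 1, .radd 4 12 3, .rdiv 4 3 4, .rconst 5 0, .radd 3 12 5, .const 8 0])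
      (.ite (.coin 4) decideProg (.seq (pickProg (treeProg (2 * m)) (treeProg 0) 5 12)
        (.ite (.eq 8 1) (suspendProg (2 * m + 3)) decideProg)))))

/-- Decides the vertex in register `5` if it is alive. -/
def decProg (m : ℕ) : Prog :=
  .seq (block [.load 7 2 5]) (.ite (.eq 7 1) (decAliveProg m) .nop)

/-- Finishes the decision of the vertex in register `5`. -/
def finProg (m N : ℕ) : Prog :=
  .seq (block [.sub 9 6 2]) (.seq (sumProg (treeProg (2 * m + 1)) (treeProg (2 * m)) 5 12)
    (.seq (block [.rconst 3 0, .radd 3 12 3, .const 8 0])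
      (.seq (pickProg (treeProg N) (treeProg (2 * m)) 5 12)
        (.seq restoreProg (.ite (.eq 8 1) (pushDec 5) decideProg)))))

/-- One round: pops a task and executes it. -/
def roundProg (m N : ℕ) : Prog :=
  .seq (block [.sub 3 3 2, .load 5 6 3, .load 6 7 3]) (.ite (.eq 6 1) (decProg m) (finProg m N))

/-- Executes tasks until there are none. -/
def mainLoop (m N : ℕ) : Prog := .loop (.lt 1 3) (roundProg m N)

/-- A bound on the running time of `roundProg`. -/
def roundTime (Δ m N : ℕ) : ℕ :=
  ((treeTime Δ (2 * m + 1) + treeTime Δ (2 * m) + treeTime Δ N + treeTime Δ 0 + 40) * Δ + 20) * 2 +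
    scheduleTime Δ (2 * m + 3) + 21 * ballBound Δ (2 * m + 4) + 200

lemma wt_one [DecidableRel G.Adj] (a b : ℕ) (H : Finset (Fin n)) (v : Fin n) :
    (wt G lam a b H v fun _ => 1) =
      ∑ u ∈ H.filter (G.Adj v), lam * (T G lam a (H.erase u) u - T G lam b (H.erase u) u) := by
  simp [wt]

lemma wt_sub [DecidableRel G.Adj] (a b : ℕ) (H : Finset (Fin n)) (v : Fin n) (F : Fin n → ℝ) :
    wt G lam a 0 H v F - wt G lam b 0 H v F = wt G lam a b H v F := by
  rw [wt, wt, wt, ← Finset.sum_sub_distrib]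
  exact Finset.sum_congr rfl fun u _ => by simp only [T]; ring

/-- `pickProg_bound` for tree recursions, with a common cost for the continuations. -/
lemma pickProg_tree [DecidableRel G.Adj] (hlam : 0 < lam) {v : Fin n} {Δ : ℕ}
    (hΔ : ∀ v, (A.nbrs v).length ≤ Δ) {Φ : Config → ℝ} {ρ : ℝ} (hΦ : Super Φ ρ) {a b c : ℕ}
    (hab : ∀ (H : Finset (Fin n)) (v : Fin n), T G lam b H v ≤ T G lam a H v)
    (hS : Base A lam S) (hH : Dead S H) (hv : S.reg 5 = (v : ℕ)) (h8 : S.reg 8 = 0)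
    (k : List Prog) (F : Fin n → ℝ) (F0 : ℝ) (hFp : ∀ u, 0 ≤ F u) (hF0p : 0 ≤ F0)
    (hF : ∀ u ∈ H.filter (G.Adj v), ∀ S', PickFrame 12 S S' → S'.reg 8 = u + 1 →
      Φ (k, S') ≤ ρ * c + F u)
    (hF0 : ∀ S', PickFrame 12 S S' → S'.reg 8 = 0 → Φ (k, S') ≤ ρ * c + F0)
    (hrem : (wt G lam a b H v fun _ => 1) ≤ S.rreg 3) :
    S.rreg 3 * Φ (pickProg (treeProg a) (treeProg b) 5 12 :: k, S) ≤
      S.rreg 3 * (ρ * (((treeTime Δ a + treeTime Δ b + 40) * Δ + 10 + c : ℕ) : ℝ)) +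
      wt G lam a b H v F + (S.rreg 3 - wt G lam a b H v fun _ => 1) * F0 := by
  have hc : 0 ≤ ρ * c := mul_nonneg hΦ.cost (Nat.cast_nonneg c)
  rw [wt_one] at hrem ⊢
  have := pickProg_bound hΔ (treeProg_computes (lam := lam) hΔ a) (treeProg_computes hΔ b) hΦ
    (vr := 5) (b := 12) (by omega) (by omega) hS hH hv h8 k (fun u => ρ * c + F u) (ρ * c + F0)
    (fun u => add_nonneg hc (hFp u)) (add_nonneg hc hF0p) hF hF0
    (fun u => mul_nonneg hlam.le (sub_nonneg.2 (hab _ _))) hrem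
  refine this.trans (le_of_eq ?_)
  simp only [mul_add, Finset.sum_add_distrib, ← Finset.sum_mul, wt]
  push_cast
  ring

section Round

variable [DecidableRel G.Adj] {Φ : Config → ℝ} {ρ : ℝ} {m N Δ : ℕ} {k : List Prog}
  {Ψ : Trail (Fin n) → List (Task (Fin n)) → ℝ}

/-- Popping a task. -/
lemma round_pop (hΦ : Super Φ ρ) {task : Task (Fin n)} (h : Mem A lam t (task :: r) H W S) :
    ∃ S', Φ (mainLoop m N :: k, S) ≤
      ρ * 9 + Φ (.ite (.eq 6 1) (decProg m) (finProg m N) :: mainLoop m N :: k, S') ∧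
      Mem A lam t r H W S' ∧ S'.reg 5 = (encTask task).1 ∧ S'.reg 6 = (encTask task).2 := by
  have hone := h.base.one
  have hsp : S.reg 3 = r.length + 1 := by simpa using h.sp
  have htop := h.tasks
  simp only [List.map_cons, Stk, List.length_map] at htop
  set S1 := ([.sub 3 3 2, .load 5 6 3, .load 6 7 3] : List Op).foldl Op.exec S with hS1
  refine ⟨S1, ?_, ?_, ?_, ?_⟩
  · have e1 := hΦ.loop_lt 1 3 (roundProg m N) k S
    rw [if_pos (by rw [h.base.zero, hsp]; omega)] at e1
    have e2 : Φ (roundProg m N :: mainLoop m N :: k, S) ≤ _ :=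
      hΦ.seq (block [.sub 3 3 2, .load 5 6 3, .load 6 7 3])
        (.ite (.eq 6 1) (decProg m) (finProg m N)) (mainLoop m N :: k) S
    have e3 := Runs.block [.sub 3 3 2, .load 5 6 3, .load 6 7 3] S Φ ρ hΦ
      (.ite (.eq 6 1) (decProg m) (finProg m N) :: mainLoop m N :: k)
    simp only [List.length_cons, List.length_nil] at e3
    push_cast at e3
    simp only [mainLoop] at *
    linarith
  · refine ⟨h.base.of_eq ?_ ?_ ?_ ?_ ?_, ?_, ?_, ?_, ?_, ?_, ?_, ?_⟩
    · simp [hS1, Op.exec]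
    · simp [hS1, Op.exec]
    · simp [hS1, Op.exec]
    · simp [hS1, Op.exec]
    · simp [hS1, Op.exec]
    · simp [hS1, Op.exec, hsp, hone]
    · simpa [hS1, Op.exec] using h.th
    · simpa [hS1, Op.exec] using htop.2.2
    · simpa [hS1, Op.exec] using h.trail
    · intro x
      simpa [hS1, Op.exec] using h.dead x
    · intro x
      simpa [hS1, Op.exec] using h.mark x
    · simpa [hS1, Op.exec] using h.out
  · simp [hS1, Op.exec, hsp, hone, htop.1]
  · simp [hS1, Op.exec, hsp, hone, htop.2.1]

/-- Popping a task to decide a vertex, and testing whether the vertex is alive. -/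
lemma round_dec (hΦ : Super Φ ρ) {v : Fin n} (h : Mem A lam t (.dec v :: r) H W S) :
    ∃ S', Φ (mainLoop m N :: k, S) ≤
      ρ * 15 + Φ ((if v ∈ H then decAliveProg m else .nop) :: mainLoop m N :: k, S') ∧
      Mem A lam t r H W S' ∧ S'.reg 5 = (v : ℕ) := by
  obtain ⟨S1, e1, m1, h5, h6⟩ := round_pop (m := m) (N := N) (k := k) hΦ h
  simp only [encTask] at h5 h6
  have e2 := hΦ.ite_eq 6 1 (decProg m) (finProg m N) (mainLoop m N :: k) S1
  rw [if_pos (by rw [h6, m1.base.zero])] at e2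
  have e3 : Φ (decProg m :: mainLoop m N :: k, S1) ≤ _ :=
    hΦ.seq (block [.load 7 2 5]) (.ite (.eq 7 1) (decAliveProg m) .nop) (mainLoop m N :: k) S1
  have e4 := Runs.block [.load 7 2 5] S1 Φ ρ hΦ
    (.ite (.eq 7 1) (decAliveProg m) .nop :: mainLoop m N :: k)
  have hfold : ([.load 7 2 5] : List Op).foldl Op.exec S1 = setReg S1 7 (if v ∈ H then 0 else 1) := by
    have := m1.dead v
    simp [Op.exec, setReg, h5, this]
  rw [hfold] at e4
  set S2 := setReg S1 7 (if v ∈ H then 0 else 1) with hS2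
  have m2 : Mem A lam t r H W S2 := m1.of_setReg (by omega) _
  have e5 := hΦ.ite_eq 7 1 (decAliveProg m) .nop (mainLoop m N :: k) S2
  have h7 : (S2.reg 7 = S2.reg 1) ↔ v ∈ H := by
    rw [m2.base.zero]
    by_cases hv : v ∈ H <;> simp [hS2, setReg, hv]
  simp only [h7] at e5
  refine ⟨S2, ?_, m2, by simp [hS2, setReg, h5]⟩
  simp only [List.length_cons, List.length_nil] at e4
  push_cast at e4
  linarith

/-- The potential `Ψ` dominates `Φ` at the head of the main loop. -/
def Dominates (A : AdjLists G) (lam : ℝ) (m N : ℕ) (k : List Prog) (Φ : Config → ℝ)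
    (Ψ : Trail (Fin n) → List (Task (Fin n)) → ℝ) : Prop :=
  (∀ t r, 0 ≤ Ψ t r) ∧
    ∀ t r S, Valid G t → Mem A lam t r (alive t) ∅ S → Φ (mainLoop m N :: k, S) ≤ Ψ t r

lemma cost_le (hΦ : Super Φ ρ) {a b : ℕ} (h : a ≤ b) : ρ * (a : ℝ) ≤ ρ * b :=
  mul_le_mul_of_nonneg_left (Nat.cast_le.2 h) hΦ.cost

lemma round_dead (hΦ : Super Φ ρ) (hΨ : Dominates A lam m N k Φ Ψ) {v : Fin n} (ht : Valid G t)
    (h : Mem A lam t (.dec v :: r) (alive t) ∅ S) (hv : v ∉ alive t) :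
    Φ (mainLoop m N :: k, S) ≤ ρ * roundTime Δ m N + Ψ t r := by
  obtain ⟨S1, e1, m1, -⟩ := round_dec (m := m) (N := N) (k := k) hΦ h
  rw [if_neg hv] at e1
  have e2 := hΦ.nop (mainLoop m N :: k) S1
  have e3 := hΨ.2 _ _ _ ht m1
  have := cost_le hΦ (show 16 ≤ roundTime Δ m N by rw [roundTime]; omega)
  push_cast at this
  linarith

/-- Multiplying by the total weight `1 + a` clears the denominators of the coin flips: weight `1`
goes to "unmatched", the lower bounds go to the partners, and the gap between the bounds goes to the
suspension. -/
lemma round_alive (hlam : 0 < lam) (hΔ : ∀ v, (A.nbrs v).length ≤ Δ) (hΦ : Super Φ ρ)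
    (hΨ : Dominates A lam m N k Φ Ψ) {v : Fin n} (ht : Valid G t)
    (h : Mem A lam t (.dec v :: r) (alive t) ∅ S) (hv : v ∈ alive t) :
    (1 + wt G lam (2 * m + 1) 0 ((alive t).erase v) v fun _ => 1) * Φ (mainLoop m N :: k, S) ≤
      (1 + wt G lam (2 * m + 1) 0 ((alive t).erase v) v fun _ => 1) * (ρ * roundTime Δ m N) +
      Ψ ((v, none) :: t) r +
      (wt G lam (2 * m) 0 ((alive t).erase v) v fun u => Ψ ((v, some u) :: t) r) +
      (wt G lam (2 * m + 1) (2 * m) ((alive t).erase v) v fun _ => 1) *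
        Ψ ((v, none) :: t) ((sphereList A (2 * m + 3) v).map .dec ++ .fin v t.length :: r) := by
  obtain ⟨S1, e1, m1, h5⟩ := round_dec (m := m) (N := N) (k := k) hΦ h
  rw [if_pos hv] at e1
  set H := (alive t).erase v with hH
  have hrho := hΦ.cost
  -- the vertex is killed
  have e2 : Φ (decAliveProg m :: mainLoop m N :: k, S1) ≤ _ :=
    hΦ.seq (block [.store 2 5 2]) _ (mainLoop m N :: k) S1
  have e3 := Runs.block [.store 2 5 2] S1 Φ ρ hΦ
    ((.seq (sumProg (treeProg (2 * m + 1)) (treeProg 0) 5 12)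
    (.seq (block [.rconst 3 1, .radd 4 12 3, .rdiv 4 3 4, .rconst 5 0, .radd 3 12 5, .const 8 0])
      (.ite (.coin 4) decideProg (.seq (pickProg (treeProg (2 * m)) (treeProg 0) 5 12)
        (.ite (.eq 8 1) (suspendProg (2 * m + 3)) decideProg))))) :: mainLoop m N :: k)
  set S2 := ([.store 2 5 2] : List Op).foldl Op.exec S1 with hS2
  have m2 : Mem A lam t r H ∅ S2 := by
    have hone := m1.base.one
    refine ⟨m1.base.of_eq ?_ ?_ ?_ ?_ ?_, ?_, ?_, ?_, ?_, ?_, ?_, ?_⟩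
    · simp [hS2, Op.exec]
    · simp [hS2, Op.exec]
    · simp [hS2, Op.exec]
    · simp [hS2, Op.exec]
    · simp [hS2, Op.exec]
    · simpa [hS2, Op.exec] using m1.sp
    · simpa [hS2, Op.exec] using m1.th
    · simpa [hS2, Op.exec] using m1.tasks
    · simpa [hS2, Op.exec] using m1.trail
    · intro x
      have := Dead.kill m1.dead v x
      simpa [hS2, Op.exec, h5, hone, hH] using this
    · intro x
      simpa [hS2, Op.exec] using m1.mark x
    · simpa [hS2, Op.exec] using m1.out
  have h52 : S2.reg 5 = (v : ℕ) := by simp [hS2, Op.exec, h5]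
  -- the weights are summed
  obtain ⟨S3, r3, f3, v3⟩ := sumProg_computes (lam := lam) hΔ (treeProg_computes hΔ (2 * m + 1))
    (treeProg_computes hΔ 0) 5 12 S2 H v (by omega) (by omega) m2.base m2.dead h52
  replace v3 := v3.trans (wt_one _ _ H v).symm
  set a := wt G lam (2 * m + 1) 0 H v fun _ => 1 with ha
  have ha0 : 0 ≤ a := by
    rw [ha, wt_zero_right]
    exact Finset.sum_nonneg fun u _ => mul_nonneg (mul_nonneg hlam.le (T_nonneg hlam _ _ _)) zero_le_one
  have m3 := m2.of_frame (by omega) f3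
  have e4 := hΦ.seq (sumProg (treeProg (2 * m + 1)) (treeProg 0) 5 12)
    (.seq (block [.rconst 3 1, .radd 4 12 3, .rdiv 4 3 4, .rconst 5 0, .radd 3 12 5, .const 8 0])
      (.ite (.coin 4) decideProg (.seq (pickProg (treeProg (2 * m)) (treeProg 0) 5 12)
        (.ite (.eq 8 1) (suspendProg (2 * m + 3)) decideProg)))) (mainLoop m N :: k) S2
  have e5 := r3 Φ ρ hΦ
    ((.seq (block [.rconst 3 1, .radd 4 12 3, .rdiv 4 3 4, .rconst 5 0, .radd 3 12 5, .const 8 0])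
      (.ite (.coin 4) decideProg (.seq (pickProg (treeProg (2 * m)) (treeProg 0) 5 12)
        (.ite (.eq 8 1) (suspendProg (2 * m + 3)) decideProg)))) :: mainLoop m N :: k)
  have e6 := hΦ.seq
    (block [.rconst 3 1, .radd 4 12 3, .rdiv 4 3 4, .rconst 5 0, .radd 3 12 5, .const 8 0])
    (.ite (.coin 4) decideProg (.seq (pickProg (treeProg (2 * m)) (treeProg 0) 5 12)
        (.ite (.eq 8 1) (suspendProg (2 * m + 3)) decideProg))) (mainLoop m N :: k) S3
  have e7 := Runs.block
    [.rconst 3 1, .radd 4 12 3, .rdiv 4 3 4, .rconst 5 0, .radd 3 12 5, .const 8 0] S3 Φ ρ hΦ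
    (.ite (.coin 4) decideProg (.seq (pickProg (treeProg (2 * m)) (treeProg 0) 5 12)
        (.ite (.eq 8 1) (suspendProg (2 * m + 3)) decideProg)) :: mainLoop m N :: k)
  set S4 := ([.rconst 3 1, .radd 4 12 3, .rdiv 4 3 4, .rconst 5 0, .radd 3 12 5, .const 8 0] :
    List Op).foldl Op.exec S3 with hS4
  have m4 : Mem A lam t r H ∅ S4 := by
    refine m3.of_eq (fun i hi hi' => ?_) ?_ ?_ ?_
    · simp [hS4, Op.exec, show i ≠ 8 by omega]
    · simp [hS4, Op.exec]
    · simp [hS4, Op.exec]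
    · simp [hS4, Op.exec]
  have h54 : S4.reg 5 = (v : ℕ) := by
    rw [← h52, ← f3.reg 5 (by omega)]
    simp [hS4, Op.exec]
  have h84 : S4.reg 8 = 0 := by simp [hS4, Op.exec]
  have hr3 : S4.rreg 3 = a := by simp [hS4, Op.exec, v3]
  have hr4 : S4.rreg 4 = 1 / (1 + a) := by simp [hS4, Op.exec, v3, add_comm]
  -- the first coin
  have e8 := hΦ.coin 4 decideProg (.seq (pickProg (treeProg (2 * m)) (treeProg 0) 5 12)
    (.ite (.eq 8 1) (suspendProg (2 * m + 3)) decideProg)) (mainLoop m N :: k) S4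
    (by rw [hr4]; positivity) (by rw [hr4, div_le_one (by positivity)]; linarith)
  rw [hr4] at e8
  obtain ⟨S5, r5, m5, -⟩ := decideProg_runs (o := none) m4 h54 h84
  have e9 := r5 Φ ρ hΦ (mainLoop m N :: k)
  have e10 := hΨ.2 _ _ _ (ht.none hv) (by rw [alive_cons, ← kill_erase]; exact m5)
  -- the choice of a neighbor
  have e11 := hΦ.seq (pickProg (treeProg (2 * m)) (treeProg 0) 5 12)
    (.ite (.eq 8 1) (suspendProg (2 * m + 3)) decideProg) (mainLoop m N :: k) S4
  have hsusp : ((scheduleTime Δ (2 * m + 3) + 36 : ℕ) : ℝ) = scheduleTime Δ (2 * m + 3) + 36 := by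
    push_cast; ring
  have hst0 : (0 : ℝ) ≤ scheduleTime Δ (2 * m + 3) := Nat.cast_nonneg _
  have e12 := pickProg_tree (A := A) hlam hΔ hΦ (a := 2 * m) (b := 0)
    (c := scheduleTime Δ (2 * m + 3) + 36)
    (fun H v => (T_even_le_odd_ge hlam 0).1 _ (by omega) H v) m4.base m4.dead h54 h84
    (.ite (.eq 8 1) (suspendProg (2 * m + 3)) decideProg :: mainLoop m N :: k)
    (fun u => Ψ ((v, some u) :: t) r)
    (Ψ ((v, none) :: t) ((sphereList A (2 * m + 3) v).map .dec ++ .fin v t.length :: r))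
    (fun u => hΨ.1 _ _) (hΨ.1 _ _)
    (by
      intro u hu S' hf h8
      have m' := m4.of_pickFrame (by omega) hf
      have d1 := hΦ.ite_eq 8 1 (suspendProg (2 * m + 3)) decideProg (mainLoop m N :: k) S'
      rw [if_neg (by rw [h8, m'.base.zero]; omega)] at d1
      obtain ⟨S6, r6, m6, -⟩ := decideProg_runs (o := some u) m'
        ((hf.reg 5 (by omega) (by omega)).trans h54) h8
      have d2 := r6 Φ ρ hΦ (mainLoop m N :: k)
      have d3 := hΨ.2 _ _ _ (ht.some hv hu) (by rw [alive_cons, ← kill_erase]; exact m6)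
      rw [hsusp]
      push_cast at d2
      have := mul_nonneg hrho hst0
      linarith)
    (by
      intro S' hf h8
      have m' := m4.of_pickFrame (by omega) hf
      have d1 := hΦ.ite_eq 8 1 (suspendProg (2 * m + 3)) decideProg (mainLoop m N :: k) S'
      rw [if_pos (by rw [h8, m'.base.zero])] at d1
      obtain ⟨S6, r6, m6⟩ := suspendProg_runs hΔ (2 * m + 3) m'
        ((hf.reg 5 (by omega) (by omega)).trans h54) h8
      have d2 := r6 Φ ρ hΦ (mainLoop m N :: k)
      rw [hH, Finset.erase_idem] at m6
      have d3 := hΨ.2 _ _ _ (ht.none hv) m6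
      rw [hsusp]
      push_cast at d2
      linarith)
    (by
      rw [hr3, ha, wt_one, wt_one]
      refine Finset.sum_le_sum fun u _ => mul_le_mul_of_nonneg_left ?_ hlam.le
      exact sub_le_sub_right ((T_even_le_odd_ge hlam m).1 _ (by omega) _ _) _)
  rw [hr3, ha, wt_sub, ← ha] at e12
  set P := wt G lam (2 * m) 0 H v fun u => Ψ ((v, some u) :: t) r
  set R := (wt G lam (2 * m + 1) (2 * m) H v fun _ => 1) *
    Ψ ((v, none) :: t) ((sphereList A (2 * m + 3) v).map .dec ++ .fin v t.length :: r)
  set c1 := (treeTime Δ (2 * m + 1) + treeTime Δ 0 + 30) * Δ + 20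
  set c2 := (treeTime Δ (2 * m) + treeTime Δ 0 + 40) * Δ + 10 + (scheduleTime Δ (2 * m + 3) + 36)
  simp only [List.length_cons, List.length_nil] at e3 e7
  push_cast at e3 e7 e9
  set Φa := Φ (decideProg :: mainLoop m N :: k, S4)
  set Φb := Φ (.seq (pickProg (treeProg (2 * m)) (treeProg 0) 5 12)
    (.ite (.eq 8 1) (suspendProg (2 * m + 3)) decideProg) :: mainLoop m N :: k, S4)
  have hX : 0 < 1 + a := by linarith
  have f1 : Φ (mainLoop m N :: k, S) ≤ ρ * (c1 + 40) + (1 / (1 + a) * Φa + (1 - 1 / (1 + a)) * Φb) := by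
    linarith
  have f2 := mul_le_mul_of_nonneg_left f1 hX.le
  have f3 : (1 + a) * (1 / (1 + a) * Φa + (1 - 1 / (1 + a)) * Φb) = Φa + a * Φb := by
    field_simp
    ring
  have f4 := mul_le_mul_of_nonneg_left e11 ha0
  have hc : c1 + c2 + 70 ≤ roundTime Δ m N := by
    have h1 : (treeTime Δ (2 * m + 1) + treeTime Δ 0 + 30) * Δ ≤ (treeTime Δ (2 * m + 1) +
      treeTime Δ (2 * m) + treeTime Δ N + treeTime Δ 0 + 40) * Δ := Nat.mul_le_mul_right _ (by omega)
    have h2 : (treeTime Δ (2 * m) + treeTime Δ 0 + 40) * Δ ≤ (treeTime Δ (2 * m + 1) +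
      treeTime Δ (2 * m) + treeTime Δ N + treeTime Δ 0 + 40) * Δ := Nat.mul_le_mul_right _ (by omega)
    simp only [c1, c2, roundTime]
    omega
  have f5 := mul_le_mul_of_nonneg_left (cost_le hΦ hc) hX.le
  push_cast at f5
  have g1 : 0 ≤ a * ρ := mul_nonneg ha0 hrho
  have g2 : 0 ≤ ρ * c2 := mul_nonneg hrho (Nat.cast_nonneg _)
  rw [mul_add, f3] at f2
  linarith

/-- The gap is recomputed in the current living set and serves as the total weight of the choice;
the final inequality is multiplied by it, since it may be zero. The choice is made while the sphere
is decided, and only then is the trail restored. -/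
lemma round_fin (hlam : 0 < lam) (hΔ : ∀ v, (A.nbrs v).length ≤ Δ) (hN : 2 * m + 1 ≤ N)
    (hΦ : Super Φ ρ) (hΨ : Dominates A lam m N k Φ Ψ) {v : Fin n} (τ : Trail (Fin n))
    (ht : Valid G (τ ++ (v, none) :: t)) (hτ : τ.length ≤ (sphereList A (2 * m + 3) v).length)
    (h : Mem A lam (τ ++ (v, none) :: t) (.fin v t.length :: r) (alive (τ ++ (v, none) :: t)) ∅ S) :
    (wt G lam (2 * m + 1) (2 * m) (alive (τ ++ (v, none) :: t)) v fun _ => 1) *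
        Φ (mainLoop m N :: k, S) ≤
      (wt G lam (2 * m + 1) (2 * m) (alive (τ ++ (v, none) :: t)) v fun _ => 1) *
        (ρ * roundTime Δ m N) +
      (wt G lam N (2 * m) (alive (τ ++ (v, none) :: t)) v fun u => Ψ ((v, some u) :: t) r) +
      ((wt G lam (2 * m + 1) (2 * m) (alive (τ ++ (v, none) :: t)) v fun _ => 1) -
        wt G lam N (2 * m) (alive (τ ++ (v, none) :: t)) v fun _ => 1) * Ψ t (.dec v :: r) := by
  have hvt : Valid G ((v, none) :: t) := by
    clear h hτ
    induction τ with
    | nil => exact ht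
    | cons e τ ih => exact ih ht.1
  have hva : v ∈ alive t := hvt.2.1
  set H := alive (τ ++ (v, none) :: t) with hH
  have hrho := hΦ.cost
  obtain ⟨S1, e1, m1, h5, h6⟩ := round_pop (m := m) (N := N) (k := k) hΦ h
  simp only [encTask] at h5 h6
  have e2 := hΦ.ite_eq 6 1 (decProg m) (finProg m N) (mainLoop m N :: k) S1
  rw [if_neg (by rw [h6, m1.base.zero]; omega)] at e2
  have e3 : Φ (finProg m N :: mainLoop m N :: k, S1) ≤ _ :=
    hΦ.seq (block [.sub 9 6 2]) _ (mainLoop m N :: k) S1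
  have e4 := Runs.block [.sub 9 6 2] S1 Φ ρ hΦ
    ((.seq (sumProg (treeProg (2 * m + 1)) (treeProg (2 * m)) 5 12)
    (.seq (block [.rconst 3 0, .radd 3 12 3, .const 8 0])
      (.seq (pickProg (treeProg N) (treeProg (2 * m)) 5 12)
        (.seq restoreProg (.ite (.eq 8 1) (pushDec 5) decideProg))))) :: mainLoop m N :: k)
  have hfold : ([.sub 9 6 2] : List Op).foldl Op.exec S1 = setReg S1 9 t.length := by
    simp [Op.exec, setReg, h6, m1.base.one]
  rw [hfold] at e4
  set S2 := setReg S1 9 t.length with hS2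
  have m2 : Mem A lam (τ ++ (v, none) :: t) r H ∅ S2 := m1.of_setReg (by omega) _
  have h52 : S2.reg 5 = (v : ℕ) := by simp [hS2, setReg, h5]
  have h92 : S2.reg 9 = t.length := by simp [hS2, setReg]
  obtain ⟨S3, r3, f3, v3⟩ := sumProg_computes (lam := lam) hΔ (treeProg_computes hΔ (2 * m + 1))
    (treeProg_computes hΔ (2 * m)) 5 12 S2 H v (by omega) (by omega) m2.base m2.dead h52
  replace v3 := v3.trans (wt_one _ _ H v).symm
  set a := wt G lam (2 * m + 1) (2 * m) H v fun _ => 1 with ha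
  have hwle : (wt G lam N (2 * m) H v fun _ => 1) ≤ a := by
    rw [ha, wt_one, wt_one]
    refine Finset.sum_le_sum fun u _ => mul_le_mul_of_nonneg_left ?_ hlam.le
    exact sub_le_sub_right ((T_even_le_odd_ge hlam m).2 _ hN _ _) _
  have ha0 : 0 ≤ a := by
    rw [ha, wt_one]
    exact Finset.sum_nonneg fun u _ => mul_nonneg hlam.le
      (sub_nonneg.2 ((T_even_le_odd_ge hlam m).1 _ (by omega) _ _))
  have m3 := m2.of_frame (by omega) f3
  have e5 := hΦ.seq (sumProg (treeProg (2 * m + 1)) (treeProg (2 * m)) 5 12)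
    (.seq (block [.rconst 3 0, .radd 3 12 3, .const 8 0])
      (.seq (pickProg (treeProg N) (treeProg (2 * m)) 5 12)
        (.seq restoreProg (.ite (.eq 8 1) (pushDec 5) decideProg)))) (mainLoop m N :: k) S2
  have e6 := r3 Φ ρ hΦ ((.seq (block [.rconst 3 0, .radd 3 12 3, .const 8 0])
      (.seq (pickProg (treeProg N) (treeProg (2 * m)) 5 12)
        (.seq restoreProg (.ite (.eq 8 1) (pushDec 5) decideProg)))) :: mainLoop m N :: k)
  have e7 := hΦ.seq (block [.rconst 3 0, .radd 3 12 3, .const 8 0])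
      (.seq (pickProg (treeProg N) (treeProg (2 * m)) 5 12)
        (.seq restoreProg (.ite (.eq 8 1) (pushDec 5) decideProg))) (mainLoop m N :: k) S3
  have e8 := Runs.block [.rconst 3 0, .radd 3 12 3, .const 8 0] S3 Φ ρ hΦ
      ((.seq (pickProg (treeProg N) (treeProg (2 * m)) 5 12)
        (.seq restoreProg (.ite (.eq 8 1) (pushDec 5) decideProg))) :: mainLoop m N :: k)
  set S4 := ([.rconst 3 0, .radd 3 12 3, .const 8 0] : List Op).foldl Op.exec S3 with hS4
  have hreg4 : ∀ i, i ≠ 8 → S4.reg i = S3.reg i := fun i hi => by simp [hS4, Op.exec, hi]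
  have m4 : Mem A lam (τ ++ (v, none) :: t) r H ∅ S4 := by
    refine m3.of_eq (fun i hi hi' => hreg4 i (by omega)) ?_ ?_ ?_
    · simp [hS4, Op.exec]
    · simp [hS4, Op.exec]
    · simp [hS4, Op.exec]
  have h54 : S4.reg 5 = (v : ℕ) := (hreg4 5 (by omega)).trans ((f3.reg 5 (by omega)).trans h52)
  have h94 : S4.reg 9 = t.length := (hreg4 9 (by omega)).trans ((f3.reg 9 (by omega)).trans h92)
  have h84 : S4.reg 8 = 0 := by simp [hS4, Op.exec]
  have hr3 : S4.rreg 3 = a := by simp [hS4, Op.exec, v3]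
  have e9 := hΦ.seq (pickProg (treeProg N) (treeProg (2 * m)) 5 12)
    (.seq restoreProg (.ite (.eq 8 1) (pushDec 5) decideProg)) (mainLoop m N :: k) S4
  set c := 21 * ballBound Δ (2 * m + 4) + 60 with hc
  have hres : ∀ S', PickFrame 12 S4 S' → ∃ S6, Φ (.seq restoreProg
      (.ite (.eq 8 1) (pushDec 5) decideProg) :: mainLoop m N :: k, S') ≤
      ρ * (21 * ballBound Δ (2 * m + 4) + 30) +
        Φ (.ite (.eq 8 1) (pushDec 5) decideProg :: mainLoop m N :: k, S6) ∧
      Mem A lam t r (alive t) ∅ S6 ∧ S6.reg 5 = (v : ℕ) ∧ S6.reg 8 = S'.reg 8 := by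
    intro S' hf
    have m' := m4.of_pickFrame (by omega) hf
    -- The provisional entry of `v` is dropped along with the decisions above it.
    have happ : τ ++ (v, none) :: t = (τ ++ [(v, none)]) ++ t := by simp
    have ht' := ht
    rw [hH, happ] at m'
    rw [happ] at ht'
    obtain ⟨S6, r6, m6, g5, g8⟩ := restoreProg_runs _ m' ht'
      ((hf.reg 9 (by omega) (by omega)).trans h94)
    have d1 := hΦ.seq restoreProg (.ite (.eq 8 1) (pushDec 5) decideProg) (mainLoop m N :: k) S'
    have d2 := r6 Φ ρ hΦ (.ite (.eq 8 1) (pushDec 5) decideProg :: mainLoop m N :: k)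
    refine ⟨S6, ?_, m6, g5.trans ((hf.reg 5 (by omega) (by omega)).trans h54), g8⟩
    have hlen : 21 * (τ ++ [(v, (none : Option (Fin n)))]).length + 1 ≤
        21 * ballBound Δ (2 * m + 4) + 22 := by
      have : (sphereList A (2 * m + 3) v).length ≤ ballBound Δ (2 * m + 4) :=
        length_sphereList hΔ (2 * m + 3) v
      simp only [List.length_append, List.length_cons, List.length_nil]
      omega
    have d3 := cost_le hΦ hlen
    push_cast at d2 d3
    linarith
  have hcc : (c : ℝ) = 21 * ballBound Δ (2 * m + 4) + 60 := by rw [hc]; push_cast; ring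
  have e10 := pickProg_tree (A := A) hlam hΔ hΦ (a := N) (b := 2 * m) (c := c)
    (fun H v => (T_even_le_odd_ge hlam m).1 _ (by omega) H v) m4.base m4.dead h54 h84
    (.seq restoreProg (.ite (.eq 8 1) (pushDec 5) decideProg) :: mainLoop m N :: k)
    (fun u => Ψ ((v, some u) :: t) r) (Ψ t (.dec v :: r)) (fun u => hΨ.1 _ _) (hΨ.1 _ _)
    (by
      intro u hu S' hf h8
      obtain ⟨S6, d1, m6, g5, g8⟩ := hres S' hf
      have d2 := hΦ.ite_eq 8 1 (pushDec 5) decideProg (mainLoop m N :: k) S6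
      rw [if_neg (by rw [g8, h8, m6.base.zero]; omega)] at d2
      obtain ⟨S7, r7, m7, -⟩ := decideProg_runs (o := some u) m6 g5 (g8.trans h8)
      have d3 := r7 Φ ρ hΦ (mainLoop m N :: k)
      have hu' := Finset.mem_filter.1 hu
      have hu'' : u ∈ ((alive t).erase v).filter (G.Adj v) :=
        Finset.mem_filter.2 ⟨alive_append_subset _ _ hu'.1, hu'.2⟩
      have d4 := hΨ.2 _ _ _ (hvt.1.some hva hu'') (by rw [alive_cons]; exact m7)
      rw [hcc]
      push_cast at d3
      linarith)
    (by
      intro S' hf h8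
      obtain ⟨S6, d1, m6, g5, g8⟩ := hres S' hf
      have d2 := hΦ.ite_eq 8 1 (pushDec 5) decideProg (mainLoop m N :: k) S6
      rw [if_pos (by rw [g8, h8, m6.base.zero])] at d2
      obtain ⟨S7, r7, m7, -⟩ := pushDec_runs m6 g5
      have d3 := r7 Φ ρ hΦ (mainLoop m N :: k)
      have d4 := hΨ.2 _ _ _ hvt.1 m7
      rw [hcc]
      push_cast at d3
      linarith)
    (by rw [hr3]; exact hwle)
  rw [hr3] at e10
  set P := wt G lam N (2 * m) H v fun u => Ψ ((v, some u) :: t) r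
  set R := (a - wt G lam N (2 * m) H v fun _ => 1) * Ψ t (.dec v :: r)
  set c1 := (treeTime Δ (2 * m + 1) + treeTime Δ (2 * m) + 30) * Δ + 20
  set c2 := (treeTime Δ N + treeTime Δ (2 * m) + 40) * Δ + 10 + c
  simp only [List.length_cons, List.length_nil] at e4 e8
  push_cast at e4 e8
  have hcost : c1 + c2 + 30 ≤ roundTime Δ m N := by
    have h1 : (treeTime Δ (2 * m + 1) + treeTime Δ (2 * m) + 30) * Δ ≤ (treeTime Δ (2 * m + 1) +
      treeTime Δ (2 * m) + treeTime Δ N + treeTime Δ 0 + 40) * Δ := Nat.mul_le_mul_right _ (by omega)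
    have h2 : (treeTime Δ N + treeTime Δ (2 * m) + 40) * Δ ≤ (treeTime Δ (2 * m + 1) +
      treeTime Δ (2 * m) + treeTime Δ N + treeTime Δ 0 + 40) * Δ := Nat.mul_le_mul_right _ (by omega)
    simp only [c1, c2, hc, roundTime]
    omega
  have f1 : Φ (mainLoop m N :: k, S) ≤ ρ * (c1 + 30) +
      Φ (pickProg (treeProg N) (treeProg (2 * m)) 5 12 ::
        .seq restoreProg (.ite (.eq 8 1) (pushDec 5) decideProg) :: mainLoop m N :: k, S4) := by
    linarith
  have f2 := mul_le_mul_of_nonneg_left f1 ha0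
  have f5 := mul_le_mul_of_nonneg_left (cost_le hΦ hcost) ha0
  push_cast at f5
  linarith

/-- The largest value of `Φ` at the head of the main loop over the representations of a trail and a
list of tasks. -/
def potential (A : AdjLists G) (lam : ℝ) (m N : ℕ) (k : List Prog) (Φ : Config → ℝ)
    (t : Trail (Fin n)) (r : List (Task (Fin n))) : ℝ :=
  ⨆ S : {S // Mem A lam t r (alive t) ∅ S}, Φ (mainLoop m N :: k, S.1)

/-- The supremum dominates every memory content because potentials are bounded. -/
lemma potential_dominates (hΦ : Super Φ ρ) :
    Dominates A lam m N k Φ (potential A lam m N k Φ) := by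
  refine ⟨fun t r => Real.iSup_nonneg fun S => hΦ.nonneg _, fun t r S _ h => ?_⟩
  obtain ⟨B, hB⟩ := hΦ.bdd
  exact le_ciSup (f := fun S : {S // Mem A lam t r (alive t) ∅ S} => Φ (mainLoop m N :: k, S.1))
    ⟨B, by rintro _ ⟨S, rfl⟩; exact hB _⟩ ⟨S, h⟩

/-- Bounds that are uniform over the representations pass to the supremum. The assumption `0 ≤ b`
covers pairs without any representation, whose real supremum is `0`. -/
lemma mul_potential_le {a b : ℝ} (ha : 0 ≤ a) (hb : 0 ≤ b)
    (h : ∀ S, Mem A lam t r (alive t) ∅ S → a * Φ (mainLoop m N :: k, S) ≤ b) :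
    a * potential A lam m N k Φ t r ≤ b := by
  rw [potential, Real.mul_iSup_of_nonneg ha]
  exact Real.iSup_le (fun S => h S.1 S.2) hb

/-- The potential of the main loop satisfies the inequalities of the task chain. -/
lemma potential_chainBound (hlam : 0 < lam) (hΔ : ∀ v, (A.nbrs v).length ≤ Δ) (hN : 2 * m + 1 ≤ N)
    (hΦ : Super Φ ρ) :
    ChainBound G lam (potential A lam m N k Φ) ρ (roundTime Δ m N) (sphereList A (2 * m + 3)) m N := by
  have hΨ := potential_dominates (A := A) (lam := lam) (m := m) (N := N) (k := k) hΦ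
  have hc : 0 ≤ ρ * (roundTime Δ m N : ℝ) := mul_nonneg hΦ.cost (Nat.cast_nonneg _)
  have hwt : ∀ a b H v (F : Fin n → ℝ), (∀ (H : Finset (Fin n)) (v : Fin n), T G lam b H v ≤ T G lam a H v) →
      (∀ u, 0 ≤ F u) → 0 ≤ wt G lam a b H v F := fun a b H v F h hF =>
    Finset.sum_nonneg fun u _ => mul_nonneg (mul_nonneg hlam.le (sub_nonneg.2 (h _ _))) (hF u)
  have h0 : ∀ k (H : Finset (Fin n)) (v : Fin n), T G lam 0 H v ≤ T G lam k H v :=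
    fun k H v => (T_even_le_odd_ge hlam 0).1 _ (by omega) H v
  have h1 : ∀ k, 2 * m ≤ k → ∀ (H : Finset (Fin n)) (v : Fin n), T G lam (2 * m) H v ≤ T G lam k H v :=
    fun k hk H v => (T_even_le_odd_ge hlam m).1 _ hk H v
  refine ⟨fun t v r ht hv => ?_, fun t v r ht hv => ?_, fun τ t v r ht hτ => ?_⟩
  · have := mul_potential_le (A := A) (lam := lam) (m := m) (N := N) (k := k) (Φ := Φ) (t := t)
      (r := .dec v :: r) zero_le_one (add_nonneg hc (hΨ.1 t r)) fun S hS => by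
        rw [one_mul]
        exact round_dead hΦ hΨ ht hS hv
    rwa [one_mul] at this
  · have hX := hwt (2 * m + 1) 0 ((alive t).erase v) v (fun _ => 1) (h0 _) fun _ => zero_le_one
    refine mul_potential_le (by linarith) ?_ fun S hS => round_alive hlam hΔ hΦ hΨ ht hS hv
    refine add_nonneg (add_nonneg (add_nonneg (mul_nonneg (by linarith) hc) (hΨ.1 _ _)) ?_)
      (mul_nonneg ?_ (hΨ.1 _ _))
    · exact hwt _ _ _ _ _ (h0 _) fun u => hΨ.1 _ _
    · exact hwt _ _ _ _ _ (h1 _ (by omega)) fun _ => zero_le_one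
  · have hX := hwt (2 * m + 1) (2 * m) (alive (τ ++ (v, none) :: t)) v (fun _ => 1) (h1 _ (by omega))
      fun _ => zero_le_one
    refine mul_potential_le hX ?_ fun S hS => round_fin hlam hΔ hN hΦ hΨ τ ht hτ hS
    refine add_nonneg (add_nonneg (mul_nonneg hX hc) ?_) (mul_nonneg (sub_nonneg.2 ?_) (hΨ.1 _ _))
    · exact hwt _ _ _ _ _ (h1 _ (by omega)) fun u => hΨ.1 _ _
    · rw [wt_one, wt_one]
      refine Finset.sum_le_sum fun u _ => mul_le_mul_of_nonneg_left ?_ hlam.le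
      exact sub_le_sub_right ((T_even_le_odd_ge hlam m).2 _ hN _ _) _

end Round

end MatchingSampler
end

/-! ### Output, initialization, and the bound for the whole program. -/

noncomputable section
namespace MatchingSampler

open RAM

variable {n : ℕ} {G : SimpleGraph (Fin n)} {A : AdjLists G} {lam : ℝ}
  {t : Trail (Fin n)} {r : List (Task (Fin n))} {H W : Finset (Fin n)} {S S' : State}

/-! ### The output -/

/-- The matched pairs of a trail, the earliest first. -/
def pairs : Trail (Fin n) → List (Fin n × Fin n)
  | [] => []
  | (_, none) :: t => pairs t
  | (v, some u) :: t => pairs t ++ [(v, u)]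

/-- The output that describes a list of edges. -/
def word (l : List (Fin n × Fin n)) : List ℕ := l.flatMap fun p => [(p.1 : ℕ), (p.2 : ℕ)]

lemma mem_pairs_edges (t : Trail (Fin n)) (e : Sym2 (Fin n)) :
    e ∈ (pairs t).map (fun p => s(p.1, p.2)) ↔ e ∈ edges t := by
  induction t with
  | nil => simp [pairs, edges]
  | cons x t ih =>
    obtain ⟨v, _ | u⟩ := x
    · exact ih
    · simp only [pairs, edges, List.map_append, List.mem_append, ih, Finset.mem_insert,
        List.map_cons, List.map_nil, List.mem_singleton, or_comm]

section Valid

variable [DecidableRel G.Adj]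

lemma notMem_alive_of_mem_edges (t : Trail (Fin n)) {e : Sym2 (Fin n)} (he : e ∈ edges t)
    {v : Fin n} (hv : v ∈ e) : v ∉ alive t := by
  induction t with
  | nil => simp [edges] at he
  | cons x t ih =>
    obtain ⟨w, _ | u⟩ := x
    · exact fun h => ih he (Finset.mem_of_mem_erase h)
    · rcases Finset.mem_insert.1 he with rfl | he
      · rcases Sym2.mem_iff.1 hv with rfl | rfl <;> simp [alive]
      · exact fun h => ih he (Finset.mem_of_mem_erase (Finset.mem_of_mem_erase h))

/-- A new edge starts at a living vertex, whereas the ends of all earlier edges are dead. -/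
lemma nodup_pairs (ht : Valid G t) : ((pairs t).map fun p => s(p.1, p.2)).Nodup := by
  induction t with
  | nil => simp [pairs]
  | cons x t ih =>
    obtain ⟨v, _ | u⟩ := x
    · exact ih ht.1
    · simp only [pairs, List.map_append, List.map_cons, List.map_nil]
      refine List.nodup_append.2 ⟨ih ht.1, List.nodup_singleton _, ?_⟩
      rintro a ha b hb rfl
      rw [List.mem_singleton.1 hb, mem_pairs_edges] at ha
      exact notMem_alive_of_mem_edges t ha (Sym2.mem_mk_left v u) ht.2.1

lemma word_mem_edgeListings (ht : Valid G t) : word (pairs t) ∈ edgeListings (edges t) :=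
  ⟨pairs t, nodup_pairs ht, mem_pairs_edges t, rfl⟩

/-- Every entry uses up at least one living vertex. This bounds the time for printing. -/
lemma Valid.length_le (ht : Valid G t) : t.length ≤ n := by
  have h : ∀ t : Trail (Fin n), Valid G t → t.length + (alive t).card ≤ n := by
    intro t
    induction t with
    | nil => simp [alive]
    | cons x t ih =>
      intro ht
      have h1 := ih ht.1
      have h2 := Finset.card_le_card (alive_cons_subset x t)
      have h3 := Finset.card_erase_add_one ht.2.1
      simp only [List.length_cons]
      omega
  exact (Nat.le_add_right _ _).trans (h t ht)

end Valid

lemma Stk.get {f g : ℕ → ℕ} {τ l : List (ℕ × ℕ)} {e : ℕ × ℕ} (h : Stk f g (τ ++ e :: l)) :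
    f l.length = e.1 ∧ g l.length = e.2 := by
  induction τ with
  | nil => exact ⟨h.1, h.2.1⟩
  | cons e' τ ih => exact ih h.2.2

/-- Prints the edge, if any, of the trail entry whose index is in register `5`. -/
def printEntry : Prog :=
  .seq (block [.load 6 4 5, .load 7 5 5, .add 5 5 2])
    (.ite (.eq 7 1) .nop (block [.sub 7 7 2, .print 6, .print 7]))

/-- Prints the edges of the trail from the index in register `5`. -/
def printLoop : Prog := .loop (.lt 5 4) printEntry

/-- Prints the edges of the trail. -/
def printProg : Prog := .seq (block [.const 5 0]) printLoop

lemma printEntry_runs {e : Fin n × Option (Fin n)} (h1 : S.reg 1 = 0) (h2 : S.reg 2 = 1)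
    (h6 : S.arr 4 (S.reg 5) = (encEntry e).1) (h7 : S.arr 5 (S.reg 5) = (encEntry e).2)
    (hout : S.out = word (pairs t)) :
    ∃ S', Runs printEntry S 16 S' ∧ S'.arr = S.arr ∧ S'.reg 1 = 0 ∧ S'.reg 2 = 1 ∧
      S'.reg 4 = S.reg 4 ∧ S'.reg 5 = S.reg 5 + 1 ∧ S'.out = word (pairs (e :: t)) := by
  have r1 := Runs.block [.load 6 4 5, .load 7 5 5, .add 5 5 2] S
  set S1 := ([.load 6 4 5, .load 7 5 5, .add 5 5 2] : List Op).foldl Op.exec S with hS1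
  have a1 : S1.arr = S.arr := by simp [hS1, Op.exec]
  have b1 : S1.reg 1 = 0 := by simp [hS1, Op.exec, h1]
  have b2 : S1.reg 2 = 1 := by simp [hS1, Op.exec, h2]
  have b4 : S1.reg 4 = S.reg 4 := by simp [hS1, Op.exec]
  have b5 : S1.reg 5 = S.reg 5 + 1 := by simp [hS1, Op.exec, h2]
  have b6 : S1.reg 6 = e.1 := by simp [hS1, Op.exec, h6, encEntry]
  have b7 : S1.reg 7 = encMate e.2 := by simp [hS1, Op.exec, h7, encEntry]
  have o1 : S1.out = word (pairs t) := by simp [hS1, Op.exec, hout]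
  obtain ⟨v, _ | u⟩ := e
  · refine ⟨S1, (r1.seq ((Runs.nop S1).ite_pos (by rw [b7, b1]; rfl))).mono (by simp), a1, b1, b2, b4,
      b5, o1⟩
  · have r2 := Runs.block [.sub 7 7 2, .print 6, .print 7] S1
    refine ⟨_, (r1.seq (r2.ite_neg (by rw [b7, b1]; simp [encMate]))).mono (by simp), ?_, ?_, ?_, ?_,
      ?_, ?_⟩
    · simp [Op.exec, a1]
    · simp [Op.exec, b1]
    · simp [Op.exec, b2]
    · simp [Op.exec, b4]
    · simp [Op.exec, b5]
    · simp [Op.exec, o1, b6, b7, b2, encMate, word, pairs]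

/-- The trail is printed from its oldest entry upward, so the induction peels `τ` from its end. -/
lemma printLoop_runs (τ : Trail (Fin n)) (h1 : S.reg 1 = 0) (h2 : S.reg 2 = 1)
    (h4 : S.reg 4 = (τ ++ t).length) (h5 : S.reg 5 = t.length)
    (hS : Stk (S.arr 4) (S.arr 5) ((τ ++ t).map encEntry)) (hout : S.out = word (pairs t)) :
    ∃ S', Runs printLoop S (17 * τ.length + 1) S' ∧ S'.out = word (pairs (τ ++ t)) := by
  induction τ using List.reverseRecOn generalizing S t with
  | nil => exact ⟨S, Runs.loop_done (by rw [h5, h4]; simp), hout⟩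
  | append_singleton τ e ih =>
    rw [List.append_assoc, List.singleton_append] at *
    have hget := Stk.get (f := S.arr 4) (g := S.arr 5) (τ := τ.map encEntry) (l := t.map encEntry)
      (e := encEntry e) (by simpa using hS)
    rw [List.length_map, ← h5] at hget
    obtain ⟨S1, r1, a1, b1, b2, b4, b5, o1⟩ := printEntry_runs h1 h2 hget.1 hget.2 hout
    obtain ⟨S2, r2, o2⟩ := ih b1 b2 (b4.trans h4) (by rw [b5, h5]; rfl) (by rw [a1]; exact hS) o1
    refine ⟨S2, (Runs.loop_step ?_ r1 r2).mono ?_, o2⟩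
    · rw [h5, h4]
      simp only [List.length_append, List.length_cons]
      omega
    · simp only [List.length_append, List.length_cons, List.length_nil]
      omega

lemma printProg_runs (h : Mem A lam t r H W S) :
    ∃ S', Runs printProg S (17 * t.length + 5) S' ∧ S'.out = word (pairs t) := by
  have r1 := Runs.block [.const 5 0] S
  set S1 := ([.const 5 0] : List Op).foldl Op.exec S with hS1
  have h1 := h.base.zero
  have h2 := h.base.one
  obtain ⟨S2, r2, o2⟩ := printLoop_runs (S := S1) (t := []) t (by simp [hS1, Op.exec, h1])
    (by simp [hS1, Op.exec, h2]) (by simp [hS1, Op.exec, h.th]) (by simp [hS1, Op.exec])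
    (by simpa [hS1, Op.exec] using h.trail) (by simpa [hS1, Op.exec, word, pairs] using h.out)
  refine ⟨S2, (r1.seq r2).mono ?_, by simpa using o2⟩
  simp only [List.length_cons, List.length_nil]
  omega

/-! ### The whole program -/

/-- Schedules all vertices. -/
def pushAll : Prog := .loop (.lt 3 0) (pushDec 3)

/-- The number of scheduled tasks doubles as the next vertex to be scheduled, so the loop runs until
register `3` reaches `n`. -/
lemma pushAll_runs (d : ℕ) (L : List (Fin n)) (hL : ∀ v : Fin n, (v : ℕ) < L.length → v ∈ L)
    (hd : L.length + d = n) (h : Mem A lam [] (L.map .dec) H W S) (h0 : S.reg 0 = n) :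
    ∃ (L' : List (Fin n)) (S' : State), Runs pushAll S (8 * d + 1) S' ∧ Mem A lam [] (L'.map .dec) H W S' ∧
      L'.length = n ∧ ∀ v : Fin n, v ∈ L' := by
  induction d generalizing L S with
  | zero =>
    refine ⟨L, S, Runs.loop_done ?_, h, hd, fun v => hL v (by omega)⟩
    rw [h.sp, h0, List.length_map]
    omega
  | succ d ih =>
    have h3 : S.reg 3 = L.length := by rw [h.sp, List.length_map]
    obtain ⟨S1, r1, m1, e1⟩ := pushDec_runs (v := ⟨L.length, by omega⟩) h h3
    have hL1 : ∀ v : Fin n, (v : ℕ) < (⟨L.length, by omega⟩ :: L : List (Fin n)).length →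
        v ∈ (⟨L.length, by omega⟩ :: L : List (Fin n)) := by
      intro v hv
      rcases Nat.lt_succ_iff_lt_or_eq.1 hv with hv | hv
      · exact List.mem_cons_of_mem _ (hL v hv)
      · exact List.mem_cons.2 (.inl (Fin.ext hv))
    obtain ⟨L', S2, r2, m2, l2⟩ := ih _ hL1 (by rw [List.length_cons]; omega) m1
      ((e1 0 (by omega)).trans h0)
    refine ⟨L', S2, (Runs.loop_step ?_ r1 r2).mono (by omega), m2, l2⟩
    rw [h3, h0]
    omega

/-- The sampler. -/
def samplerProg (m N : ℕ) : Prog :=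
  .seq (block [.const 2 1]) (.seq pushAll (.seq (mainLoop m N) printProg))

/-- The cost of the sampler per vertex. -/
def samplerCost (Δ m N : ℕ) (D : ℝ) : ℝ :=
  25 + roundTime Δ m N + 2 * (roundTime Δ m N * (1 + D) +
    roundTime Δ m N * (ballBound Δ (2 * m + 4) + 1))

/-- The codes are chosen so that zeroed memory represents the empty trail with all vertices alive
and unmarked; only the constant `1` must be set up. -/
lemma mem_input (A : AdjLists G) (lam : ℝ) :
    Mem A lam [] [] Finset.univ ∅ (([.const 2 1] : List Op).foldl Op.exec (A.input lam)) := by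
  refine ⟨⟨⟨?_, ?_⟩, ?_, ?_, ?_⟩, ?_, ?_, trivial, trivial, fun x => ?_, fun x => ?_, ?_⟩ <;>
    simp [Op.exec, AdjLists.input]

section Bound

variable [DecidableRel G.Adj] {Φ : Config → ℝ} {ρ : ℝ} {m N Δ : ℕ}

lemma potential_nil_le (hΦ : Super Φ ρ) (g : Finset (Sym2 (Fin n)) → ℝ) (hg : ∀ M, 0 ≤ g M)
    (hout : ∀ S M, S.out ∈ edgeListings M → Φ ([], S) ≤ g M) (ht : Valid G t) :
    potential A lam m N [printProg] Φ t [] ≤ ρ * (17 * n + 6) + g (edges t) := by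
  have h0 : 0 ≤ ρ * (17 * (n : ℝ) + 6) := mul_nonneg hΦ.cost (by positivity)
  refine Real.iSup_le (fun S => ?_) (add_nonneg h0 (hg _))
  obtain ⟨S, hS⟩ := S
  have e1 := hΦ.loop_lt 1 3 (roundProg m N) [printProg] S
  rw [if_neg (by rw [hS.sp]; simp)] at e1
  obtain ⟨S', r2, o2⟩ := printProg_runs hS
  have e2 := r2 Φ ρ hΦ []
  have e3 := hout S' _ (by rw [o2]; exact word_mem_edgeListings ht)
  have e4 := cost_le hΦ (show 17 * t.length + 5 ≤ 17 * n + 5 by have := ht.length_le; omega)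
  push_cast at e2 e4
  simp only [mainLoop]
  linarith

/-- The potential of the sampler. -/
lemma samplerProg_bound (hlam : 0 < lam) (hΔ : ∀ v, (A.nbrs v).length ≤ Δ) (hmN : 2 * m + 1 ≤ N)
    {D ε s : ℝ}
    (hN : ∀ v, (Finset.univ.filter fun x => G.edist v x < (2 * m + 4 : ℕ)).card < N)
    (hD : ∀ (H : Finset (Fin n)) (v : Fin n), lam * ((H.filter (G.Adj v)).card : ℝ) ≤ D) (hD0 : 0 ≤ D)
    (hε : ∀ (H : Finset (Fin n)) (v : Fin n),
      T G lam (2 * m + 1) H v ≤ (1 + ε) * T G lam (2 * m) H v)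
    (hε0 : 0 ≤ ε) (hε1 : ε ≤ 1) (hεs : ε * s ≤ 1 / 2)
    (hs : ∀ v, (((Finset.univ.filter fun x => G.edist v x = (2 * m + 4 : ℕ)).card : ℕ) : ℝ) ≤ s)
    (hΦ : Super Φ ρ) (g : Finset (Sym2 (Fin n)) → ℝ) (hg : ∀ M, 0 ≤ g M)
    (hout : ∀ S M, S.out ∈ edgeListings M → Φ ([], S) ≤ g M) :
    Φ ([samplerProg m N], A.input lam) ≤
      ρ * (samplerCost Δ m N D * (n + 1)) +
      wsum G lam Finset.univ g / Z G lam Finset.univ := by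
  have r1 := Runs.block [.const 2 1] (A.input lam)
  obtain ⟨L, S2, r2, m2, hlen, hL⟩ := pushAll_runs n [] (by simp) (by simp) (mem_input A lam)
    (by simp [Op.exec, AdjLists.input])
  have e0 := hΦ.seq (block [.const 2 1]) (.seq pushAll (.seq (mainLoop m N) printProg)) [] (A.input lam)
  have e1 := r1 Φ ρ hΦ [.seq pushAll (.seq (mainLoop m N) printProg)]
  have e2 := hΦ.seq pushAll (.seq (mainLoop m N) printProg) []
    (([.const 2 1] : List Op).foldl Op.exec (A.input lam))
  have e3 := r2 Φ ρ hΦ [.seq (mainLoop m N) printProg]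
  have e4 := hΦ.seq (mainLoop m N) printProg [] S2
  have e5 := (potential_dominates (A := A) (lam := lam) (m := m) (N := N) (k := [printProg]) hΦ).2 [] _ S2
    trivial m2
  have hsph : ∀ v w, w ∈ sphereList A (2 * m + 3) v ↔ G.edist v w = (2 * m + 4 : ℕ) := fun v w => by
    rw [mem_sphereList]
  have e6 := chain_total hlam (potential_chainBound (A := A) (m := m) (N := N) (k := [printProg]) hlam hΔ
    hmN hΦ) hΦ.cost (Nat.cast_nonneg _) hsph hN hD hD0 hε hε0 hε1 hεs
    (B := ballBound Δ (2 * m + 4)) (fun v => Nat.cast_le.2 (length_sphereList hΔ _ v))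
    (fun v => by
      refine le_trans (le_of_eq ?_) (hs v)
      congr 2
      ext w
      simp [hsph]) (Nat.cast_nonneg _) g (ρ * (17 * n + 6))
    (fun t ht => potential_nil_le hΦ g hg hout ht) L hL
  rw [hlen, Fintype.card_fin] at e6
  simp only [List.length_cons, List.length_nil] at e1
  push_cast at e1 e3
  have hc : 0 ≤ ρ * ((12 : ℝ) + roundTime Δ m N + 2 * (roundTime Δ m N * (1 + D) +
      roundTime Δ m N * (ballBound Δ (2 * m + 4) + 1))) := mul_nonneg hΦ.cost (by positivity)
  simp only [samplerProg, samplerCost]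
  have e7 : Φ ([.seq (block [.const 2 1]) (.seq pushAll (.seq (mainLoop m N) printProg))], A.input lam) ≤
      ρ * (8 * n + 7) + Φ (mainLoop m N :: [printProg], S2) := by linarith
  linarith

end Bound

end MatchingSampler
end

/-! ### From bounds on potentials to the running time and the output distribution. -/

noncomputable section
namespace MatchingSampler

open RAM

/-! ### Expectations -/

/-- The expectation of a nonnegative function. -/
def mean {α : Type*} (p : PMF α) (F : α → ℝ≥0∞) : ℝ≥0∞ := ∑' a, p a * F a

section Mean

variable {α β : Type*}

lemma mean_pure (a : α) (F : α → ℝ≥0∞) : mean (PMF.pure a) F = F a := by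
  rw [mean, tsum_eq_single a]
  · simp
  · intro b hb
    simp [hb]

lemma mean_bind (p : PMF α) (q : α → PMF β) (F : β → ℝ≥0∞) :
    mean (p.bind q) F = mean p fun a => mean (q a) F := by
  simp only [mean, PMF.bind_apply, ← ENNReal.tsum_mul_right, ← ENNReal.tsum_mul_left]
  rw [ENNReal.tsum_comm]
  simp only [mul_assoc]

lemma mean_map (p : PMF α) (f : α → β) (F : β → ℝ≥0∞) :
    mean (p.map f) F = mean p fun a => F (f a) := by
  rw [← PMF.bind_pure_comp, mean_bind]
  simp only [Function.comp_apply, mean_pure]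

lemma mean_mono (p : PMF α) {F F' : α → ℝ≥0∞} (h : ∀ a, F a ≤ F' a) : mean p F ≤ mean p F' :=
  ENNReal.tsum_le_tsum fun a => mul_le_mul_right (h a) (p a)

lemma mean_add (p : PMF α) (F F' : α → ℝ≥0∞) :
    (mean p fun a => F a + F' a) = mean p F + mean p F' := by
  simp only [mean, mul_add, ENNReal.tsum_add]

lemma mean_const (p : PMF α) (c : ℝ≥0∞) : (mean p fun _ => c) = c := by
  rw [mean, ENNReal.tsum_mul_right, p.tsum_coe, one_mul]

lemma toOuterMeasure_eq_mean (p : PMF α) (X : Set α) :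
    p.toOuterMeasure X = mean p (X.indicator 1) := by
  rw [PMF.toOuterMeasure_apply, mean]
  refine tsum_congr fun a => ?_
  by_cases h : a ∈ X <;> simp [h]

end Mean

/-- The expectation after one step. -/
def next (F : Config → ℝ≥0∞) (c : Config) : ℝ≥0∞ := mean (step c) F

lemma next_halted (F : Config → ℝ≥0∞) (S : State) : next F ([], S) = F ([], S) := mean_pure _ _

lemma next_mono {F F' : Config → ℝ≥0∞} (h : F ≤ F') : next F ≤ next F' :=
  fun c => mean_mono (step c) h

lemma iterate_next_mono (t : ℕ) {F F' : Config → ℝ≥0∞} (h : F ≤ F') :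
    next^[t] F ≤ next^[t] F' := Monotone.iterate (fun _ _ => next_mono) t h

lemma iterate_next_halted (t : ℕ) (F : Config → ℝ≥0∞) (S : State) :
    next^[t] F ([], S) = F ([], S) := by
  induction t with
  | zero => rfl
  | succ t ih => rw [Function.iterate_succ_apply', next_halted, ih]

lemma iterate_next_add (t : ℕ) (F F' : Config → ℝ≥0∞) :
    next^[t] (F + F') = next^[t] F + next^[t] F' := by
  induction t generalizing F F' with
  | zero => rfl
  | succ t ih =>
    have : next (F + F') = next F + next F' := funext fun c => mean_add (step c) F F'
    rw [Function.iterate_succ_apply, this, ih]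
    rfl

lemma iterate_next_one (t : ℕ) : next^[t] 1 = 1 := by
  induction t with
  | zero => rfl
  | succ t ih =>
    rw [Function.iterate_succ_apply', ih]
    exact funext fun c => mean_const (step c) 1

/-- Instead of pushing the law forward, the test function is pulled back to the initial
configuration. -/
lemma law_mean (P : Prog) (S : State) (t : ℕ) (F : Config → ℝ≥0∞) :
    mean (law P S t) F = next^[t] F ([P], S) := by
  induction t generalizing F with
  | zero => exact mean_pure _ _
  | succ t ih =>
    rw [law, mean_bind, Function.iterate_succ_apply, ← ih]
    rfl

/-- A function that exceeds its expectation after one step by at most `ρ` yields a potential. -/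
lemma super_of_le_next {F : Config → ℝ≥0∞} {ρ : ℝ} (hρ : 0 ≤ ρ) {B : ℝ≥0∞} (hB : B ≠ ∞)
    (hF : ∀ c, F c ≤ B) (h : ∀ c, F c ≤ ENNReal.ofReal ρ + next F c) :
    Super (fun c => (F c).toReal) ρ := by
  have hfin : ∀ c, F c ≠ ∞ := fun c => ne_top_of_le_ne_top hB (hF c)
  have key : ∀ c c', next F c = F c' → (F c).toReal ≤ ρ + (F c').toReal := by
    intro c c' hc
    have := h c
    rw [hc] at this
    have := ENNReal.toReal_mono (by simp [hfin]) this
    rwa [ENNReal.toReal_add ENNReal.ofReal_ne_top (hfin _), ENNReal.toReal_ofReal hρ] at this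
  refine ⟨hρ, fun c => ENNReal.toReal_nonneg, ⟨B.toReal, fun c => ENNReal.toReal_mono hB (hF c)⟩,
    fun k S => key _ _ (mean_pure _ _), fun o k S => key _ _ (mean_pure _ _),
    fun p q k S => key _ _ (mean_pure _ _), fun i j p q k S => key _ _ ?_,
    fun i j p k S => key _ _ ?_, fun i p q k S h0 h1 => ?_⟩
  · simp only [next, step, Test.law, mean_map, mean_pure, decide_eq_true_eq]
    split_ifs <;> rfl
  · simp only [next, step, Test.law, mean_map, mean_pure, decide_eq_true_eq]
  · have h2 : next F (.ite (.coin i) p q :: k, S) =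
        ENNReal.ofReal (S.rreg i) * F (p :: k, S) + ENNReal.ofReal (1 - S.rreg i) * F (q :: k, S) := by
      have h3 : ENNReal.ofReal (S.rreg i) ≤ 1 := ENNReal.ofReal_le_one.2 h1
      simp only [next, step, Test.law, mean_map]
      rw [mean, tsum_bool, coinFlip]
      simp only [PMF.ofFintype_apply, if_true, min_eq_left h3, Bool.false_eq_true, if_false]
      rw [ENNReal.ofReal_sub _ h0, ENNReal.ofReal_one, add_comm]
    have h4 := h (.ite (.coin i) p q :: k, S)
    rw [h2] at h4
    have h5 := ENNReal.toReal_mono (by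
      simp [hfin, ENNReal.mul_eq_top]) h4
    rwa [ENNReal.toReal_add ENNReal.ofReal_ne_top (by simp [hfin, ENNReal.mul_eq_top]),
      ENNReal.toReal_add (by simp [hfin, ENNReal.mul_eq_top]) (by simp [hfin, ENNReal.mul_eq_top]),
      ENNReal.toReal_mul, ENNReal.toReal_mul, ENNReal.toReal_ofReal hρ, ENNReal.toReal_ofReal h0,
      ENNReal.toReal_ofReal (sub_nonneg.2 h1)] at h5

/-- The indicator of the configurations that have not halted. -/
def running : Config → ℝ≥0∞ := Set.indicator {c | c.1 ≠ []} 1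

/-- The indicator of the configurations that have halted with an output in `X`. -/
def haltedIn (X : Set (List ℕ)) : Config → ℝ≥0∞ := Set.indicator {c | c.1 = [] ∧ c.2.out ∈ X} 1

/-- Halted configurations do not move, so the probability of having halted with a given output can
only grow. -/
lemma haltedIn_le_next (X : Set (List ℕ)) : haltedIn X ≤ next (haltedIn X) := by
  rintro ⟨k, S⟩
  cases k with
  | nil => rw [next_halted]
  | cons p k => simp [haltedIn]

lemma haltedIn_le_one (X : Set (List ℕ)) : haltedIn X ≤ 1 := Set.indicator_le_self' (by simp)

lemma super_haltedIn (X : Set (List ℕ)) (t : ℕ) :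
    Super (fun c => (next^[t] (haltedIn X) c).toReal) 0 := by
  refine super_of_le_next le_rfl ENNReal.one_ne_top (fun c => ?_) fun c => ?_
  · exact (iterate_next_mono t (haltedIn_le_one X) c).trans (by rw [iterate_next_one]; rfl)
  · rw [ENNReal.ofReal_zero, zero_add, ← Function.iterate_succ_apply' next,
      Function.iterate_succ_apply]
    exact iterate_next_mono t (haltedIn_le_next X) c

lemma next_sum (s : Finset ℕ) (F : ℕ → Config → ℝ≥0∞) (c : Config) :
    next (fun c => ∑ i ∈ s, F i c) c = ∑ i ∈ s, next (F i) c := by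
  simp only [next, mean, Finset.mul_sum]
  exact Summable.tsum_finsetSum fun i _ => ENNReal.summable

/-- One more step shifts the summands, so only the first one, which is at most `1`, is lost.
Truncation at `t` makes the potential bounded before the expected time is known to be finite. -/
lemma super_running (t : ℕ) :
    Super (fun c => (∑ s ∈ Finset.range t, next^[s] running c).toReal) 1 := by
  have h1 : ∀ s c, next^[s] running c ≤ 1 := fun s c =>
    (iterate_next_mono s (Set.indicator_le_self' (by simp)) c).trans (by rw [iterate_next_one]; rfl)
  refine super_of_le_next zero_le_one (ENNReal.natCast_ne_top t) (fun c => ?_) fun c => ?_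
  · refine (Finset.sum_le_sum fun s _ => h1 s c).trans ?_
    simp
  · rw [next_sum]
    refine (Finset.sum_le_sum_of_subset (Finset.range_mono t.le_succ)).trans ?_
    rw [Finset.sum_range_succ', add_comm, ENNReal.ofReal_one]
    refine add_le_add (h1 0 c) (le_of_eq ?_)
    exact Finset.sum_congr rfl fun s _ => by rw [Function.iterate_succ_apply']

/-! ### Perfect sampling from bounds on potentials -/

lemma word_injective {n : ℕ} : Function.Injective (word (n := n)) := by
  intro l
  induction l with
  | nil =>
    intro l' h
    cases l' with
    | nil => rfl
    | cons p l' => simp [word] at h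
  | cons p l ih =>
    intro l' h
    cases l' with
    | nil => simp [word] at h
    | cons p' l' =>
      simp only [word, List.flatMap_cons, List.cons_append, List.nil_append, List.cons.injEq] at h
      rw [ih h.2.2, Prod.ext (Fin.ext h.1) (Fin.ext h.2.1)]

/-- A word determines its list of pairs and hence its edge set, so the output events for different
edge sets are disjoint. -/
lemma edgeListings_unique {n : ℕ} {M M' : Finset (Sym2 (Fin n))} {w : List ℕ}
    (h : w ∈ edgeListings M) (h' : w ∈ edgeListings M') : M = M' := by
  obtain ⟨l, -, h2, h3⟩ := h
  obtain ⟨l', -, h2', h3'⟩ := h'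
  have : l = l' := word_injective (h3.symm.trans h3')
  subst this
  ext e
  rw [← h2, h2']

section Sampling

variable {n : ℕ} {P : Prog} {S₀ : State} {K : ℝ} {p : Finset (Sym2 (Fin n)) → ℝ}

variable (P S₀ K p) in
/-- Every potential with cost `ρ` is at most `ρ * K` plus the expectation with respect to `p` of a
bound on its values for final states. -/
def SuperBound : Prop :=
  ∀ (Φ : Config → ℝ) (ρ : ℝ) (g : Finset (Sym2 (Fin n)) → ℝ), Super Φ ρ → (∀ M, 0 ≤ g M) →
    (∀ S M, S.out ∈ edgeListings M → Φ ([], S) ≤ g M) → Φ ([P], S₀) ≤ ρ * K + ∑ M, p M * g M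

lemma expectedTime_le_of_super (hb : SuperBound P S₀ K p) : expectedTime P S₀ ≤ ENNReal.ofReal K := by
  simp only [expectedTime, toOuterMeasure_eq_mean, law_mean]
  rw [ENNReal.tsum_eq_iSup_nat]
  refine iSup_le fun t => ?_
  have h1 : ∀ c, ∑ s ∈ Finset.range t, next^[s] running c ≠ ∞ := by
    intro c
    refine ENNReal.sum_ne_top.2 fun s _ => ne_top_of_le_ne_top ENNReal.one_ne_top ?_
    exact (iterate_next_mono s (Set.indicator_le_self' (by simp)) c).trans
      (by rw [iterate_next_one]; rfl)
  have h2 := hb _ _ (fun _ => 0) (super_running t) (fun _ => le_rfl) fun S M _ => by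
    simp [iterate_next_halted, running]
  change ∑ s ∈ Finset.range t, next^[s] running ([P], S₀) ≤ _
  rw [← ENNReal.ofReal_toReal (h1 ([P], S₀))]
  exact ENNReal.ofReal_le_ofReal (by simpa using h2)

/-- Potentials yield only upper bounds. The lower bound comes from the complement: at each time, the
probabilities of the right output, of a wrong output and of still running add up to one, and the
last tends to zero because the expected time is finite. -/
lemma outputProb_of_super (hb : SuperBound P S₀ K p) (hp0 : ∀ M, 0 ≤ p M) (hp : ∑ M, p M = 1)
    (M₀ : Finset (Sym2 (Fin n))) :
    outputProb P S₀ (edgeListings M₀) = ENNReal.ofReal (p M₀) := by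
  classical
  have hrun : Tendsto (fun t => next^[t] running ([P], S₀)) atTop (nhds 0) := by
    refine ENNReal.tendsto_atTop_zero_of_tsum_ne_top ?_
    have := expectedTime_le_of_super hb
    simp only [expectedTime, toOuterMeasure_eq_mean, law_mean] at this
    exact ne_top_of_le_ne_top ENNReal.ofReal_ne_top this
  have hfin : ∀ X t, next^[t] (haltedIn X) ([P], S₀) ≠ ∞ := fun X t =>
    ne_top_of_le_ne_top ENNReal.one_ne_top
      ((iterate_next_mono t (haltedIn_le_one X) _).trans (by rw [iterate_next_one]; rfl))
  have hup : ∀ t, next^[t] (haltedIn (edgeListings M₀)) ([P], S₀) ≤ ENNReal.ofReal (p M₀) := by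
    intro t
    have h2 := hb _ _ (fun M => if M = M₀ then 1 else 0) (super_haltedIn (edgeListings M₀) t)
      (fun M => by split_ifs <;> simp) fun S M hM => by
        rw [iterate_next_halted]
        by_cases h : S.out ∈ edgeListings M₀
        · rw [if_pos (edgeListings_unique hM h)]
          simp [haltedIn, h]
        · have : haltedIn (edgeListings M₀) ([], S) = 0 := by simp [haltedIn, h]
          rw [this]
          split_ifs <;> simp
    rw [← ENNReal.ofReal_toReal (hfin _ t)]
    exact ENNReal.ofReal_le_ofReal (by simpa using h2)
  -- The complement also contains words that list no edge set. `SuperBound` imposes no condition on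
  -- the potential there, so it implicitly rules such outputs out.
  have hlow : ∀ t, next^[t] (haltedIn (edgeListings M₀)ᶜ) ([P], S₀) ≤ ENNReal.ofReal (1 - p M₀) := by
    intro t
    have h2 := hb _ _ (fun M => if M = M₀ then 0 else 1) (super_haltedIn (edgeListings M₀)ᶜ t)
      (fun M => by split_ifs <;> simp) fun S M hM => by
        rw [iterate_next_halted]
        split_ifs with h
        · subst h
          simp [haltedIn, hM]
        · exact ENNReal.toReal_mono ENNReal.one_ne_top (haltedIn_le_one _ _)
    have h3 : ∑ M, p M * (if M = M₀ then 0 else 1) = 1 - p M₀ := by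
      refine eq_sub_of_add_eq (Eq.trans ?_
        ((Finset.sum_erase_add _ p (Finset.mem_univ M₀)).trans hp))
      rw [← Finset.sum_erase_add _ _ (Finset.mem_univ M₀), if_pos rfl, mul_zero, add_zero]
      refine congrArg (· + p M₀) (Finset.sum_congr rfl fun M hM => ?_)
      rw [if_neg (Finset.ne_of_mem_erase hM), mul_one]
    rw [h3] at h2
    rw [← ENNReal.ofReal_toReal (hfin _ t)]
    exact ENNReal.ofReal_le_ofReal (by simpa using h2)
  have hsum : ∀ t, 1 = next^[t] (haltedIn (edgeListings M₀)) ([P], S₀) +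
      next^[t] (haltedIn (edgeListings M₀)ᶜ) ([P], S₀) + next^[t] running ([P], S₀) := by
    intro t
    have h1 : (1 : Config → ℝ≥0∞) =
        haltedIn (edgeListings M₀) + haltedIn (edgeListings M₀)ᶜ + running := by
      funext c
      by_cases h : c.1 = [] <;> by_cases h' : c.2.out ∈ edgeListings M₀ <;>
        simp [haltedIn, running, h, h']
    have h2 := congrFun (iterate_next_one t) ([P], S₀)
    nth_rw 1 [h1] at h2
    rw [iterate_next_add, iterate_next_add] at h2
    exact h2.symm
  have hout : outputProb P S₀ (edgeListings M₀) =
      ⨆ t, next^[t] (haltedIn (edgeListings M₀)) ([P], S₀) := by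
    simp only [outputProb, toOuterMeasure_eq_mean, law_mean]
    rfl
  rw [hout]
  refine le_antisymm (iSup_le hup) ?_
  set s := ⨆ t, next^[t] (haltedIn (edgeListings M₀)) ([P], S₀)
  have h1 : (1 : ℝ≥0∞) ≤ s + ENNReal.ofReal (1 - p M₀) + 0 := by
    refine ge_of_tendsto' (hrun.const_add _) fun t => ?_
    rw [hsum t]
    exact add_le_add (add_le_add (le_iSup
      (fun t => next^[t] (haltedIn (edgeListings M₀)) ([P], S₀)) t) (hlow t)) le_rfl
  have hs : s ≠ ∞ := ne_top_of_le_ne_top ENNReal.ofReal_ne_top (iSup_le hup)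
  have h0 : 0 ≤ 1 - p M₀ := sub_nonneg.2 (hp ▸ Finset.single_le_sum (fun M _ => hp0 M) (Finset.mem_univ M₀))
  rw [add_zero, ← ENNReal.ofReal_toReal hs, ← ENNReal.ofReal_add ENNReal.toReal_nonneg h0,
    ← ENNReal.ofReal_one] at h1
  have h2 := (ENNReal.ofReal_le_ofReal_iff (add_nonneg ENNReal.toReal_nonneg h0)).1 h1
  rw [← ENNReal.ofReal_toReal hs]
  exact ENNReal.ofReal_le_ofReal (by linarith)

end Sampling

end MatchingSampler
end

/-! ### The truncation depth, the Gibbs distribution, and the theorem. -/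

noncomputable section
namespace MatchingSampler

open RAM

/-! ### The choice of the truncation depth -/

/-- Eventually `f ℓ` is at most half of `-log κ * ℓ`, so `κ ^ ℓ * s ℓ` is still dominated by a
decaying geometric sequence. -/
lemma exists_depth {s : ℕ → ℕ} {f : ℕ → ℝ} (hf : f =o[atTop] (fun ℓ : ℕ => (ℓ : ℝ)))
    (hs : ∀ ℓ, (s ℓ : ℝ) = Real.exp (f ℓ)) {κ : ℝ} (h0 : 0 < κ) (h1 : κ < 1) (C : ℝ) :
    ∃ m : ℕ, 1 ≤ m ∧ C * κ ^ (2 * m - 1) * s (2 * m + 4) ≤ 1 / 2 := by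
  have hlog : Real.log κ < 0 := Real.log_neg h0 h1
  have hle : ∀ᶠ ℓ : ℕ in atTop, κ ^ ℓ * (s ℓ : ℝ) ≤ Real.exp (Real.log κ / 2) ^ ℓ := by
    filter_upwards [hf.bound (show 0 < -Real.log κ / 2 by linarith)] with ℓ hℓ
    rw [hs, ← Real.exp_log h0, ← Real.exp_nat_mul, ← Real.exp_nat_mul, ← Real.exp_add, Real.log_exp]
    have h2 := (le_abs_self _).trans hℓ
    rw [Real.norm_natCast] at h2
    exact Real.exp_le_exp.2 (by linarith)
  have hlim : Tendsto (fun ℓ : ℕ => κ ^ ℓ * (s ℓ : ℝ)) atTop (nhds 0) :=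
    squeeze_zero' (Eventually.of_forall fun ℓ => by positivity) hle
      (tendsto_pow_atTop_nhds_zero_of_lt_one (Real.exp_pos _).le (Real.exp_lt_one_iff.2 (by linarith)))
  have hsub : Tendsto (fun m : ℕ => 2 * m + 4) atTop atTop :=
    tendsto_atTop_mono (fun m => by simp only [id]; omega) tendsto_id
  -- The factor `κ ^ 5` compensates for the difference between the exponents `2 * m + 4` and `2 * m
  -- - 1`.
  have hlim' := (hlim.comp hsub).const_mul (C / κ ^ 5)
  rw [mul_zero] at hlim'
  obtain ⟨m, hm, hm1⟩ := ((hlim'.eventually_le_const (show (0 : ℝ) < 1 / 2 by norm_num)).and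
    (eventually_ge_atTop 1)).exists
  refine ⟨m, hm1, le_trans (le_of_eq ?_) hm⟩
  have h5 : κ ^ (2 * m + 4) = κ ^ (2 * m - 1) * κ ^ 5 := by
    rw [← pow_add]
    congr 1
    omega
  simp only [Function.comp_apply, h5]
  field_simp

/-! ### Spheres and degrees -/

section Spheres

variable {n : ℕ} {G : SimpleGraph (Fin n)} {s : ℕ → ℕ} {v : Fin n}

lemma card_edist_eq_le (hs : ∀ ℓ, (G.sphereAt v ℓ).ncard ≤ s ℓ) (ℓ : ℕ) :
    (Finset.univ.filter fun x => G.edist v x = (ℓ : ℕ)).card ≤ s ℓ := by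
  refine le_trans (le_of_eq ?_) (hs ℓ)
  rw [← Set.ncard_coe_finset]
  congr 1
  ext x
  simp [SimpleGraph.sphereAt]

lemma card_edist_lt_le (hs : ∀ ℓ, (G.sphereAt v ℓ).ncard ≤ s ℓ) (ℓ : ℕ) :
    (Finset.univ.filter fun x => G.edist v x < (ℓ : ℕ)).card ≤ ∑ j ∈ Finset.range ℓ, s j := by
  have h : (Finset.univ.filter fun x => G.edist v x < (ℓ : ℕ)) ⊆
      (Finset.range ℓ).biUnion fun j => Finset.univ.filter fun x => G.edist v x = (j : ℕ) := by
    intro x hx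
    have hx := (Finset.mem_filter.1 hx).2
    obtain ⟨j, hj⟩ := ENat.ne_top_iff_exists.1 hx.ne_top
    rw [← hj, Nat.cast_lt] at hx
    exact Finset.mem_biUnion.2 ⟨j, Finset.mem_range.2 hx, by simp [hj]⟩
  exact (Finset.card_le_card h).trans (Finset.card_biUnion_le.trans
    (Finset.sum_le_sum fun j _ => card_edist_eq_le hs j))

lemma card_filter_adj_le [DecidableRel G.Adj] (hs : ∀ ℓ, (G.sphereAt v ℓ).ncard ≤ s ℓ)
    (H : Finset (Fin n)) : (H.filter (G.Adj v)).card ≤ s 1 := by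
  refine (Finset.card_le_card fun x hx => ?_).trans (card_edist_eq_le hs 1)
  simpa [SimpleGraph.edist_eq_one_iff_adj] using (Finset.mem_filter.1 hx).2

lemma length_nbrs_le (A : AdjLists G) (hs : ∀ ℓ, (G.sphereAt v ℓ).ncard ≤ s ℓ) :
    (A.nbrs v).length ≤ s 1 := by
  rw [← List.toFinset_card_of_nodup (A.nodup v)]
  refine (Finset.card_le_card fun x hx => ?_).trans (card_edist_eq_le hs 1)
  simpa [SimpleGraph.edist_eq_one_iff_adj, A.mem_iff] using hx

end Spheres

/-! ### The Gibbs distribution -/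

section Gibbs

variable (I : MonomerDimer)

lemma sum_weight_mul (g : Finset (Sym2 (Fin I.n)) → ℝ) :
    ∑ M, I.weight M * g M = wsum I.graph.2 I.lam Finset.univ g := by
  classical
  rw [wsum, matchings, Finset.sum_filter]
  refine Finset.sum_congr rfl fun M _ => ?_
  have h : I.IsMatching M ↔ IsMatch I.graph.2 M ∧ ∀ e ∈ M, ∀ x ∈ e, x ∈ Finset.univ :=
    ⟨fun h => ⟨h, fun _ _ _ _ => Finset.mem_univ _⟩, fun h => h.1⟩
  by_cases hM : I.IsMatching M
  · rw [if_pos (h.1 hM), MonomerDimer.weight, if_pos hM]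
  · rw [if_neg (mt h.2 hM), MonomerDimer.weight, if_neg hM, zero_mul]

lemma partitionFunction_eq : I.partitionFunction = Z I.graph.2 I.lam Finset.univ := by
  rw [Z, ← sum_weight_mul]
  simp [MonomerDimer.partitionFunction]

lemma partitionFunction_pos : 0 < I.partitionFunction := by
  classical
  rw [partitionFunction_eq]
  exact Z_pos I.lam_pos _

lemma sum_gibbs_mul (g : Finset (Sym2 (Fin I.n)) → ℝ) :
    ∑ M, I.gibbs M * g M = wsum I.graph.2 I.lam Finset.univ g / Z I.graph.2 I.lam Finset.univ := by
  rw [← sum_weight_mul, ← partitionFunction_eq, Finset.sum_div]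
  exact Finset.sum_congr rfl fun M _ => by rw [MonomerDimer.gibbs]; ring

lemma sum_gibbs : ∑ M, I.gibbs M = 1 := by
  simp only [MonomerDimer.gibbs, ← Finset.sum_div]
  exact div_self (partitionFunction_pos I).ne'

lemma gibbs_nonneg (M : Finset (Sym2 (Fin I.n))) : 0 ≤ I.gibbs M := by
  refine div_nonneg ?_ (partitionFunction_pos I).le
  rw [MonomerDimer.weight]
  split_ifs
  · exact pow_nonneg I.lam_pos.le _
  · exact le_rfl

end Gibbs

/-- The sampler satisfies the bound on potentials, with constants that depend only on the growth
function and on the bound on the edge weight. -/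
lemma samplerProg_superBound {s : ℕ → ℕ} {C : ℝ} {m : ℕ} (hm : 1 ≤ m) (hC : 0 ≤ C) (hs0 : ∀ ℓ, 1 ≤ s ℓ)
    (hε : C * s 1 * (C * s 1 / (1 + C * s 1)) ^ (2 * m - 1) * s (2 * m + 4) ≤ 1 / 2) {N : ℕ}
    (hN : N = ∑ j ∈ Finset.range (2 * m + 4), s j + (2 * m + 1))
    (I : MonomerDimer) (hI : I.lam ≤ C) (hs : ∀ v ℓ, (I.graph.2.sphereAt v ℓ).ncard ≤ s ℓ)
    (A : AdjLists I.graph.2) :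
    SuperBound (samplerProg m N) (A.input I.lam)
      (samplerCost (s 1) m N (C * s 1) * (I.n + 1)) I.gibbs := by
  classical
  intro Φ ρ g hΦ hg hout
  rw [sum_gibbs_mul]
  have hD0 : 0 ≤ C * s 1 := by positivity
  have hD : ∀ (H : Finset (Fin I.n)) (v : Fin I.n),
      I.lam * ((H.filter (I.graph.2.Adj v)).card : ℝ) ≤ C * s 1 := fun H v =>
    mul_le_mul hI (Nat.cast_le.2 (card_filter_adj_le (hs v) H)) (Nat.cast_nonneg _) hC
  have hε0 : 0 ≤ C * s 1 * (C * s 1 / (1 + C * s 1)) ^ (2 * m - 1) := by positivity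
  have hs1 : (1 : ℝ) ≤ s (2 * m + 4) := by exact_mod_cast hs0 (2 * m + 4)
  have hε1 := (le_mul_of_one_le_right hε0 hs1).trans hε
  refine samplerProg_bound I.lam_pos (fun v => length_nbrs_le A (hs v)) (by omega) (fun v => ?_) hD hD0
    (fun H v => ?_) hε0 (hε1.trans (by norm_num)) hε
    (fun v => Nat.cast_le.2 (card_edist_eq_le (hs v) _)) hΦ g hg hout
  · have := card_edist_lt_le (hs v) (2 * m + 4)
    omega
  -- `T_ratio` at `k` compares depths `k + 1` and `k + 2`, so depths `2 * m` and `2 * m + 1` need `k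
  -- = 2 * m - 1`, hence `1 ≤ m`.
  · have := (T_ratio I.lam_pos hD hD0 (2 * m - 1) H v).2
    rwa [show 2 * m - 1 + 2 = 2 * m + 1 by omega, show 2 * m - 1 + 1 = 2 * m by omega] at this

end MatchingSampler
end

open MatchingSampler

theorem mainTheorem6 (𝔐 : Set MonomerDimer)
    (hgrowth : SubexponentialGrowth (MonomerDimer.graph '' 𝔐))
    (hlam : ∃ C : ℝ, ∀ I ∈ 𝔐, I.lam ≤ C) :
    ∃ (P : RAM.Prog) (K : ℕ), ∀ I ∈ 𝔐,
      P.PerfectlySamples I ∧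
        ∀ A : AdjLists I.graph.2,
          RAM.expectedTime P (A.input I.lam) ≤ (K : ℝ≥0∞) * ((I.n : ℝ≥0∞) + 1) := by
  classical
  obtain ⟨s, ⟨f, hf, hsf⟩, hs⟩ := hgrowth
  obtain ⟨C, hC⟩ := hlam
  have hs0 : ∀ ℓ, 1 ≤ s ℓ := fun ℓ => by
    have := Real.exp_pos (f ℓ)
    rw [← hsf] at this
    exact_mod_cast this
  -- Replacing `C` by `max C 1` makes `D` positive, so that the contraction factor lies strictly
  -- between `0` and `1`.
  have hC1 : 0 < max C 1 := lt_max_of_lt_right one_pos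
  have hD : 0 < max C 1 * s 1 := mul_pos hC1 (Nat.cast_pos.2 (hs0 1))
  obtain ⟨m, hm, hε⟩ := exists_depth hf hsf (κ := max C 1 * s 1 / (1 + max C 1 * s 1)) (by positivity)
    (by rw [div_lt_one (by positivity)]; linarith) (max C 1 * s 1)
  -- The sum bounds the open ball of radius `2 * m + 4`; the extra `2 * m + 1` makes the inequality
  -- strict and ensures `2 * m + 1 ≤ N`.
  obtain ⟨N, hN⟩ : ∃ N, N = ∑ j ∈ Finset.range (2 * m + 4), s j + (2 * m + 1) := ⟨_, rfl⟩
  have hb := fun (I : MonomerDimer) (hI : I ∈ 𝔐) (A : AdjLists I.graph.2) =>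
    samplerProg_superBound hm hC1.le hs0 hε hN I ((hC I hI).trans (le_max_left _ _))
      (hs _ ⟨I, hI, rfl⟩) A
  refine ⟨samplerProg m N, ⌈samplerCost (s 1) m N (max C 1 * s 1)⌉₊, fun I hI =>
    ⟨fun A M => outputProb_of_super (hb I hI A) (gibbs_nonneg I) (sum_gibbs I) M, fun A =>
      (expectedTime_le_of_super (hb I hI A)).trans ?_⟩⟩
  rw [ENNReal.ofReal_mul' (by positivity)]
  refine mul_le_mul' ?_ (le_of_eq ?_)
  · rw [← ENNReal.ofReal_natCast]
    exact ENNReal.ofReal_le_ofReal (Nat.le_ceil _)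
  · rw [ENNReal.ofReal_add (Nat.cast_nonneg _) zero_le_one, ENNReal.ofReal_natCast,
      ENNReal.ofReal_one]
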